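/- Denote the nontrivial zeros of the Riemann zeta function, listed with multiplicity, by $\tfrac12+i\gamma_j$ ($j=\pm1,\pm2,\dots$); the Riemann Hypothesis is not assumed, so the $\gamma_j$ may be complex. Let $0<a\le 1$, let $m\ge 1$ be an integer, and put $H=T^a$. Let $f:\mathbb R\to\mathbb R$ be an even, continuous, integrable function whose Fourier transform $\hat f(u)=\int_{-\infty}^\infty f(x)e^{-2\pi i xu}\,dx$ belongs to $C_c^\infty(\mathbb R)$ and satisfies $\operatorname{supp}\hat f\subseteq(-2a/m,\,2a/m)$; write $f$ also for its entire extension $f(z)=\int_{-\infty}^\infty \hat f(u)e^{2\pi i uz}\,du$. For $T>1$ and $\tau\in\mathbb R$ set $$N_f(\tau)=\sum_{j}f\Big(\frac{\log T}{2\pi}(\gamma_j-\tau)\Big).$$ Let $w\ge 0$ be a weight function on $\mathbb R$ with $\int_{-\infty}^\infty w(x)\,dx=1$, with $\hat w$ compactly supported and with $\int_{-\infty}^\infty (\log(1+|x|))^m\,w(x)\,dx<\infty$, and define the average $$\langle W\rangle_{T,H}=\int_{-\infty}^\infty W(\tau)\,w\Big(\frac{\tau-T}{H}\Big)\frac{d\tau}{H}.$$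 Then the series defining $N_f(\tau)$ converges absolutely for all $T>1$ and $\tau\in\mathbb R$, the integrals defining $\langle N_f^k\rangle_{T,H}$ converge absolutely for all $T>1$ and $0\le k\le m$, and the first $m$ moments of $N_f$ converge to those of a Gaussian: for every $0\le k\le m$, $$\lim_{T\to\infty}\big\langle N_f^{\,k}\big\rangle_{T,H}=\mathbb E\big[X^k\big],$$ where $X$ is a normal random variable with expectation $\int_{-\infty}^\infty f(x)\,dx$ and variance $$\sigma_f^2=\int_{-\infty}^\infty\min(|u|,1)\,\hat f(u)^2\,du.$$ -/

import Mathlib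

open MeasureTheory ProbabilityTheory Filter Topology
open scoped FourierTransform ContDiff

noncomputable section

namespace ZetaStatistics

/-- The Fourier transform `u ↦ ∫ g(x) e^{-2πixu} dx` of a real-valued function. -/
def hat (g : ℝ → ℝ) : ℝ → ℂ := 𝓕 (fun x : ℝ => (g x : ℂ))

/-- The values at complex arguments of a function whose Fourier transform is compactly supported:
`f(z) = ∫ f̂(u) e^{2πiuz} du`. On the real line this is `f` itself, see `extension_ofReal`. -/
def extension (f : ℝ → ℝ) (z : ℂ) : ℂ :=
  ∫ u : ℝ, hat f u * Complex.exp (2 * Real.pi * Complex.I * u * z)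

theorem extension_ofReal {f : ℝ → ℝ} (hc : Continuous f) (hi : Integrable f)
    (hh : Integrable (hat f)) (x : ℝ) : extension f x = f x := by
  have h1 : Continuous fun x : ℝ => (f x : ℂ) := by fun_prop
  have h := congrFun (Continuous.fourierInv_fourier_eq h1 hi.ofReal hh) x
  rw [Real.fourierInv_eq'] at h
  rw [← h, extension]
  refine integral_congr_ae (Eventually.of_forall fun u => ?_)
  simp only [smul_eq_mul, hat]
  rw [mul_comm]
  congr 2
  simp
  ring

/-- The nontrivial zeros `ρ` of the Riemann zeta function, as a set, without multiplicity. -/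
def nontrivialZeros : Set ℂ := {ρ | riemannZeta ρ = 0 ∧ 0 < ρ.re ∧ ρ.re < 1}

/-- The complex number `γ` with `ρ = 1/2 + iγ`. -/
def gam (ρ : ℂ) : ℂ := (ρ - 1 / 2) / Complex.I

/-- The term of the zero `ρ` in `N_f(τ)`: the number `f((log T / 2π)(γ - τ))`, counted with the
multiplicity of `ρ`. -/
def zeroTerm (f : ℝ → ℝ) (T τ : ℝ) (ρ : ℂ) : ℂ :=
  (analyticOrderNatAt riemannZeta ρ : ℂ) *
    extension f ((Real.log T / (2 * Real.pi) : ℝ) * (gam ρ - τ))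

/-- The smoothed zero-counting statistic `N_f(τ) = ∑_j f((log T / 2π)(γ_j - τ))`, the sum being
over all nontrivial zeros with multiplicity. -/
def zeroStat (f : ℝ → ℝ) (T τ : ℝ) : ℂ :=
  ∑' ρ : nontrivialZeros, zeroTerm f T τ ρ

/-- The average `∫ W(τ) w((τ - T)/H) dτ/H` of `W` near `T` at scale `H`. -/
def average (w : ℝ → ℝ) (T H : ℝ) (W : ℝ → ℂ) : ℂ :=
  ∫ τ : ℝ, W τ * (w ((τ - T) / H) / H : ℝ)

/-- The variance `σ_f² = ∫ min(|u|, 1) f̂(u)² du`; here `f` is even, so `f̂` is real-valued. -/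
def sigmaSq (f : ℝ → ℝ) : ℝ :=
  ∫ u : ℝ, min |u| 1 * (hat f u).re ^ 2

theorem sigmaSq_nonneg (f : ℝ → ℝ) : 0 ≤ sigmaSq f :=
  integral_nonneg fun u => mul_nonneg (le_min (abs_nonneg u) zero_le_one) (sq_nonneg _)

/-- The conditions on a weight: `w ≥ 0`, `∫ w = 1`, and `ŵ` has compact support. -/
structure IsWeight (w : ℝ → ℝ) : Prop where
  nonneg : ∀ x, 0 ≤ w x
  integrable : Integrable w
  integral_eq_one : ∫ x, w x = 1
  hat_compact : HasCompactSupport (hat w)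

end ZetaStatistics

end

/-! ### Entire functions of slow growth: splitting off zeros and counting them. -/

noncomputable section
namespace ZetaStatistics

/-! Write L = log T and φ = f̂. The term of a zero ρ is the Laplace transform of φ at L(ρ - 1/2 -
iτ) (`extension_eq_lap`), and the explicit formula turns the sum over zeros, wherever they lie in
the strip, into three terms (`hasSum_zeroTerm`, `zeroStat_eq`): a trigonometric polynomial in τ with
frequencies log n for prime powers n ≤ T^b, where b < 2a/m bounds the support of φ; an archimedean
term close to φ(0) = ∫ f; and a pole term concentrated near τ = 0. The constant φ(0) joins the
polynomial at the frequency log 1 = 0, which gives `trigSum (coeff φ L)`.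

Moments of the polynomial. The frequencies of its k-th power are log(M/M') with MM' ≤ T^(bk), so a
nonzero one is at least of order T^(-bk/2) (`le_abs_log_sub_log`). Since bm < 2a, averaging at scale
T^a against a weight with compactly supported Fourier transform kills all of them once T is large,
and only M = M' survives. By unique factorisation the same terms survive when the p^(iτ) are
replaced by independent uniform phases, so the moments are exactly those of a random model on a
torus (`integral_trigSum_pow_mul`). That model is a sum of independent terms, one for each prime,
each of size O(1/L). Its moment generating function converges on |s| = 1 to that of a Gaussian
(`exists_norm_complexMGF_torusSum_sub_le`), the variance being computed from Mertens' estimate, and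
Cauchy's estimate passes to moments (`abs_moment_sub_le`). The limiting variance is 2∫ uφ(u)² over u
> 0. It equals σ_f² when φ lives on [-1,1], as it does for m ≥ 2; when m = 1 only the moments 0 and
1 occur, and they do not see the variance.

Errors. The archimedean term differs from φ(0) by O(log L / L) times a logarithm, except where |τ| ≤
T^a/L, where the difference is merely bounded up to such a term. To average this against powers of
the polynomial, which is not small pointwise, the error is majorised by a function whose product
with the weight is still band-limited; the moment identity then applies with that product as the
weight (`exists_arch_majorant`). The pole term is estimated pointwise: with the powers of the other
terms it costs at most T^(bm/2), and the region near τ = 0 has weight O(T^(-a))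
(`exists_pole_majorant`).

The explicit formula is proved without moving a contour. On the line Re z = 1 the logarithmic
derivative of ξ is expanded both over the zeros (`hasSum_logDeriv_xi`) and over poles, gamma factor
and primes (`logDeriv_xi_eq`). In both expansions every term is a superposition of exponentials
e^(-xz), and integrating such an exponential against the Laplace transform of g returns g(x). -/

theorem exists_eq_pow_mul {f : ℂ → ℂ} (hf : Differentiable ℂ f) {ρ : ℂ}
    (h : analyticOrderAt f ρ ≠ ⊤) :
    ∃ g : ℂ → ℂ, Differentiable ℂ g ∧ g ρ ≠ 0 ∧
      ∀ w, f w = (w - ρ) ^ analyticOrderNatAt f ρ * g w := by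
  set n := analyticOrderNatAt f ρ with hn
  have h1 : analyticOrderAt f ρ = n := (Nat.cast_analyticOrderNatAt h).symm
  obtain ⟨g₁, hg₁, hg₁0, he⟩ := (hf.analyticAt ρ).analyticOrderAt_eq_natCast.1 h1
  -- The quotient is patched at ρ by the value of the local analytic cofactor, with which it agrees
  -- nearby.
  refine ⟨Function.update (fun w => f w / (w - ρ) ^ n) ρ (g₁ ρ), ?_, by simpa using hg₁0, ?_⟩
  · intro w
    rcases eq_or_ne w ρ with rfl | hw
    · refine hg₁.differentiableAt.congr_of_eventuallyEq ?_
      filter_upwards [he] with z hz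
      rcases eq_or_ne z w with rfl | hzw
      · simp
      · rw [Function.update_of_ne hzw, hz, smul_eq_mul, mul_div_cancel_left₀]
        exact pow_ne_zero _ (sub_ne_zero.2 hzw)
    · have : DifferentiableAt ℂ (fun w => f w / (w - ρ) ^ n) w :=
        (hf w).div (by fun_prop) (pow_ne_zero _ (sub_ne_zero.2 hw))
      refine this.congr_of_eventuallyEq ?_
      filter_upwards [isOpen_ne.mem_nhds hw] with z hz
      rw [Function.update_of_ne hz]
  · intro w
    rcases eq_or_ne w ρ with rfl | hw
    · have := he.self_of_nhds
      simpa using this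
    · rw [Function.update_of_ne hw, mul_div_cancel₀]
      exact pow_ne_zero _ (sub_ne_zero.2 hw)

theorem analyticOrderAt_ne_top_of_entire {f : ℂ → ℂ} (hf : Differentiable ℂ f) {w₀ : ℂ}
    (h0 : f w₀ ≠ 0) (ρ : ℂ) : analyticOrderAt f ρ ≠ ⊤ := by
  intro h
  have h1 := (analyticOrderAt_eq_top.1 h)
  have h2 : AnalyticOnNhd ℂ f Set.univ := fun z _ => hf.analyticAt z
  have := h2.eqOn_zero_of_preconnected_of_eventuallyEq_zero isPreconnected_univ
    (Set.mem_univ ρ) h1 (Set.mem_univ w₀)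
  exact h0 this

/-- Zeros are removed one at a time. The factors already removed do not vanish at the next point, so
its order in the quotient is still its order in f. -/
theorem exists_eq_prod_pow_mul {f : ℂ → ℂ} (hf : Differentiable ℂ f) {w₀ : ℂ} (h0 : f w₀ ≠ 0)
    (S : Finset ℂ) :
    ∃ g : ℂ → ℂ, Differentiable ℂ g ∧ (∀ ρ ∈ S, g ρ ≠ 0) ∧
      ∀ w, f w = (∏ ρ ∈ S, (w - ρ) ^ analyticOrderNatAt f ρ) * g w := by
  classical
  induction S using Finset.induction_on with
  | empty => exact ⟨f, hf, by simp, by simp⟩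
  | insert a S ha ih =>
    obtain ⟨g, hg, hgS, hfg⟩ := ih
    have hg0 : g w₀ ≠ 0 := fun h => h0 (by rw [hfg, h, mul_zero])
    obtain ⟨g', hg', hg'a, hgg'⟩ := exists_eq_pow_mul hg (analyticOrderAt_ne_top_of_entire hg hg0 a)
    have hord : analyticOrderNatAt g a = analyticOrderNatAt f a := by
      have hP : AnalyticAt ℂ (fun w => ∏ ρ ∈ S, (w - ρ) ^ analyticOrderNatAt f ρ) a := by
        refine Differentiable.analyticAt ?_ a
        fun_prop
      have hP0 : analyticOrderAt (fun w => ∏ ρ ∈ S, (w - ρ) ^ analyticOrderNatAt f ρ) a = 0 := by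
        rw [hP.analyticOrderAt_eq_zero, Finset.prod_ne_zero_iff]
        intro ρ hρ
        exact pow_ne_zero _ (sub_ne_zero.2 (fun h => ha (h ▸ hρ)))
      have : f = (fun w => ∏ ρ ∈ S, (w - ρ) ^ analyticOrderNatAt f ρ) * g := funext hfg
      have h2 : analyticOrderAt f a = analyticOrderAt g a := by
        conv_lhs => rw [this]
        rw [analyticOrderAt_mul hP (hg.analyticAt a), hP0, zero_add]
      simp only [analyticOrderNatAt, h2]
    refine ⟨g', hg', ?_, ?_⟩
    · intro ρ hρ
      rcases Finset.mem_insert.1 hρ with rfl | hρ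
      · exact hg'a
      · intro h
        exact hgS ρ hρ (by rw [hgg', h, mul_zero])
    · intro w
      rw [hfg, hgg' w, Finset.prod_insert ha, hord]
      ring

theorem norm_le_of_sphere_bound {g : ℂ → ℂ} (hg : Differentiable ℂ g) {R B : ℝ} (hR : 0 < R)
    (h : ∀ w, ‖w‖ = R → ‖g w‖ ≤ B) {w : ℂ} (hw : ‖w‖ ≤ R) : ‖g w‖ ≤ B := by
  refine Complex.norm_le_of_forall_mem_frontier_norm_le (U := Metric.ball (0 : ℂ) R)
    Metric.isBounded_ball hg.diffContOnCl ?_ ?_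
  · intro z hz
    rw [frontier_ball _ hR.ne'] at hz
    exact h z (by simpa using hz)
  · rw [closure_ball _ hR.ne']
    simpa using hw

/-- Dividing by the zeros in a disc of radius `r` costs no growth at radius `R ≥ r`. -/
theorem norm_cofactor_le {f g : ℂ → ℂ} (hg : Differentiable ℂ g) {S : Finset ℂ} {r R B : ℝ}
    {n : ℂ → ℕ}
    (hS : ∀ ρ ∈ S, ‖ρ‖ ≤ r) (hr : 0 ≤ r) (hrR : r < R)
    (hfg : ∀ w, f w = (∏ ρ ∈ S, (w - ρ) ^ n ρ) * g w)
    (hB : ∀ w, ‖w‖ = R → ‖f w‖ ≤ B) {w : ℂ} (hw : ‖w‖ ≤ R) :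
    ‖g w‖ * (R - r) ^ (∑ ρ ∈ S, n ρ) ≤ B := by
  rw [← le_div_iff₀ (pow_pos (sub_pos.2 hrR) _)]
  refine norm_le_of_sphere_bound hg (hr.trans_lt hrR) (fun z hz => ?_) hw
  rw [le_div_iff₀ (pow_pos (sub_pos.2 hrR) _)]
  refine le_trans ?_ (hB z hz)
  rw [hfg z, norm_mul, mul_comm, norm_prod, ← Finset.prod_pow_eq_pow_sum]
  refine mul_le_mul_of_nonneg_right ?_ (norm_nonneg _)
  refine Finset.prod_le_prod (fun _ _ => pow_nonneg (sub_pos.2 hrR).le _) fun ρ hρ => ?_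
  rw [norm_pow]
  refine pow_le_pow_left₀ (sub_pos.2 hrR).le ?_ _
  have := norm_sub_norm_le z ρ
  have := hS ρ hρ
  linarith

/-- A lower bound for the cofactor at the centre. Together with the upper bound `norm_cofactor_le`
it plays the role of Jensen's formula. -/
theorem norm_apply_zero_le {f g : ℂ → ℂ} {S : Finset ℂ} {r : ℝ} {n : ℂ → ℕ}
    (hS : ∀ ρ ∈ S, ‖ρ‖ ≤ r)
    (hfg : ∀ w, f w = (∏ ρ ∈ S, (w - ρ) ^ n ρ) * g w) :
    ‖f 0‖ ≤ r ^ (∑ ρ ∈ S, n ρ) * ‖g 0‖ := by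
  rw [hfg 0, norm_mul, norm_prod, ← Finset.prod_pow_eq_pow_sum]
  refine mul_le_mul_of_nonneg_right ?_ (norm_nonneg _)
  refine Finset.prod_le_prod (fun _ _ => norm_nonneg _) fun ρ hρ => ?_
  rw [norm_pow, zero_sub, norm_neg]
  exact pow_le_pow_left₀ (norm_nonneg _) (hS ρ hρ) _

/-- An entire function that does not vanish at `0` and grows at most like `exp (C |w| ^ (3/2))`. -/
structure SlowGrowth (f : ℂ → ℂ) (C : ℝ) : Prop where
  diff : Differentiable ℂ f
  apply_zero : f 0 ≠ 0
  nonneg : 0 ≤ C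
  le : ∀ w, ‖f w‖ ≤ Real.exp (C * (1 + ‖w‖) ^ (3 / 2 : ℝ))

theorem SlowGrowth.le_of_norm {f : ℂ → ℂ} {C : ℝ} (h : SlowGrowth f C) {R c : ℝ} (hR : 1 ≤ R)
    (hc : 0 ≤ c) {w : ℂ} (hw : ‖w‖ = c * R) :
    ‖f w‖ ≤ Real.exp (C * (1 + c) ^ (3 / 2 : ℝ) * R ^ (3 / 2 : ℝ)) := by
  refine (h.le w).trans (Real.exp_le_exp.2 ?_)
  rw [mul_assoc, ← Real.mul_rpow (by linarith) (by linarith)]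
  refine mul_le_mul_of_nonneg_left ?_ h.nonneg
  refine Real.rpow_le_rpow (by positivity) ?_ (by norm_num)
  rw [hw]; nlinarith

/-- Dividing out n zeros of modulus at most R leaves a cofactor at 0 of size at least |f(0)|/R^n,
while the maximum principle on |w| = 4R bounds it by the growth of f over (3R)^n. Hence |f(0)| 3^n
is at most the growth of f. -/
theorem SlowGrowth.exists_sum_order_le {f : ℂ → ℂ} {C : ℝ} (h : SlowGrowth f C) :
    ∃ C' : ℝ, 0 ≤ C' ∧ ∀ R : ℝ, 1 ≤ R → ∀ S : Finset ℂ, (∀ ρ ∈ S, ‖ρ‖ ≤ R) →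
      (∑ ρ ∈ S, (analyticOrderNatAt f ρ : ℝ)) ≤ C' * R ^ (3 / 2 : ℝ) := by
  refine ⟨C * (1 + 4) ^ (3 / 2 : ℝ) + |Real.log ‖f 0‖|, by have := h.nonneg; positivity, ?_⟩
  intro R hR S hS
  have hR0 : 0 < R := by linarith
  obtain ⟨g, hg, -, hfg⟩ := exists_eq_prod_pow_mul h.diff h.apply_zero S
  set n := ∑ ρ ∈ S, analyticOrderNatAt f ρ with hn
  have h1 := norm_cofactor_le hg hS hR0.le (R := 4 * R) (by linarith) hfg
    (fun w hw => h.le_of_norm hR (by norm_num) hw) (w := 0) (by simp; linarith)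
  have h2 := norm_apply_zero_le hS hfg
  rw [← hn] at h1 h2
  have hf0 : 0 < ‖f 0‖ := norm_pos_iff.2 h.apply_zero
  have h3 : ‖f 0‖ * 3 ^ n ≤ Real.exp (C * (1 + 4) ^ (3 / 2 : ℝ) * R ^ (3 / 2 : ℝ)) := by
    calc ‖f 0‖ * 3 ^ n ≤ R ^ n * ‖g 0‖ * 3 ^ n := by gcongr
      _ = ‖g 0‖ * (4 * R - R) ^ n := by
        rw [show 4 * R - R = R * 3 by ring, mul_pow]; ring
      _ ≤ _ := h1
  have h4 := Real.log_le_log (by positivity) h3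
  rw [Real.log_exp, Real.log_mul hf0.ne' (by positivity), Real.log_pow] at h4
  have h5 : (1 : ℝ) ≤ Real.log 3 := by
    rw [Real.le_log_iff_exp_le (by norm_num)]
    exact Real.exp_one_lt_d9.le.trans (by norm_num)
  have h6 : (1 : ℝ) ≤ R ^ (3 / 2 : ℝ) := Real.one_le_rpow hR (by norm_num)
  have h7 := neg_abs_le (Real.log ‖f 0‖)
  have h8 : (∑ ρ ∈ S, (analyticOrderNatAt f ρ : ℝ)) = n := by rw [hn]; push_cast; rfl
  rw [h8]
  have h9 : (n : ℝ) * 1 ≤ n * Real.log 3 := by gcongr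
  have h10 : |Real.log ‖f 0‖| * 1 ≤ |Real.log ‖f 0‖| * R ^ (3 / 2 : ℝ) := by gcongr
  linarith

/-- The dyadic shell 1 + |ρ| ≈ 2^j contains O(2^(3j/2)) zeros with multiplicity, each weighted by
about 2^(-2j). What matters is that the growth exponent 3/2 is below 2. -/
theorem SlowGrowth.summable_order {f : ℂ → ℂ} {C : ℝ} (h : SlowGrowth f C) :
    Summable fun ρ : ℂ => (analyticOrderNatAt f ρ : ℝ) / (1 + ‖ρ‖) ^ 2 := by
  classical
  obtain ⟨C', hC', hcount⟩ := h.exists_sum_order_le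
  have hk : ∀ ρ : ℂ, ∃ k : ℕ, (2 : ℝ) ^ k ≤ 1 + ‖ρ‖ ∧ 1 + ‖ρ‖ < 2 ^ (k + 1) := fun ρ =>
    exists_nat_pow_near (by linarith [norm_nonneg ρ]) (by norm_num)
  choose k hk1 hk2 using hk
  -- The ratio between consecutive shells: 3/2 - 2 = -1/2.
  set q : ℝ := (2 : ℝ) ^ (-(1 / 2) : ℝ) with hq
  have hq0 : 0 < q := by positivity
  have hq1 : q < 1 := Real.rpow_lt_one_of_one_lt_of_neg (by norm_num) (by norm_num)
  have hgeo := summable_geometric_of_lt_one hq0.le hq1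
  refine summable_of_sum_le (c := C' * 4 * ∑' j : ℕ, q ^ j) (fun ρ => by positivity) fun S => ?_
  calc ∑ ρ ∈ S, (analyticOrderNatAt f ρ : ℝ) / (1 + ‖ρ‖) ^ 2
      ≤ ∑ ρ ∈ S, (analyticOrderNatAt f ρ : ℝ) / ((2 : ℝ) ^ k ρ) ^ 2 := by
        refine Finset.sum_le_sum fun ρ _ => ?_
        have := hk1 ρ
        gcongr
    _ = ∑ j ∈ S.image k, ∑ ρ ∈ S with k ρ = j, (analyticOrderNatAt f ρ : ℝ) / ((2 : ℝ) ^ k ρ) ^ 2 :=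
        (Finset.sum_fiberwise_of_maps_to (fun ρ hρ => Finset.mem_image_of_mem k hρ) _).symm
    _ ≤ ∑ j ∈ S.image k, C' * 4 * q ^ j := by
        refine Finset.sum_le_sum fun j _ => ?_
        have h1 : ∑ ρ ∈ S with k ρ = j, (analyticOrderNatAt f ρ : ℝ) / ((2 : ℝ) ^ k ρ) ^ 2
            = (∑ ρ ∈ S with k ρ = j, (analyticOrderNatAt f ρ : ℝ)) / ((2 : ℝ) ^ j) ^ 2 := by
          rw [Finset.sum_div]
          refine Finset.sum_congr rfl fun ρ hρ => ?_
          rw [(Finset.mem_filter.1 hρ).2]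
        rw [h1]
        have h2 := hcount (2 ^ (j + 1)) (one_le_pow₀ (by norm_num)) (S.filter fun ρ => k ρ = j) (by
          intro ρ hρ
          have := hk2 ρ
          rw [(Finset.mem_filter.1 hρ).2] at this
          linarith)
        rw [div_le_iff₀ (by positivity)]
        refine h2.trans ?_
        rw [mul_assoc, mul_assoc]
        refine mul_le_mul_of_nonneg_left ?_ hC'
        have e1 : ((2 : ℝ) ^ (j + 1)) ^ (3 / 2 : ℝ) = 2 ^ (3 / 2 * ((j : ℝ) + 1)) := by
          rw [← Real.rpow_natCast, ← Real.rpow_mul (by norm_num)]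
          congr 1; push_cast; ring
        have e2 : q ^ j * ((2 : ℝ) ^ j) ^ 2 = 2 ^ (3 / 2 * (j : ℝ)) := by
          rw [hq, ← Real.rpow_natCast, ← Real.rpow_natCast, ← Real.rpow_natCast,
            ← Real.rpow_mul (by norm_num), ← Real.rpow_mul (by norm_num), ← Real.rpow_add (by norm_num)]
          congr 1; push_cast; ring
        rw [e1, e2, show (3 / 2 * ((j : ℝ) + 1)) = 3 / 2 + 3 / 2 * j by ring,
          Real.rpow_add (by norm_num)]
        refine mul_le_mul_of_nonneg_right ?_ (by positivity)
        calc (2 : ℝ) ^ (3 / 2 : ℝ) ≤ 2 ^ (2 : ℝ) :=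
              Real.rpow_le_rpow_of_exponent_le (by norm_num) (by norm_num)
          _ = 4 := by norm_num
    _ = C' * 4 * ∑ j ∈ S.image k, q ^ j := by rw [Finset.mul_sum]
    _ ≤ _ := by
        refine mul_le_mul_of_nonneg_left ?_ (by positivity)
        exact hgeo.sum_le_tsum _ fun _ _ => by positivity

end ZetaStatistics
end

/-! ### Partial fractions of the logarithmic derivative. -/

noncomputable section
namespace ZetaStatistics

/-- A zero-free entire function on a disc whose growth from the centre is at most `exp A` has a
slowly varying logarithmic derivative near the centre. -/
theorem norm_logDeriv_sub_le {g : ℂ → ℂ} (hg : Differentiable ℂ g) {R A : ℝ} (hR : 0 < R)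
    (hA : 0 < A) (hne : ∀ w, ‖w‖ < 2 * R → g w ≠ 0)
    (hle : ∀ w, ‖w‖ < 2 * R → ‖g w‖ ≤ Real.exp A * ‖g 0‖)
    {w₁ w₂ : ℂ} (h₁ : ‖w₁‖ ≤ R / 4) (h₂ : ‖w₂‖ ≤ R / 4) :
    ‖logDeriv g w₁ - logDeriv g w₂‖ ≤ 16 * A / R ^ 2 * ‖w₁ - w₂‖ := by
  have hU : ∀ w : ℂ, w ∈ Metric.ball (0 : ℂ) (2 * R) ↔ ‖w‖ < 2 * R := fun w => by simp
  have hld : DifferentiableOn ℂ (logDeriv g) (Metric.ball 0 (2 * R)) := by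
    intro w hw
    have : DifferentiableAt ℂ (fun z => deriv g z / g z) w :=
      ((hg.contDiff (n := 2)).differentiable_deriv_two w).div (hg w) (hne w ((hU w).1 hw))
    exact this.differentiableWithinAt
  -- h is the branch of log(g/g(0)) vanishing at 0, obtained as a primitive of the logarithmic
  -- derivative.
  obtain ⟨h, hh0, hh⟩ := (hld.isExactOn_ball).with_val_at 0 0
  have hhd : DifferentiableOn ℂ h (Metric.ball 0 (2 * R)) := fun w hw =>
    (hh w hw).differentiableAt.differentiableWithinAt
  have h0mem : (0 : ℂ) ∈ Metric.ball (0 : ℂ) (2 * R) := by simp [hR]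
  have hexp : ∀ w ∈ Metric.ball (0 : ℂ) (2 * R), g w * Complex.exp (-h w) = g 0 := by
    intro w hw
    have hder : ∀ z ∈ Metric.ball (0 : ℂ) (2 * R),
        HasDerivAt (fun z => g z * Complex.exp (-h z)) 0 z := by
      intro z hz
      have hd := (hg z).hasDerivAt.mul ((hh z hz).neg.cexp)
      refine HasDerivAt.congr_deriv hd ?_
      have := hne z ((hU z).1 hz)
      rw [logDeriv_apply]
      field_simp
      ring
    have := (convex_ball (0 : ℂ) (2 * R)).is_const_of_fderivWithin_eq_zero (𝕜 := ℂ)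
      (f := fun z => g z * Complex.exp (-h z))
      (fun z hz => (hder z hz).differentiableAt.differentiableWithinAt)
      (fun z hz => by
        rw [fderivWithin_of_isOpen Metric.isOpen_ball hz]
        ext
        simp [(hder z hz).deriv]) hw h0mem
    simpa [hh0] using this
  have hre : ∀ w ∈ Metric.ball (0 : ℂ) (2 * R), (h w).re ≤ A := by
    intro w hw
    have h1 := hexp w hw
    have hg0 : 0 < ‖g 0‖ := norm_pos_iff.2 (hne 0 ((hU 0).1 h0mem))
    have h2 : g w = g 0 * Complex.exp (h w) := by
      rw [← h1, mul_assoc, ← Complex.exp_add]; simp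
    have h3 := hle w ((hU w).1 hw)
    rw [h2, norm_mul, Complex.norm_exp, mul_comm] at h3
    exact Real.exp_le_exp.1 (le_of_mul_le_mul_right h3 hg0)
  -- Borel–Carathéodory turns the bound on Re h into one on |h|. Two Cauchy estimates, with radii
  -- R/2 and R/4, then bound the first and second derivatives of h.
  have hbd : ∀ w, ‖w‖ ≤ R → ‖h w‖ ≤ 2 * A := by
    intro w hw
    refine (Complex.borelCaratheodory_zero hA hhd hre (by linarith)
      ((hU w).2 (by linarith)) hh0).trans ?_
    rw [div_le_iff₀ (by linarith)]
    nlinarith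
  have hd1 : ∀ w, ‖w‖ ≤ R / 2 → ‖logDeriv g w‖ ≤ 4 * A / R := by
    intro w hw
    rw [← (hh w ((hU w).2 (by linarith))).deriv]
    have hsub : Metric.closedBall w (R / 2) ⊆ Metric.ball (0 : ℂ) (2 * R) := fun z hz => by
      rw [hU]
      have : ‖z - w‖ ≤ R / 2 := by simpa [dist_eq_norm] using hz
      have := norm_le_norm_sub_add z w
      linarith
    have := Complex.norm_deriv_le_of_forall_mem_sphere_norm_le (c := w) (R := R / 2) (C := 2 * A)
      (f := h) (by linarith)
      ((hhd.mono hsub).diffContOnCl_ball (subset_refl _)) (fun z hz => hbd z (by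
        have : ‖z - w‖ = R / 2 := by simpa [dist_eq_norm] using hz
        have := norm_le_norm_sub_add z w
        linarith))
    refine this.trans (le_of_eq ?_)
    field_simp
    ring
  have hd2 : ∀ w, ‖w‖ ≤ R / 4 → ‖deriv (logDeriv g) w‖ ≤ 16 * A / R ^ 2 := by
    intro w hw
    have hsub : Metric.closedBall w (R / 4) ⊆ Metric.ball (0 : ℂ) (2 * R) := fun z hz => by
      rw [hU]
      have : ‖z - w‖ ≤ R / 4 := by simpa [dist_eq_norm] using hz
      have := norm_le_norm_sub_add z w
      linarith
    have := Complex.norm_deriv_le_of_forall_mem_sphere_norm_le (c := w) (R := R / 4)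
      (C := 4 * A / R) (f := logDeriv g) (by linarith)
      ((hld.mono hsub).diffContOnCl_ball (subset_refl _)) (fun z hz => hd1 z (by
        have : ‖z - w‖ = R / 4 := by simpa [dist_eq_norm] using hz
        have := norm_le_norm_sub_add z w
        linarith))
    refine this.trans (le_of_eq ?_)
    field_simp
    ring
  refine (convex_closedBall (0 : ℂ) (R / 4)).norm_image_sub_le_of_norm_deriv_le
    (fun z hz => ?_) (fun z hz => hd2 z (by simpa using hz)) (by simpa using h₂) (by simpa using h₁)
  refine (hld z ?_).differentiableAt (Metric.isOpen_ball.mem_nhds ?_) <;>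
  · rw [hU]
    have : ‖z‖ ≤ R / 4 := by simpa using hz
    linarith

theorem finite_zeros_closedBall {f : ℂ → ℂ} (hf : Differentiable ℂ f) {w₀ : ℂ} (h0 : f w₀ ≠ 0)
    (R : ℝ) : {w | ‖w‖ ≤ R ∧ f w = 0}.Finite := by
  have h2 : AnalyticOnNhd ℂ f Set.univ := fun z _ => hf.analyticAt z
  have h3 := h2.preimage_zero_mem_codiscrete (x := w₀) h0
  have h4 := mem_codiscrete'.1 h3
  have h5 : ({w | ‖w‖ ≤ R ∧ f w = 0} : Set ℂ) = Metric.closedBall 0 R ∩ (f ⁻¹' {0}ᶜ)ᶜ := by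
    ext w; simp
  rw [h5]
  refine IsCompact.finite ?_ ?_
  · refine (isCompact_closedBall _ _).inter_right ?_
    have := isClosed_singleton (x := (0 : ℂ)).preimage hf.continuous
    simpa using this
  · exact h4.2.mono Set.inter_subset_right

/-- A zero-free disc around w handles nearby zeros, the triangle inequality distant ones. The
uniform δ lets 1/|w - ρ| be compared with 1/(1 + |ρ|). -/
theorem exists_mul_le_norm_sub {f : ℂ → ℂ} (hf : Differentiable ℂ f) {w : ℂ} (h0 : f w ≠ 0) :
    ∃ δ : ℝ, 0 < δ ∧ ∀ ρ, f ρ = 0 → δ * (1 + ‖ρ‖) ≤ ‖w - ρ‖ := by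
  obtain ⟨ε, hε, hb⟩ := Metric.eventually_nhds_iff.1 (hf.continuous.continuousAt.eventually_ne h0)
  refine ⟨((1 + ‖w‖) / ε + 1)⁻¹, by positivity, fun ρ hρ => ?_⟩
  have h1 : ε ≤ ‖w - ρ‖ := by
    by_contra! hlt
    exact hb (by rwa [dist_comm, dist_eq_norm]) hρ
  rw [inv_mul_le_iff₀ (by positivity), add_mul, one_mul, div_mul_eq_mul_div]
  have h2 : 1 + ‖w‖ ≤ (1 + ‖w‖) * ‖w - ρ‖ / ε := by
    rw [le_div_iff₀ hε]; gcongr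
  have h3 := norm_sub_norm_le ρ w
  rw [norm_sub_rev] at h3
  linarith

theorem logDeriv_prod_pow_mul {f g : ℂ → ℂ} (hg : Differentiable ℂ g) {S : Finset ℂ} {n : ℂ → ℕ}
    (hfg : ∀ w, f w = (∏ ρ ∈ S, (w - ρ) ^ n ρ) * g w) {w : ℂ} (hw : f w ≠ 0)
    (hS : ∀ ρ ∈ S, w ≠ ρ) :
    logDeriv f w = ∑ ρ ∈ S, n ρ * (1 / (w - ρ)) + logDeriv g w := by
  have hfe : f = fun w => (∏ ρ ∈ S, (w - ρ) ^ n ρ) * g w := funext hfg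
  have hw' := hw
  rw [hfg, mul_ne_zero_iff] at hw'
  rw [hfe, logDeriv_mul w hw'.1 hw'.2 (by fun_prop) (hg w)]
  congr 1
  rw [logDeriv_prod (f := fun ρ z => (z - ρ) ^ n ρ)]
  · refine Finset.sum_congr rfl fun ρ hρ => ?_
    rw [logDeriv_fun_pow (by fun_prop)]
    congr 1
    rw [logDeriv_apply]
    simp
  · intro ρ hρ
    exact pow_ne_zero _ (sub_ne_zero.2 (hS ρ hρ))
  · intro ρ hρ
    fun_prop

/-- A form of Hadamard's factorisation that avoids infinite products. Taking the difference at two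
points makes the series absolutely convergent. After the zeros with |ρ| ≤ 2R are divided out, the
logarithmic derivative of the cofactor varies by O(R^(3/2)/R²) between the two points, which tends
to 0. -/
theorem SlowGrowth.hasSum_logDeriv_sub {f : ℂ → ℂ} {C : ℝ} (h : SlowGrowth f C) {w₁ w₂ : ℂ}
    (h₁ : f w₁ ≠ 0) (h₂ : f w₂ ≠ 0) :
    HasSum (fun ρ : ℂ => (analyticOrderNatAt f ρ : ℂ) * (1 / (w₁ - ρ) - 1 / (w₂ - ρ)))
      (logDeriv f w₁ - logDeriv f w₂) := by
  classical
  set F : ℂ → ℂ := fun ρ => (analyticOrderNatAt f ρ : ℂ) * (1 / (w₁ - ρ) - 1 / (w₂ - ρ)) with hF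
  have hz : ∀ ρ, f ρ ≠ 0 → F ρ = 0 := by
    intro ρ hρ
    have : analyticOrderNatAt f ρ = 0 := by
      by_contra hne
      exact hρ (apply_eq_zero_of_analyticOrderNatAt_ne_zero hne)
    simp [hF, this]
  obtain ⟨δ₁, hδ₁, hb₁⟩ := exists_mul_le_norm_sub h.diff h₁
  obtain ⟨δ₂, hδ₂, hb₂⟩ := exists_mul_le_norm_sub h.diff h₂
  have hsum : Summable F := by
    refine Summable.of_norm_bounded
      (h.summable_order.mul_left (‖w₂ - w₁‖ / (δ₁ * δ₂))) fun ρ => ?_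
    by_cases hρ : f ρ = 0
    · have e1 := hb₁ ρ hρ
      have e2 := hb₂ ρ hρ
      have hp : 0 < 1 + ‖ρ‖ := by positivity
      have n1 : w₁ - ρ ≠ 0 := norm_pos_iff.1 (lt_of_lt_of_le (by positivity) e1)
      have n2 : w₂ - ρ ≠ 0 := norm_pos_iff.1 (lt_of_lt_of_le (by positivity) e2)
      have : F ρ = (analyticOrderNatAt f ρ : ℂ) * ((w₂ - w₁) / ((w₁ - ρ) * (w₂ - ρ))) := by
        simp only [hF]
        congr 1
        field_simp
        ring
      rw [this, norm_mul, norm_div, norm_mul, Complex.norm_natCast]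
      calc (analyticOrderNatAt f ρ : ℝ) * (‖w₂ - w₁‖ / (‖w₁ - ρ‖ * ‖w₂ - ρ‖))
          ≤ (analyticOrderNatAt f ρ : ℝ) * (‖w₂ - w₁‖ / ((δ₁ * (1 + ‖ρ‖)) * (δ₂ * (1 + ‖ρ‖)))) := by
            gcongr
        _ = _ := by field_simp
    · rw [hz ρ hρ]
      simp only [norm_zero]
      positivity
  have hlim : Tendsto (fun R : ℝ => ∑' ρ, (Metric.closedBall (0 : ℂ) (2 * R)).indicator F ρ) atTop
      (𝓝 (∑' ρ, F ρ)) := by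
    refine tendsto_tsum_of_dominated_convergence hsum.norm (fun ρ => ?_) ?_
    · refine tendsto_const_nhds.congr' ?_
      filter_upwards [eventually_ge_atTop ‖ρ‖] with R hR
      rw [Set.indicator_of_mem]
      have := norm_nonneg ρ
      simp; linarith
    · exact Eventually.of_forall fun R ρ => norm_indicator_le_norm_self _ _
  have hlim2 : Tendsto (fun R : ℝ => ∑' ρ, (Metric.closedBall (0 : ℂ) (2 * R)).indicator F ρ) atTop
      (𝓝 (logDeriv f w₁ - logDeriv f w₂)) := by
    rw [tendsto_iff_norm_sub_tendsto_zero]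
    set K : ℝ := C * (1 + 6) ^ (3 / 2 : ℝ) + |Real.log ‖f 0‖| + 1 with hK
    have hC := h.nonneg
    have hK0 : 0 < K := by positivity
    have hT : Tendsto (fun R : ℝ => 16 * K * ‖w₁ - w₂‖ * R ^ (-(1 / 2) : ℝ)) atTop (𝓝 0) := by
      have := (tendsto_rpow_neg_atTop (y := 1 / 2) (by norm_num)).const_mul
        (16 * K * ‖w₁ - w₂‖)
      simpa using this
    refine squeeze_zero' (Eventually.of_forall fun _ => norm_nonneg _) ?_ hT
    filter_upwards [eventually_ge_atTop 1, eventually_ge_atTop (4 * ‖w₁‖),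
      eventually_ge_atTop (4 * ‖w₂‖)] with R hR hRw₁ hRw₂
    have hR0 : 0 < R := by linarith
    set S := (finite_zeros_closedBall h.diff h.apply_zero (2 * R)).toFinset with hSdef
    have hSmem : ∀ ρ, ρ ∈ S ↔ ‖ρ‖ ≤ 2 * R ∧ f ρ = 0 := fun ρ => by simp [hSdef]
    have hSR : ∀ ρ ∈ S, ‖ρ‖ ≤ 2 * R := fun ρ hρ => ((hSmem ρ).1 hρ).1
    have htsum : ∑' ρ, (Metric.closedBall (0 : ℂ) (2 * R)).indicator F ρ = ∑ ρ ∈ S, F ρ := by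
      rw [tsum_eq_sum (s := S)]
      · refine Finset.sum_congr rfl fun ρ hρ => ?_
        rw [Set.indicator_of_mem]
        simpa using hSR ρ hρ
      · intro ρ hρ
        by_cases hb : ρ ∈ Metric.closedBall (0 : ℂ) (2 * R)
        · rw [Set.indicator_of_mem hb]
          apply hz
          intro h0
          exact hρ ((hSmem ρ).2 ⟨by simpa using hb, h0⟩)
        · rw [Set.indicator_of_notMem hb]
    obtain ⟨g, hg, hgS, hfg⟩ := exists_eq_prod_pow_mul h.diff h.apply_zero S
    have hgne : ∀ w, ‖w‖ < 2 * R → g w ≠ 0 := by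
      intro w hw h0
      have : f w = 0 := by rw [hfg, h0, mul_zero]
      exact hgS w ((hSmem w).2 ⟨hw.le, this⟩) h0
    set n := ∑ ρ ∈ S, analyticOrderNatAt f ρ with hn
    have hA : ∀ w, ‖w‖ < 2 * R → ‖g w‖ ≤ Real.exp (K * R ^ (3 / 2 : ℝ)) * ‖g 0‖ := by
      intro w hw
      -- On |w| = 6R every removed zero is at distance at least 4R = 2 · 2R, so the power of R
      -- gained covers the one lost at the centre in `norm_apply_zero_le`.
      have e1 := norm_cofactor_le hg hSR (by linarith) (R := 6 * R) (by linarith) hfg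
        (fun w hw => h.le_of_norm hR (by norm_num) hw) (w := w) (by linarith)
      have e2 := norm_apply_zero_le hSR hfg
      rw [← hn] at e1 e2
      have hf0 : 0 < ‖f 0‖ := norm_pos_iff.2 h.apply_zero
      have e3 : (6 * R - 2 * R) ^ n = (2 * R) ^ n * 2 ^ n := by
        rw [← mul_pow]; congr 1; ring
      have e4 : ‖g w‖ * (2 * R) ^ n ≤
          Real.exp (C * (1 + 6) ^ (3 / 2 : ℝ) * R ^ (3 / 2 : ℝ)) := by
        refine le_trans ?_ e1
        rw [e3]
        have : (1 : ℝ) ≤ 2 ^ n := one_le_pow₀ (by norm_num)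
        have h7 : 0 ≤ ‖g w‖ * (2 * R) ^ n := by positivity
        nlinarith
      -- A possibly small value of |f(0)| is absorbed into the exponential; hence the term |log ‖f
      -- 0‖| in `K`.
      have e5 : 1 ≤ Real.exp (|Real.log ‖f 0‖| * R ^ (3 / 2 : ℝ)) * ‖f 0‖ := by
        nth_rewrite 2 [← Real.exp_log hf0]
        rw [← Real.exp_add]
        refine Real.one_le_exp ?_
        have h6 : (1 : ℝ) ≤ R ^ (3 / 2 : ℝ) := Real.one_le_rpow hR (by norm_num)
        have := neg_abs_le (Real.log ‖f 0‖)
        nlinarith [abs_nonneg (Real.log ‖f 0‖)]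
      have e6 : 0 < (2 * R) ^ n := by positivity
      have e7 : ‖g w‖ * (2 * R) ^ n ≤
          Real.exp (K * R ^ (3 / 2 : ℝ)) * ‖g 0‖ * (2 * R) ^ n := by
        calc ‖g w‖ * (2 * R) ^ n
            ≤ Real.exp (C * (1 + 6) ^ (3 / 2 : ℝ) * R ^ (3 / 2 : ℝ)) * 1 := by rw [mul_one]; exact e4
          _ ≤ Real.exp (C * (1 + 6) ^ (3 / 2 : ℝ) * R ^ (3 / 2 : ℝ)) *
              (Real.exp (|Real.log ‖f 0‖| * R ^ (3 / 2 : ℝ)) * ‖f 0‖) := by gcongr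
          _ = Real.exp ((C * (1 + 6) ^ (3 / 2 : ℝ) + |Real.log ‖f 0‖|) * R ^ (3 / 2 : ℝ)) * ‖f 0‖ := by
              rw [← mul_assoc, ← Real.exp_add]; congr 2; ring
          _ ≤ Real.exp (K * R ^ (3 / 2 : ℝ)) * ((2 * R) ^ n * ‖g 0‖) := by
              gcongr
              linarith
          _ = _ := by ring
      exact le_of_mul_le_mul_right e7 e6
    have hmain := norm_logDeriv_sub_le hg hR0 (A := K * R ^ (3 / 2 : ℝ)) (by positivity) hgne hA
      (w₁ := w₁) (w₂ := w₂) (by linarith) (by linarith)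
    have l1 := logDeriv_prod_pow_mul hg hfg h₁ (fun ρ hρ he => h₁ (he ▸ ((hSmem ρ).1 hρ).2))
    have l2 := logDeriv_prod_pow_mul hg hfg h₂ (fun ρ hρ he => h₂ (he ▸ ((hSmem ρ).1 hρ).2))
    have : ∑' ρ, (Metric.closedBall (0 : ℂ) (2 * R)).indicator F ρ -
        (logDeriv f w₁ - logDeriv f w₂) = -(logDeriv g w₁ - logDeriv g w₂) := by
      rw [htsum, l1, l2]
      simp only [hF, mul_sub, Finset.sum_sub_distrib]
      ring
    rw [this, norm_neg]
    refine hmain.trans (le_of_eq ?_)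
    have e8 : R ^ (-(1 / 2) : ℝ) = R ^ (3 / 2 : ℝ) / R ^ 2 := by
      rw [← Real.rpow_natCast, ← Real.rpow_sub hR0]; norm_num
    rw [e8]
    field_simp
  rw [← tendsto_nhds_unique hlim hlim2]
  exact hsum.hasSum

end ZetaStatistics
end

/-! ### The function ξ: symmetry, zeros and growth. -/

noncomputable section
namespace ZetaStatistics

/-- The entire function `ξ(1/2 + z) = s (s - 1) π^(-s/2) Γ(s/2) ζ(s)` with `s = 1/2 + z`. -/
def xi (z : ℂ) : ℂ := (1 / 2 + z) * (z - 1 / 2) * completedRiemannZeta₀ (1 / 2 + z) + 1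

theorem differentiable_xi : Differentiable ℂ xi := by
  have := differentiable_completedZeta₀
  unfold xi
  fun_prop

theorem xi_neg (z : ℂ) : xi (-z) = xi z := by
  unfold xi
  rw [show (1 / 2 + -z : ℂ) = 1 - (1 / 2 + z) by ring, completedRiemannZeta₀_one_sub]
  ring

theorem xi_eq {z : ℂ} (h1 : z ≠ 1 / 2) (h2 : z ≠ -(1 / 2)) :
    xi z = (1 / 2 + z) * (z - 1 / 2) * completedRiemannZeta (1 / 2 + z) := by
  have e1 : (1 / 2 + z : ℂ) ≠ 0 := fun h => h2 (by linear_combination h)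
  have e2 : (1 - (1 / 2 + z) : ℂ) ≠ 0 := fun h => h1 (by linear_combination -h)
  have e3 : (z - 1 / 2 : ℂ) ≠ 0 := fun h => h1 (by linear_combination h)
  rw [completedRiemannZeta_eq, xi]
  have h3 : (1 / 2 + z) * (1 / (1 / 2 + z)) = 1 := mul_one_div_cancel e1
  have h4 : (z - 1 / 2) * (1 / (1 - (1 / 2 + z))) = -1 := by
    rw [show (z - 1 / 2 : ℂ) = -(1 - (1 / 2 + z)) by ring, neg_mul, mul_one_div_cancel e2]
  linear_combination (z - 1 / 2) * h3 + (1 / 2 + z) * h4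

theorem xi_eq_mul_riemannZeta {z : ℂ} (h1 : z ≠ 1 / 2) (h2 : -(1 / 2) < z.re) :
    xi z = ((1 / 2 + z) * (z - 1 / 2) * Complex.Gammaℝ (1 / 2 + z)) * riemannZeta (1 / 2 + z) := by
  have h3 : z ≠ -(1 / 2) := by
    rintro rfl; simp at h2
  have h4 : (0 : ℝ) < (1 / 2 + z : ℂ).re := by simp; linarith
  have e1 : (1 / 2 + z : ℂ) ≠ 0 := fun h => h3 (by linear_combination h)
  rw [xi_eq h1 h3, riemannZeta_def_of_ne_zero e1]
  have hG := Complex.Gammaℝ_ne_zero_of_re_pos h4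
  generalize Complex.Gammaℝ (1 / 2 + z) = G at hG ⊢
  generalize completedRiemannZeta (1 / 2 + z) = X
  field_simp

theorem xi_ne_zero_of_half_le_re {z : ℂ} (hz : 1 / 2 ≤ z.re) : xi z ≠ 0 := by
  rcases eq_or_ne z (1 / 2) with rfl | h1
  · simp [xi]
  · rw [xi_eq_mul_riemannZeta h1 (by linarith)]
    have h4 : (0 : ℝ) < (1 / 2 + z : ℂ).re := by simp; linarith
    refine mul_ne_zero (mul_ne_zero (mul_ne_zero ?_ (sub_ne_zero.2 h1))
      (Complex.Gammaℝ_ne_zero_of_re_pos h4)) (riemannZeta_ne_zero_of_one_le_re ?_)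
    · intro h; rw [h] at h4; simp at h4
    · simp; linarith

theorem abs_re_lt_of_xi_eq_zero {z : ℂ} (hz : xi z = 0) : |z.re| < 1 / 2 := by
  rw [abs_lt]
  constructor
  · by_contra! h
    refine xi_ne_zero_of_half_le_re (z := -z) (by simp; linarith) ?_
    rwa [xi_neg]
  · by_contra! h
    exact xi_ne_zero_of_half_le_re h hz

theorem abs_re_lt_of_order_ne_zero {z : ℂ} (hz : analyticOrderNatAt xi z ≠ 0) :
    |z.re| < 1 / 2 :=
  abs_re_lt_of_xi_eq_zero (apply_eq_zero_of_analyticOrderNatAt_ne_zero hz)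

/-- Inside the critical strip the factor s(s - 1)π^(-s/2)Γ(s/2) is analytic and nonzero, so
multiplicities for ζ and ξ agree. -/
theorem analyticOrderNatAt_riemannZeta {z : ℂ} (hz : |z.re| < 1 / 2) :
    analyticOrderNatAt riemannZeta (1 / 2 + z) = analyticOrderNatAt xi z := by
  rw [abs_lt] at hz
  set A : ℂ → ℂ := fun w => (1 / 2 + w) * (w - 1 / 2) * Complex.Gammaℝ (1 / 2 + w) with hA
  have hne : z ≠ 1 / 2 := by rintro rfl; simp at hz
  have hz1 : (0 : ℝ) < (1 / 2 + z : ℂ).re := by simp; linarith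
  have hU : ∀ᶠ w in 𝓝 z, |w.re| < 1 / 2 := by
    have : ContinuousAt (fun w : ℂ => |w.re|) z := by fun_prop
    exact this.eventually_lt continuousAt_const (abs_lt.2 hz)
  have hGd : ∀ w : ℂ, |w.re| < 1 / 2 → DifferentiableAt ℂ A w := by
    intro w hw
    rw [abs_lt] at hw
    have : DifferentiableAt ℂ Complex.Gammaℝ (1 / 2 + w) := by
      have hG : DifferentiableAt ℂ Complex.Gamma ((1 / 2 + w) / 2) := by
        refine Complex.differentiableAt_Gamma _ fun m h => ?_
        have := congrArg Complex.re h
        simp at this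
        have hm : (0 : ℝ) ≤ m := by positivity
        linarith
      have h2 : DifferentiableAt ℂ (fun s : ℂ => (Real.pi : ℂ) ^ (-s / 2) * Complex.Gamma (s / 2))
          (1 / 2 + w) := by
        refine DifferentiableAt.mul ?_ ?_
        · refine DifferentiableAt.const_cpow (by fun_prop) (Or.inl ?_)
          exact_mod_cast Real.pi_ne_zero
        · exact hG.comp (f := fun s : ℂ => s / 2) (1 / 2 + w) (by fun_prop)
      exact h2
    have h3 : DifferentiableAt ℂ (fun w : ℂ => Complex.Gammaℝ (1 / 2 + w)) w :=
      this.comp (f := fun w : ℂ => 1 / 2 + w) w (by fun_prop)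
    exact DifferentiableAt.mul (by fun_prop) h3
  have hAan : AnalyticAt ℂ A z := by
    rw [Complex.analyticAt_iff_eventually_differentiableAt]
    filter_upwards [hU] with w hw using hGd w hw
  have hA0 : A z ≠ 0 := by
    refine mul_ne_zero (mul_ne_zero ?_ (sub_ne_zero.2 hne)) (Complex.Gammaℝ_ne_zero_of_re_pos hz1)
    intro h; rw [h] at hz1; simp at hz1
  have hZd : ∀ w : ℂ, |w.re| < 1 / 2 → DifferentiableAt ℂ (fun w => riemannZeta (1 / 2 + w)) w := by
    intro w hw
    have h5 : (1 / 2 + w : ℂ) ≠ 1 := by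
      intro h
      have := congrArg Complex.re h
      simp at this
      rw [abs_lt] at hw
      linarith
    exact (differentiableAt_riemannZeta h5).comp (f := fun w : ℂ => 1 / 2 + w) w (by fun_prop)
  have hZ : AnalyticAt ℂ (fun w => riemannZeta (1 / 2 + w)) z := by
    rw [Complex.analyticAt_iff_eventually_differentiableAt]
    filter_upwards [hU] with w hw using hZd w hw
  have hcong : xi =ᶠ[𝓝 z] A * fun w => riemannZeta (1 / 2 + w) := by
    filter_upwards [hU] with w hw
    rw [abs_lt] at hw
    exact xi_eq_mul_riemannZeta (by rintro rfl; simp at hw) (by linarith)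
  have h6 : analyticOrderAt xi z = analyticOrderAt (fun w => riemannZeta (1 / 2 + w)) z := by
    rw [analyticOrderAt_congr hcong, analyticOrderAt_mul hAan hZ, hAan.analyticOrderAt_eq_zero.2 hA0,
      zero_add]
  have h7 : analyticOrderAt (fun w => riemannZeta (1 / 2 + w)) z =
      analyticOrderAt riemannZeta (1 / 2 + z) := by
    have hzan : AnalyticAt ℂ riemannZeta (1 / 2 + z) := by
      refine analyticOn_riemannZeta _ ?_
      simp only [Set.mem_compl_iff, Set.mem_singleton_iff]
      intro h
      have := congrArg Complex.re h
      simp at this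
      linarith
    have hd : HasDerivAt (fun w : ℂ => 1 / 2 + w) 1 z := by
      exact (hasDerivAt_id z).const_add (1 / 2)
    have := analyticOrderAt_comp_of_deriv_ne_zero (f := riemannZeta) (g := fun w : ℂ => 1 / 2 + w)
      (z₀ := z) (by fun_prop) (by rw [hd.deriv]; exact one_ne_zero)
    exact this
  simp only [analyticOrderNatAt, h6, h7]

/-- The crude n! ≤ n^n with n = ⌈x⌉ suffices: log n is bounded by 4√x, which is the origin of the
exponent 3/2 in `SlowGrowth`. -/
theorem Gamma_le_exp {x : ℝ} (hx : 1 ≤ x) : Real.Gamma x ≤ Real.exp (8 * x ^ (3 / 2 : ℝ)) := by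
  have h1 : Real.Gamma x ≤ Real.Gamma (x + 1) := by
    rw [Real.Gamma_add_one (by linarith)]
    have := Real.Gamma_pos_of_pos (by linarith : 0 < x)
    nlinarith
  have h2 : Real.Gamma (x + 1) ≤ Real.Gamma ((⌈x⌉₊ : ℝ) + 1) := by
    refine Real.Gamma_strictMonoOn_Ici.monotoneOn ?_ ?_ ?_
    · simp; linarith
    · simp only [Set.mem_Ici]; linarith [Nat.le_ceil x]
    · linarith [Nat.le_ceil x]
  rw [Real.Gamma_nat_eq_factorial] at h2
  have h3 : ((⌈x⌉₊).factorial : ℝ) ≤ (⌈x⌉₊ : ℝ) ^ ⌈x⌉₊ := by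
    exact_mod_cast Nat.factorial_le_pow ⌈x⌉₊
  have h4 : (⌈x⌉₊ : ℝ) ≤ 2 * x := by linarith [Nat.ceil_lt_add_one (by linarith : 0 ≤ x)]
  have h5 : (0 : ℝ) < ⌈x⌉₊ := by
    exact_mod_cast Nat.ceil_pos.2 (by linarith)
  have h6 : (1 : ℝ) ≤ ⌈x⌉₊ := by exact_mod_cast h5
  have h7 : (⌈x⌉₊ : ℝ) ^ ⌈x⌉₊ ≤ Real.exp (8 * x ^ (3 / 2 : ℝ)) := by
    rw [← Real.exp_log h5, ← Real.exp_nat_mul, Real.exp_le_exp]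
    have hl : Real.log (⌈x⌉₊ : ℝ) ≤ 4 * x ^ (1 / 2 : ℝ) := by
      have e1 := Real.log_le_log h5 h4
      have e2 := Real.log_le_rpow_div (x := 2 * x) (by linarith) (ε := 1 / 2) (by norm_num)
      rw [Real.mul_rpow (by norm_num) (by linarith)] at e2
      have e3 : (2 : ℝ) ^ (1 / 2 : ℝ) ≤ 2 := by
        calc (2 : ℝ) ^ (1 / 2 : ℝ) ≤ 2 ^ (1 : ℝ) :=
              Real.rpow_le_rpow_of_exponent_le (by norm_num) (by norm_num)
          _ = 2 := by norm_num
      have e4 : 0 ≤ x ^ (1 / 2 : ℝ) := by positivity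
      nlinarith
    calc (⌈x⌉₊ : ℝ) * Real.log (⌈x⌉₊ : ℝ) ≤ (2 * x) * (4 * x ^ (1 / 2 : ℝ)) := by
          have := Real.log_nonneg h6
          gcongr
      _ = 8 * x ^ (3 / 2 : ℝ) := by
          rw [show (3 / 2 : ℝ) = 1 + 1 / 2 by norm_num, Real.rpow_add (by linarith), Real.rpow_one]
          ring
  linarith

/-- The entire part of the completed zeta function is a Mellin transform converging at every
abscissa. On the strip its modulus is dominated by the values at the two extreme abscissas, which
after halving s are 1/4 and 1. -/
theorem exists_norm_completedZeta₀_le_strip :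
    ∃ B : ℝ, 0 ≤ B ∧ ∀ s : ℂ, 1 / 2 ≤ s.re → s.re ≤ 2 → ‖completedRiemannZeta₀ s‖ ≤ B := by
  set P := HurwitzZeta.hurwitzEvenFEPair 0
  have hconv : ∀ s : ℂ, MellinConvergent P.f_modif s := fun s =>
    (P.isStrongFEPair_toStrongFEPair.hasMellin s).1
  have hint : ∀ s : ℂ, IntegrableOn (fun t : ℝ => t ^ (s.re - 1) * ‖P.f_modif t‖) (Set.Ioi 0) := by
    intro s
    have h1 : IntegrableOn (fun t : ℝ => ‖(t : ℂ) ^ (s - 1) • P.f_modif t‖) (Set.Ioi 0) :=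
      (hconv s).norm
    refine h1.congr_fun (fun t ht => ?_) measurableSet_Ioi
    simp only [norm_smul]
    rw [Complex.norm_cpow_eq_rpow_re_of_pos ht]
    simp
  have i1 := hint (1 / 4 : ℝ)
  have i2 := hint (1 : ℝ)
  simp only [Complex.ofReal_re] at i1 i2
  refine ⟨∫ t in Set.Ioi (0 : ℝ), (t ^ ((1 / 4 : ℝ) - 1) * ‖P.f_modif t‖ +
    t ^ ((1 : ℝ) - 1) * ‖P.f_modif t‖), setIntegral_nonneg measurableSet_Ioi fun t ht => ?_, ?_⟩
  · have : (0 : ℝ) < t := ht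
    positivity
  intro s h1 h2
  have e1 : completedRiemannZeta₀ s = mellin P.f_modif (s / 2) / 2 := rfl
  have hre : (s / 2).re = s.re / 2 := by simp
  rw [e1, norm_div, Complex.norm_ofNat]
  have e2 : ‖mellin P.f_modif (s / 2)‖ ≤ ∫ t in Set.Ioi (0 : ℝ),
      (t ^ ((1 / 4 : ℝ) - 1) * ‖P.f_modif t‖ + t ^ ((1 : ℝ) - 1) * ‖P.f_modif t‖) := by
    refine norm_integral_le_of_norm_le (i1.add i2) ?_
    filter_upwards [ae_restrict_mem measurableSet_Ioi] with t ht
    have ht0 : (0 : ℝ) < t := ht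
    rw [norm_smul, Complex.norm_cpow_eq_rpow_re_of_pos ht0, ← add_mul]
    refine mul_le_mul_of_nonneg_right ?_ (norm_nonneg _)
    simp only [Complex.sub_re, hre, Complex.one_re]
    rcases le_total 1 t with h | h
    · have := Real.rpow_le_rpow_of_exponent_le h (by linarith : s.re / 2 - 1 ≤ 1 - 1)
      exact le_add_of_nonneg_of_le (by positivity) this
    · have := Real.rpow_le_rpow_of_exponent_ge ht0 h (by linarith : (1 / 4 : ℝ) - 1 ≤ s.re / 2 - 1)
      exact le_add_of_le_of_nonneg this (by positivity)
  have := norm_nonneg (mellin P.f_modif (s / 2))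
  linarith

theorem norm_riemannZeta_le {s : ℂ} (hs : 2 ≤ s.re) :
    ‖riemannZeta s‖ ≤ ∑' n : ℕ, 1 / (n : ℝ) ^ 2 := by
  rw [zeta_eq_tsum_one_div_nat_cpow (by linarith)]
  have h1 : Summable fun n : ℕ => 1 / (n : ℝ) ^ 2 := Real.summable_one_div_nat_pow.2 (by norm_num)
  refine tsum_of_norm_bounded h1.hasSum fun n => ?_
  rcases Nat.eq_zero_or_pos n with rfl | hn
  · have : s ≠ 0 := by rintro rfl; simp at hs; linarith
    simp [Complex.zero_cpow this]
  · rw [norm_div, norm_one, Complex.norm_natCast_cpow_of_pos hn, ← Real.rpow_natCast]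
    have : (1 : ℝ) ≤ n := by exact_mod_cast hn
    gcongr
    exact_mod_cast hs

/-- The strip bound covers Re s ≤ 2. Beyond it the Gamma factor, the bounded Dirichlet series and
the two polar terms are estimated separately. -/
theorem exists_norm_xi_le_of_nonneg_re :
    ∃ C : ℝ, 0 ≤ C ∧ ∀ z : ℂ, 0 ≤ z.re → ‖xi z‖ ≤ Real.exp (C * (1 + ‖z‖) ^ (3 / 2 : ℝ)) := by
  obtain ⟨B, hB, hstrip⟩ := exists_norm_completedZeta₀_le_strip
  set Z : ℝ := ∑' n : ℕ, 1 / (n : ℝ) ^ 2 with hZ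
  have hZ0 : 0 ≤ Z := tsum_nonneg fun n => by positivity
  refine ⟨8 + 2 + (B + Z + 3), by positivity, fun z hz => ?_⟩
  set u : ℝ := 1 + ‖z‖ with hu
  have hu1 : 1 ≤ u := by linarith [norm_nonneg z]
  have hs : ‖(1 / 2 + z : ℂ)‖ ≤ u := (norm_add_le _ _).trans (by norm_num; linarith)
  have hs1 : ‖(z - 1 / 2 : ℂ)‖ ≤ u := (norm_sub_le _ _).trans (by norm_num; linarith)
  have hU : u ≤ u ^ (3 / 2 : ℝ) := by
    calc u = u ^ (1 : ℝ) := by rw [Real.rpow_one]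
      _ ≤ _ := Real.rpow_le_rpow_of_exponent_le hu1 (by norm_num)
  have key : ‖completedRiemannZeta₀ (1 / 2 + z)‖ ≤ (B + Z + 2) * Real.exp (8 * u ^ (3 / 2 : ℝ)) := by
    have hE : 1 ≤ Real.exp (8 * u ^ (3 / 2 : ℝ)) := Real.one_le_exp (by positivity)
    rcases le_total (1 / 2 + z : ℂ).re 2 with h | h
    · have h0 : 1 / 2 ≤ (1 / 2 + z : ℂ).re := by simp; linarith
      have := hstrip _ h0 h
      nlinarith
    · set s : ℂ := 1 / 2 + z with hsdef
      have hs0 : s ≠ 0 := by intro h0; rw [h0] at h; simp at h; linarith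
      have e1 : completedRiemannZeta₀ s = Complex.Gammaℝ s * riemannZeta s + 1 / s + 1 / (1 - s) := by
        have hG := Complex.Gammaℝ_ne_zero_of_re_pos (by linarith : 0 < s.re)
        rw [riemannZeta_def_of_ne_zero hs0, completedRiemannZeta_eq]
        field_simp
        ring
      have e2 : ‖Complex.Gammaℝ s‖ ≤ Real.exp (8 * u ^ (3 / 2 : ℝ)) := by
        rw [Complex.Gammaℝ_def, norm_mul]
        have p1 : ‖(Real.pi : ℂ) ^ (-s / 2)‖ ≤ 1 := by
          rw [Complex.norm_cpow_eq_rpow_re_of_pos Real.pi_pos]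
          refine Real.rpow_le_one_of_one_le_of_nonpos (by linarith [Real.pi_gt_three]) ?_
          simp; linarith
        have hre2 : (s / 2).re = s.re / 2 := by simp
        have p2 : ‖Complex.Gamma (s / 2)‖ ≤ Real.Gamma (s.re / 2) := by
          rw [← hre2]
          rw [Complex.Gamma_eq_integral (by rw [hre2]; linarith),
            Real.Gamma_eq_integral (by rw [hre2]; linarith)]
          refine norm_integral_le_of_norm_le
            (Real.GammaIntegral_convergent (by rw [hre2]; linarith)) ?_
          filter_upwards [ae_restrict_mem measurableSet_Ioi] with t ht
          rw [norm_mul, Complex.norm_cpow_eq_rpow_re_of_pos ht]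
          simp [Complex.norm_exp]
        have p3 := Gamma_le_exp (x := s.re / 2) (by linarith)
        have p4 : s.re / 2 ≤ u := by
          have := Complex.re_le_norm s
          have : 0 ≤ ‖s‖ := norm_nonneg _
          linarith
        have p5 : Real.exp (8 * (s.re / 2) ^ (3 / 2 : ℝ)) ≤ Real.exp (8 * u ^ (3 / 2 : ℝ)) := by
          refine Real.exp_le_exp.2 (mul_le_mul_of_nonneg_left ?_ (by norm_num))
          exact Real.rpow_le_rpow (by linarith) p4 (by norm_num)
        calc _ ≤ 1 * Real.Gamma (s.re / 2) := by gcongr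
          _ ≤ _ := by linarith
      have e3 := norm_riemannZeta_le h
      have e4 : ‖1 / s‖ ≤ 1 := by
        rw [norm_div, norm_one, div_le_one (norm_pos_iff.2 hs0)]
        linarith [Complex.re_le_norm s]
      have e5 : ‖1 / (1 - s)‖ ≤ 1 := by
        have h6 : 1 ≤ ‖1 - s‖ := by
          have := Complex.abs_re_le_norm (1 - s)
          have h7 := neg_abs_le (1 - s).re
          simp at this h7
          linarith
        rw [norm_div, norm_one, div_le_one (by linarith)]
        exact h6
      rw [e1]
      calc _ ≤ ‖Complex.Gammaℝ s‖ * ‖riemannZeta s‖ + 1 + 1 := by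
            refine (norm_add_le _ _).trans (add_le_add ((norm_add_le _ _).trans
              (add_le_add (norm_mul _ _).le e4)) e5)
        _ ≤ Real.exp (8 * u ^ (3 / 2 : ℝ)) * Z + 1 + 1 := by gcongr
        _ ≤ _ := by nlinarith
  have h2 : u ^ 2 ≤ Real.exp (2 * u ^ (3 / 2 : ℝ)) := by
    have : u ≤ Real.exp (u ^ (3 / 2 : ℝ)) := hU.trans ((by linarith [Real.add_one_le_exp (u ^ (3 / 2 : ℝ))]))
    calc u ^ 2 ≤ Real.exp (u ^ (3 / 2 : ℝ)) ^ 2 := by gcongr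
      _ = _ := by rw [← Real.exp_nat_mul]; norm_num
  have h3 : B + Z + 3 ≤ Real.exp ((B + Z + 3) * u ^ (3 / 2 : ℝ)) := by
    have := Real.add_one_le_exp ((B + Z + 3) * u ^ (3 / 2 : ℝ))
    nlinarith
  have h1' : 1 ≤ u ^ 2 * Real.exp (8 * u ^ (3 / 2 : ℝ)) := by
    have hE : 1 ≤ Real.exp (8 * u ^ (3 / 2 : ℝ)) := Real.one_le_exp (by positivity)
    nlinarith
  calc ‖xi z‖ ≤ ‖(1 / 2 + z : ℂ)‖ * ‖(z - 1 / 2 : ℂ)‖ * ‖completedRiemannZeta₀ (1 / 2 + z)‖ + 1 := by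
        unfold xi
        refine (norm_add_le _ _).trans ?_
        simp only [norm_mul, norm_one]
        exact le_rfl
    _ ≤ u * u * ((B + Z + 2) * Real.exp (8 * u ^ (3 / 2 : ℝ))) + 1 := by gcongr
    _ ≤ Real.exp (8 * u ^ (3 / 2 : ℝ)) * u ^ 2 * (B + Z + 3) := by nlinarith
    _ ≤ Real.exp (8 * u ^ (3 / 2 : ℝ)) * Real.exp (2 * u ^ (3 / 2 : ℝ)) *
        Real.exp ((B + Z + 3) * u ^ (3 / 2 : ℝ)) := by gcongr
    _ = _ := by rw [← Real.exp_add, ← Real.exp_add]; congr 1; ring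

/-- `SlowGrowth` needs a nonzero value at the centre. Moving the centre to z = 3/2, that is s = 2,
provides one without any knowledge of ζ(1/2). -/
theorem exists_slowGrowth_xi : ∃ C : ℝ, SlowGrowth (fun w => xi (3 / 2 + w)) C := by
  obtain ⟨C, hC, h⟩ := exists_norm_xi_le_of_nonneg_re
  refine ⟨C * 3 ^ (3 / 2 : ℝ), ?_, ?_, by positivity, fun w => ?_⟩
  · have := differentiable_xi
    fun_prop
  · simp only [add_zero]
    exact xi_ne_zero_of_half_le_re (by norm_num)
  · have h1 : ∀ z : ℂ, ‖xi z‖ ≤ Real.exp (C * (1 + ‖z‖) ^ (3 / 2 : ℝ)) := by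
      intro z
      rcases le_total 0 z.re with hz | hz
      · exact h z hz
      · have := h (-z) (by simpa using hz)
        rwa [xi_neg, norm_neg] at this
    refine (h1 _).trans (Real.exp_le_exp.2 ?_)
    rw [mul_assoc, ← Real.mul_rpow (by norm_num) (by positivity)]
    gcongr
    have := norm_add_le (3 / 2 : ℂ) w
    have h32 : ‖(3 / 2 : ℂ)‖ = 3 / 2 := by norm_num
    have := norm_nonneg w
    linarith

theorem analyticOrderNatAt_xi_add (c ρ : ℂ) :
    analyticOrderNatAt (fun w => xi (c + w)) ρ = analyticOrderNatAt xi (c + ρ) := by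
  have hd : HasDerivAt (fun w : ℂ => c + w) 1 ρ := by
    simpa using (hasDerivAt_id ρ).const_add c
  have := analyticOrderAt_comp_of_deriv_ne_zero (f := xi) (g := fun w : ℂ => c + w)
    (z₀ := ρ) (by fun_prop) (by rw [hd.deriv]; exact one_ne_zero)
  have h2 : analyticOrderAt (fun w => xi (c + w)) ρ = analyticOrderAt xi (c + ρ) := this
  simp only [analyticOrderNatAt, h2]

theorem summable_order_xi :
    Summable fun ρ : ℂ => (analyticOrderNatAt xi ρ : ℝ) / (1 + ‖ρ‖) ^ 2 := by
  obtain ⟨C, hC⟩ := exists_slowGrowth_xi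
  have h1 := hC.summable_order
  simp only [analyticOrderNatAt_xi_add] at h1
  have h2 := (Equiv.addLeft (-(3 / 2) : ℂ)).summable_iff.2 h1
  refine Summable.of_nonneg_of_le (fun ρ => by positivity) (fun ρ => ?_) (h2.mul_left (4 ^ 2))
  simp only [Function.comp, Equiv.coe_addLeft, add_neg_cancel_left]
  rw [mul_div_assoc', div_le_div_iff₀ (by positivity) (by positivity)]
  have : 1 + ‖(-(3 / 2) + ρ : ℂ)‖ ≤ 4 * (1 + ‖ρ‖) := by
    have := norm_add_le (-(3 / 2) : ℂ) ρ
    have h32 : ‖(-(3 / 2) : ℂ)‖ = 3 / 2 := by norm_num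
    have := norm_nonneg ρ
    linarith
  calc (analyticOrderNatAt xi ρ : ℝ) * (1 + ‖(-(3 / 2) + ρ : ℂ)‖) ^ 2
      ≤ (analyticOrderNatAt xi ρ : ℝ) * (4 * (1 + ‖ρ‖)) ^ 2 := by gcongr
    _ = _ := by ring

/-- The difference formula is taken at the points z and -z: since ξ is even its logarithmic
derivative is odd, so the difference is twice the value at z and no unknown constant remains. -/
theorem hasSum_logDeriv_xi {z : ℂ} (hz : xi z ≠ 0) :
    HasSum (fun ρ : ℂ => (analyticOrderNatAt xi ρ : ℂ) * (1 / (z - ρ) + 1 / (z + ρ)))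
      (2 * logDeriv xi z) := by
  obtain ⟨C, hC⟩ := exists_slowGrowth_xi
  have h1 := hC.hasSum_logDeriv_sub (w₁ := -(3 / 2) + z) (w₂ := -(3 / 2) - z)
    (by ring_nf; exact hz) (by ring_nf; rw [xi_neg]; exact hz)
  simp only [analyticOrderNatAt_xi_add] at h1
  have h2 := (Equiv.addLeft (-(3 / 2) : ℂ)).hasSum_iff.2 h1
  have hld : ∀ w, logDeriv (fun w => xi (3 / 2 + w)) w = logDeriv xi (3 / 2 + w) := by
    intro w
    rw [logDeriv_apply, logDeriv_apply, deriv_comp_const_add]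
  have hneg : logDeriv xi (-z) = -logDeriv xi z := by
    have : xi = fun w => xi (-w) := funext fun w => (xi_neg w).symm
    have hd : deriv xi z = -deriv xi (-z) := by
      conv_lhs => rw [this]
      exact deriv_comp_neg xi z
    rw [logDeriv_apply, logDeriv_apply, xi_neg, hd]
    ring
  rw [hld, hld, show (3 / 2 + (-(3 / 2) + z) : ℂ) = z by ring,
    show (3 / 2 + (-(3 / 2) - z) : ℂ) = -z by ring, hneg] at h2
  convert h2 using 1
  · funext ρ
    simp only [Function.comp, Equiv.coe_addLeft]
    rw [show (3 / 2 + (-(3 / 2) + ρ) : ℂ) = ρ by ring,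
      show (-(3 / 2) + z - (-(3 / 2) + ρ) : ℂ) = z - ρ by ring,
      show (-(3 / 2) - z - (-(3 / 2) + ρ) : ℂ) = -(z + ρ) by ring, div_neg, sub_neg_eq_add]
  · ring

end ZetaStatistics
end

/-! ### Gauss's integral for the digamma function. -/

noncomputable section
namespace ZetaStatistics

theorem norm_one_sub_exp_neg_le {w : ℂ} (hw : 0 ≤ w.re) : ‖1 - Complex.exp (-w)‖ ≤ ‖w‖ := by
  have hc : Convex ℝ {z : ℂ | 0 ≤ z.re} := convex_halfSpace_re_ge 0
  have hd : ∀ z : ℂ, HasDerivAt (fun z : ℂ => Complex.exp (-z)) (-Complex.exp (-z)) z := fun z => by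
    simpa using (hasDerivAt_neg z).cexp
  have := hc.norm_image_sub_le_of_norm_deriv_le (𝕜 := ℂ) (f := fun z : ℂ => Complex.exp (-z))
    (C := 1) (x := w) (y := 0) (fun z _ => (hd z).differentiableAt) (fun z hz => by
      rw [(hd z).deriv, norm_neg, Complex.norm_exp]
      exact Real.exp_le_one_iff.2 (by simpa using hz)) hw (by simp)
  simpa using this

/-- The kernel of the archimedean term of the explicit formula. -/
def kappa (y : ℝ) : ℝ := Real.exp (-y / 2) / (1 - Real.exp (-2 * y))

theorem one_sub_exp_pos {y : ℝ} (hy : 0 < y) : 0 < 1 - Real.exp (-2 * y) := by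
  have := Real.exp_lt_one_iff.2 (by linarith : -2 * y < 0)
  linarith

theorem kappa_nonneg {y : ℝ} (hy : 0 < y) : 0 ≤ kappa y :=
  div_nonneg (Real.exp_pos _).le (one_sub_exp_pos hy).le

/-- `kappa` behaves like 1/(2y) at 0 and like e^(-y/2) at infinity. One factor y removes the
singularity and leaves an integrable function. -/
theorem mul_kappa_le {y : ℝ} (hy : 0 < y) : y * kappa y ≤ 5 * Real.exp (-(1 / 4) * y) := by
  have h1 := one_sub_exp_pos hy
  rw [kappa, mul_div_assoc', div_le_iff₀ h1]
  have e1 : Real.exp (-2 * y) * (1 + 2 * y) ≤ 1 := by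
    have := Real.add_one_le_exp (2 * y)
    calc Real.exp (-2 * y) * (1 + 2 * y) ≤ Real.exp (-2 * y) * Real.exp (2 * y) := by
          gcongr; linarith
      _ = 1 := by rw [← Real.exp_add]; simp
  -- One copy of e^(-y/4) absorbs the factor 1 + 2y, the other is the decay that is kept.
  have e2 : Real.exp (-y / 2) = Real.exp (-(1 / 4) * y) * Real.exp (-(1 / 4) * y) := by
    rw [← Real.exp_add]; congr 1; ring
  have e3 : Real.exp (-(1 / 4) * y) * (1 + y / 4) ≤ 1 := by
    have := Real.add_one_le_exp (y / 4)
    calc Real.exp (-(1 / 4) * y) * (1 + y / 4) ≤ Real.exp (-(1 / 4) * y) * Real.exp (y / 4) := by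
          gcongr; linarith
      _ = 1 := by rw [← Real.exp_add]; ring_nf; simp
  rw [e2]
  have p1 := Real.exp_pos (-(1 / 4) * y)
  set E := Real.exp (-(1 / 4) * y)
  set D := Real.exp (-2 * y)
  have e4 : 2 * y ≤ (1 - D) * (1 + 2 * y) := by linarith
  have e5 : y * E ≤ 5 * (1 - D) := by
    have : 2 * y * E ≤ (1 - D) * (1 + 2 * y) * E := by gcongr
    have h8 : (1 + 2 * y) * E ≤ 10 := by nlinarith
    nlinarith
  nlinarith

theorem measurable_kappa : Measurable kappa := by
  unfold kappa; fun_prop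

theorem integrableOn_mul_kappa : IntegrableOn (fun y => y * kappa y) (Set.Ioi 0) := by
  have h1 : IntegrableOn (fun y : ℝ => 5 * Real.exp (-(1 / 4) * y)) (Set.Ioi 0) :=
    (integrableOn_exp_mul_Ioi (by norm_num) 0).const_mul 5
  refine Integrable.mono' h1 (measurable_id.mul measurable_kappa).aestronglyMeasurable ?_
  filter_upwards [ae_restrict_mem measurableSet_Ioi] with y hy
  have hy0 : (0 : ℝ) < y := hy
  rw [Real.norm_of_nonneg (mul_nonneg hy0.le (kappa_nonneg hy0))]
  exact mul_kappa_le hy0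

theorem norm_kappa_mul_le {y : ℝ} (hy : 0 < y) {z : ℂ} (hz : 0 ≤ z.re) :
    ‖(kappa y : ℂ) * (1 - Complex.exp (-(y * z)))‖ ≤ ‖z‖ * (y * kappa y) := by
  rw [norm_mul, Complex.norm_real, Real.norm_of_nonneg (kappa_nonneg hy)]
  have := norm_one_sub_exp_neg_le (w := y * z) (by simp; positivity)
  rw [norm_mul, Complex.norm_real, Real.norm_of_nonneg hy.le] at this
  have := mul_le_mul_of_nonneg_left this (kappa_nonneg hy)
  linarith

theorem integrableOn_kappa_mul {z : ℂ} (hz : 0 ≤ z.re) :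
    IntegrableOn (fun y : ℝ => (kappa y : ℂ) * (1 - Complex.exp (-(y * z)))) (Set.Ioi 0) := by
  refine Integrable.mono' (integrableOn_mul_kappa.const_mul ‖z‖) ?_ ?_
  · have := measurable_kappa
    exact Measurable.aestronglyMeasurable (by fun_prop)
  · filter_upwards [ae_restrict_mem measurableSet_Ioi] with y hy
    exact norm_kappa_mul_le hy hz

theorem image_exp_Ioi : (fun y : ℝ => Real.exp (-2 * y)) '' Set.Ioi 0 = Set.Ioo 0 1 := by
  ext t
  constructor
  · rintro ⟨y, hy, rfl⟩
    exact ⟨Real.exp_pos _, Real.exp_lt_one_iff.2 (by have : (0 : ℝ) < y := hy; linarith)⟩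
  · rintro ⟨h0, h1⟩
    refine ⟨-Real.log t / 2, ?_, ?_⟩
    · have := Real.log_neg h0 h1
      simp only [Set.mem_Ioi]; linarith
    · simp only
      rw [show -2 * (-Real.log t / 2) = Real.log t by ring, Real.exp_log h0]

/-- The substitution t = e^(-2y) carries the Beta-type kernel on (0,1) to `kappa` on the half-line,
with its Jacobian included. -/
theorem beta_kernel_comp_exp {z : ℂ} {y : ℝ} (hy : 0 < y) :
    |-2 * Real.exp (-2 * y)| • ((((Real.exp (-2 * y) : ℝ) : ℂ) ^ ((1 / 4 : ℂ) - 1) -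
      ((Real.exp (-2 * y) : ℝ) : ℂ) ^ (1 / 4 + z / 2 - 1)) / (1 - (Real.exp (-2 * y) : ℝ))) =
    2 * ((kappa y : ℂ) * (1 - Complex.exp (-(y * z)))) := by
  have h1 : (0 : ℝ) < Real.exp (-2 * y) := Real.exp_pos _
  have h2 : |-2 * Real.exp (-2 * y)| = 2 * Real.exp (-2 * y) := by
    rw [abs_mul, abs_of_pos h1]; norm_num
  have hpow : ∀ s : ℂ, ((Real.exp (-2 * y) : ℝ) : ℂ) ^ s = Complex.exp (-2 * y * s) := by
    intro s
    rw [Complex.cpow_def_of_ne_zero (by exact_mod_cast h1.ne'), ← Complex.ofReal_log h1.le,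
      Real.log_exp]
    push_cast; ring_nf
  have h3 : (1 - (Real.exp (-2 * y) : ℝ) : ℂ) ≠ 0 := by
    have := (one_sub_exp_pos hy).ne'
    exact_mod_cast this
  rw [h2, hpow, hpow, kappa, Complex.real_smul]
  push_cast at h3 ⊢
  field_simp
  rw [mul_sub, ← Complex.exp_add, ← Complex.exp_add, mul_sub (Complex.exp (-((y : ℂ) / 2))),
    mul_one, ← Complex.exp_add]
  congr 2 <;> (congr 1; ring)

theorem integrableOn_beta_kernel {z : ℂ} (hz : 0 ≤ z.re) :
    IntegrableOn (fun t : ℝ => ((t : ℂ) ^ ((1 / 4 : ℂ) - 1) - (t : ℂ) ^ (1 / 4 + z / 2 - 1)) /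
      (1 - t)) (Set.Ioo 0 1) := by
  have hinj : Set.InjOn (fun y : ℝ => Real.exp (-2 * y)) (Set.Ioi 0) := by
    intro a _ b _ h
    have := Real.exp_injective h
    linarith
  have hder : ∀ y ∈ Set.Ioi (0 : ℝ), HasDerivWithinAt (fun y : ℝ => Real.exp (-2 * y))
      (-2 * Real.exp (-2 * y)) (Set.Ioi 0) y := by
    intro y _
    have : HasDerivAt (fun y : ℝ => Real.exp (-2 * y)) (Real.exp (-2 * y) * (-2 * 1)) y :=
      ((hasDerivAt_id y).const_mul (-2)).exp
    exact (this.congr_deriv (by ring)).hasDerivWithinAt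
  rw [← image_exp_Ioi, integrableOn_image_iff_integrableOn_abs_deriv_smul measurableSet_Ioi hder hinj]
  refine IntegrableOn.congr_fun (f := fun y : ℝ => 2 * ((kappa y : ℂ) * (1 - Complex.exp (-(y * z)))))
    ((integrableOn_kappa_mul hz).const_mul 2) (fun y hy => ?_) measurableSet_Ioi
  exact (beta_kernel_comp_exp hy).symm

theorem integral_beta_kernel {z : ℂ} :
    ∫ t in Set.Ioo (0 : ℝ) 1, ((t : ℂ) ^ ((1 / 4 : ℂ) - 1) - (t : ℂ) ^ (1 / 4 + z / 2 - 1)) /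
      (1 - t) = 2 * ∫ y in Set.Ioi (0 : ℝ), (kappa y : ℂ) * (1 - Complex.exp (-(y * z))) := by
  have hinj : Set.InjOn (fun y : ℝ => Real.exp (-2 * y)) (Set.Ioi 0) := by
    intro a _ b _ h
    have := Real.exp_injective h
    linarith
  have hder : ∀ y ∈ Set.Ioi (0 : ℝ), HasDerivWithinAt (fun y : ℝ => Real.exp (-2 * y))
      (-2 * Real.exp (-2 * y)) (Set.Ioi 0) y := by
    intro y _
    have : HasDerivAt (fun y : ℝ => Real.exp (-2 * y)) (Real.exp (-2 * y) * (-2 * 1)) y :=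
      ((hasDerivAt_id y).const_mul (-2)).exp
    exact (this.congr_deriv (by ring)).hasDerivWithinAt
  rw [← image_exp_Ioi, integral_image_eq_integral_abs_deriv_smul measurableSet_Ioi hder hinj,
    ← integral_const_mul]
  exact setIntegral_congr_fun measurableSet_Ioi fun y hy => beta_kernel_comp_exp hy

theorem ne_neg_nat_of_re_pos {s : ℂ} (hs : 0 < s.re) (m : ℕ) : s ≠ -m := by
  rintro rfl
  simp at hs
  have : (0 : ℝ) ≤ m := by positivity
  linarith

theorem hasDerivAt_Gamma_ratio {s : ℂ} (hs : 0 < s.re) :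
    HasDerivAt (fun u : ℝ => Complex.Gamma s / Complex.Gamma (s + u)) (-Complex.digamma s) 0 := by
  have h1 : HasDerivAt Complex.Gamma (deriv Complex.Gamma s) (s + (0 : ℝ)) := by
    simpa using (Complex.differentiableAt_Gamma s (ne_neg_nat_of_re_pos hs)).hasDerivAt
  have h2 : HasDerivAt (fun u : ℝ => s + (u : ℂ)) 1 0 :=
    (Complex.ofRealCLM.hasDerivAt (x := (0 : ℝ))).const_add s
  have h3 := h1.scomp (0 : ℝ) h2
  have hG := Complex.Gamma_ne_zero (ne_neg_nat_of_re_pos hs)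
  have h4 := (hasDerivAt_const (0 : ℝ) (Complex.Gamma s)).div h3 (by simpa using hG)
  refine HasDerivAt.congr_deriv h4 ?_
  simp only [Function.comp, Complex.ofReal_zero, add_zero, Complex.digamma_def, logDeriv_apply]
  simp only [one_smul]
  field_simp
  ring

/-- Consider B(1/4,u) - B(s,u) with s = 1/4 + z/2 as u → 0+. In the Beta integrals the limit follows
by dominated convergence, since (1 - t)^u ≤ 1. In terms of Γ it is uΓ(u) → 1 times the difference
quotient of Γ(1/4)/Γ(1/4+u) - Γ(s)/Γ(s+u), which tends to the difference of digamma values. -/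
theorem digamma_sub_eq_integral {z : ℂ} (hz : 0 ≤ z.re) :
    Complex.digamma (1 / 4 + z / 2) - Complex.digamma (1 / 4) =
      2 * ∫ y in Set.Ioi (0 : ℝ), (kappa y : ℂ) * (1 - Complex.exp (-(y * z))) := by
  rw [← integral_beta_kernel]
  set s : ℂ := 1 / 4 + z / 2 with hs
  have hs0 : 0 < s.re := by simp [hs]; linarith
  have hq0 : 0 < (1 / 4 : ℂ).re := by norm_num
  set K : ℝ → ℂ := fun t => ((t : ℂ) ^ ((1 / 4 : ℂ) - 1) - (t : ℂ) ^ (s - 1)) / (1 - t) with hK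
  have hint : IntegrableOn K (Set.Ioo 0 1) := integrableOn_beta_kernel hz
  have hlim1 : Tendsto (fun u : ℝ => ∫ t in Set.Ioo (0 : ℝ) 1, K t * (1 - (t : ℂ)) ^ (u : ℂ))
      (𝓝[>] 0) (𝓝 (∫ t in Set.Ioo (0 : ℝ) 1, K t)) := by
    refine tendsto_integral_filter_of_dominated_convergence (fun t => ‖K t‖) ?_ ?_ hint.norm ?_
    · refine Eventually.of_forall fun u => hint.aestronglyMeasurable.mul ?_
      exact Measurable.aestronglyMeasurable (by fun_prop)
    · filter_upwards [self_mem_nhdsWithin] with u hu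
      filter_upwards [ae_restrict_mem measurableSet_Ioo] with t ht
      rw [norm_mul]
      refine mul_le_of_le_one_right (norm_nonneg _) ?_
      have h1 : (0 : ℝ) < 1 - t := by linarith [ht.2]
      rw [← Complex.ofReal_one, ← Complex.ofReal_sub, Complex.norm_cpow_eq_rpow_re_of_pos h1]
      exact Real.rpow_le_one h1.le (by linarith [ht.1]) (le_of_lt (by simpa using hu))
    · filter_upwards [ae_restrict_mem measurableSet_Ioo] with t ht
      have h1 : (0 : ℝ) < 1 - t := by linarith [ht.2]
      have h2 : (1 - (t : ℂ)) ≠ 0 := by exact_mod_cast h1.ne'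
      have h3 : ContinuousAt (fun u : ℝ => (1 - (t : ℂ)) ^ (u : ℂ)) 0 :=
        ContinuousAt.const_cpow (by fun_prop) (Or.inl h2)
      have h4 : Tendsto (fun u : ℝ => K t * (1 - (t : ℂ)) ^ (u : ℂ)) (𝓝 0) (𝓝 (K t * 1)) := by
        refine Tendsto.const_mul _ ?_
        simpa [ContinuousAt] using h3
      rw [mul_one] at h4
      exact h4.mono_left nhdsWithin_le_nhds
  have hlim2 : Tendsto (fun u : ℝ => ∫ t in Set.Ioo (0 : ℝ) 1, K t * (1 - (t : ℂ)) ^ (u : ℂ))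
      (𝓝[>] 0) (𝓝 (Complex.digamma s - Complex.digamma (1 / 4))) := by
    have hd := (hasDerivAt_Gamma_ratio hq0).sub (hasDerivAt_Gamma_ratio hs0)
    have hsl := hd.tendsto_slope_zero_right
    have hG : Tendsto (fun u : ℝ => (u : ℂ) * Complex.Gamma u) (𝓝[>] 0) (𝓝 1) := by
      refine Complex.tendsto_self_mul_Gamma_nhds_zero.comp ?_
      refine tendsto_nhdsWithin_iff.2 ⟨?_, ?_⟩
      · have : Tendsto (fun u : ℝ => (u : ℂ)) (𝓝 0) (𝓝 ((0 : ℝ) : ℂ)) :=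
          Complex.continuous_ofReal.continuousAt
        exact (by simpa using this : Tendsto (fun u : ℝ => (u : ℂ)) (𝓝 0) (𝓝 0)).mono_left
          nhdsWithin_le_nhds
      · filter_upwards [self_mem_nhdsWithin] with u hu
        simpa using (ne_of_gt hu : u ≠ 0)
    have h5 := hG.mul hsl
    rw [one_mul, show -Complex.digamma (1 / 4) - -Complex.digamma s =
      Complex.digamma s - Complex.digamma (1 / 4) by ring] at h5
    refine h5.congr' ?_
    filter_upwards [self_mem_nhdsWithin] with u hu
    have hu0 : (0 : ℝ) < u := hu
    have hbeta : ∀ q : ℂ, 0 < q.re → Complex.Gamma u * (Complex.Gamma q / Complex.Gamma (q + u)) =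
        ∫ t in Set.Ioo (0 : ℝ) 1, (t : ℂ) ^ (q - 1) * (1 - (t : ℂ)) ^ ((u : ℂ) - 1) := by
      intro q hq
      have h6 := Complex.Gamma_mul_Gamma_eq_betaIntegral hq (t := (u : ℂ)) (by simpa using hu0)
      have h7 : Complex.Gamma (q + u) ≠ 0 :=
        Complex.Gamma_ne_zero (ne_neg_nat_of_re_pos (by simp; linarith))
      rw [← integral_Ioc_eq_integral_Ioo, ← intervalIntegral.integral_of_le zero_le_one]
      change _ = Complex.betaIntegral q u
      field_simp
      rw [mul_comm, h6, mul_comm]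
    have hbint : ∀ q : ℂ, 0 < q.re → IntegrableOn
        (fun t : ℝ => (t : ℂ) ^ (q - 1) * (1 - (t : ℂ)) ^ ((u : ℂ) - 1)) (Set.Ioo 0 1) := by
      intro q hq
      have := Complex.betaIntegral_convergent hq (v := (u : ℂ)) (by simpa using hu0)
      exact ((intervalIntegrable_iff_integrableOn_Ioc_of_le zero_le_one).1 this).mono_set
        Set.Ioo_subset_Ioc_self
    have h8 : ∫ t in Set.Ioo (0 : ℝ) 1, K t * (1 - (t : ℂ)) ^ (u : ℂ) =
        Complex.Gamma u * (Complex.Gamma (1 / 4) / Complex.Gamma (1 / 4 + u)) -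
        Complex.Gamma u * (Complex.Gamma s / Complex.Gamma (s + u)) := by
      rw [hbeta _ hq0, hbeta _ hs0, ← integral_sub (hbint _ hq0) (hbint _ hs0)]
      refine setIntegral_congr_fun measurableSet_Ioo fun t ht => ?_
      have h1 : (0 : ℝ) < 1 - t := by linarith [ht.2]
      have h2 : (1 - (t : ℂ)) ≠ 0 := by exact_mod_cast h1.ne'
      simp only [hK]
      rw [Complex.cpow_sub _ _ h2, Complex.cpow_one]
      ring
    rw [h8]
    have hu1 : (u : ℂ) ≠ 0 := by exact_mod_cast hu0.ne'
    have hq1 : Complex.Gamma (1 / 4) ≠ 0 := Complex.Gamma_ne_zero (ne_neg_nat_of_re_pos hq0)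
    have hs1 : Complex.Gamma s ≠ 0 := Complex.Gamma_ne_zero (ne_neg_nat_of_re_pos hs0)
    simp only [Pi.sub_apply, zero_add, Complex.ofReal_zero, add_zero, div_self hq1, div_self hs1,
      sub_self, sub_zero, Complex.real_smul, Complex.ofReal_inv]
    field_simp
  exact tendsto_nhds_unique hlim2 hlim1

end ZetaStatistics
end

/-! ### The two-sided Laplace transform of a test function. -/

noncomputable section
namespace ZetaStatistics

/-- The two-sided Laplace transform `z ↦ ∫ g(x) e^{xz} dx`. -/
def lap (g : ℝ → ℂ) (z : ℂ) : ℂ := ∫ x : ℝ, g x * Complex.exp (x * z)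

theorem integrable_mul_exp {g : ℝ → ℂ} (hg : Continuous g) (hc : HasCompactSupport g) (z : ℂ) :
    Integrable fun x : ℝ => g x * Complex.exp (x * z) :=
  Continuous.integrable_of_hasCompactSupport (by fun_prop) hc.mul_right

theorem lap_deriv {g : ℝ → ℂ} (hg : ContDiff ℝ 1 g) (hc : HasCompactSupport g) (z : ℂ) :
    lap (deriv g) z = -z * lap g z := by
  have hd : ∀ x : ℝ, HasDerivAt (fun x : ℝ => Complex.exp (x * z)) (z * Complex.exp (x * z)) x := by
    intro x
    have := ((Complex.ofRealCLM.hasDerivAt (x := x)).mul_const z).cexp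
    refine this.congr_deriv ?_
    simp [mul_comm]
  have hg' : ∀ x, HasDerivAt g (deriv g x) x := fun x =>
    (hg.differentiable (by norm_num) x).hasDerivAt
  have hdc : Continuous (deriv g) := hg.continuous_deriv le_rfl
  have := integral_mul_deriv_eq_deriv_mul_of_integrable (u := g)
    (v := fun x : ℝ => Complex.exp (x * z)) (fun x _ => hg' x) (fun x _ => hd x) ?_ ?_ ?_
  · unfold lap
    rw [← neg_inj, ← this, neg_mul, neg_neg, ← integral_const_mul]
    congr 1 with x
    ring
  · refine Continuous.integrable_of_hasCompactSupport ?_ hc.mul_right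
    have := hg.continuous
    exact this.mul (by fun_prop)
  · exact integrable_mul_exp hdc hc.deriv z
  · exact integrable_mul_exp hg.continuous hc z

theorem lap_iteratedDeriv {g : ℝ → ℂ} (hg : ContDiff ℝ ∞ g) (hc : HasCompactSupport g) (n : ℕ)
    (z : ℂ) : lap (iteratedDeriv n g) z = (-z) ^ n * lap g z := by
  induction n generalizing g with
  | zero => simp [iteratedDeriv_zero]
  | succ n ih =>
    rw [iteratedDeriv_succ', ih (contDiff_infty_iff_deriv.1 hg).2 hc.deriv,
      lap_deriv (hg.of_le (by exact_mod_cast le_top)) hc]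
    ring

theorem norm_lap_le {g : ℝ → ℂ} (hg : Continuous g) (hc : HasCompactSupport g) {b : ℝ}
    (hb : ∀ x, b < |x| → g x = 0) (z : ℂ) :
    ‖lap g z‖ ≤ Real.exp (b * |z.re|) * ∫ x, ‖g x‖ := by
  unfold lap
  rw [← integral_const_mul]
  refine norm_integral_le_of_norm_le ((hg.integrable_of_hasCompactSupport hc).norm.const_mul _)
    (Eventually.of_forall fun x => ?_)
  by_cases hx : b < |x|
  · simp [hb x hx]
  · rw [norm_mul, Complex.norm_exp, mul_comm]
    refine mul_le_mul_of_nonneg_right (Real.exp_le_exp.2 ?_) (norm_nonneg _)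
    have h1 : (x * z : ℂ).re = x * z.re := by simp
    rw [h1]
    calc x * z.re ≤ |x * z.re| := le_abs_self _
      _ = |x| * |z.re| := abs_mul _ _
      _ ≤ b * |z.re| := mul_le_mul_of_nonneg_right (not_lt.1 hx) (abs_nonneg _)

/-- The Paley–Wiener bound, by n integrations by parts. The factor e^(b|Re z|) later becomes T^(b/2)
in the pole term. -/
theorem exists_pow_mul_norm_lap_le {g : ℝ → ℂ} (hg : ContDiff ℝ ∞ g) (hc : HasCompactSupport g)
    {b : ℝ} (hb : ∀ x, b < |x| → g x = 0) (n : ℕ) :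
    ∃ C : ℝ, 0 ≤ C ∧ ∀ z : ℂ, (1 + ‖z‖) ^ n * ‖lap g z‖ ≤ C * Real.exp (b * |z.re|) := by
  have hdc : Continuous (iteratedDeriv n g) := hg.continuous_iteratedDeriv n (by exact_mod_cast le_top)
  have hcs : HasCompactSupport (iteratedDeriv n g) := by
    refine hc.mono' ?_
    exact (Function.support_subset_iff'.2 fun x hx => by
      have : g =ᶠ[𝓝 x] 0 := notMem_tsupport_iff_eventuallyEq.1 hx
      have h := this.iteratedDeriv_eq n
      rw [h]; simp)
  have hbd : ∀ x, b < |x| → iteratedDeriv n g x = 0 := by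
    intro x hx
    have : g =ᶠ[𝓝 x] 0 := by
      have h1 : ∀ᶠ y in 𝓝 x, b < |y| := continuous_abs.continuousAt.eventually (lt_mem_nhds hx)
      filter_upwards [h1] with y hy using hb y hy
    rw [this.iteratedDeriv_eq n]; simp
  refine ⟨2 ^ n * ((∫ x, ‖g x‖) + ∫ x, ‖iteratedDeriv n g x‖), by
    have h1 : 0 ≤ ∫ x, ‖g x‖ := integral_nonneg fun _ => norm_nonneg _
    have h2 : 0 ≤ ∫ x, ‖iteratedDeriv n g x‖ := integral_nonneg fun _ => norm_nonneg _
    positivity, fun z => ?_⟩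
  have h1 := norm_lap_le hg.continuous hc hb z
  have h2 := norm_lap_le hdc hcs hbd z
  rw [lap_iteratedDeriv hg hc, norm_mul, norm_pow, norm_neg] at h2
  have h3 : (1 + ‖z‖) ^ n ≤ 2 ^ n * (1 + ‖z‖ ^ n) := by
    have : (1 + ‖z‖) ≤ 2 * max 1 ‖z‖ := by
      have := le_max_left 1 ‖z‖
      have := le_max_right 1 ‖z‖
      linarith
    calc (1 + ‖z‖) ^ n ≤ (2 * max 1 ‖z‖) ^ n := by gcongr
      _ = 2 ^ n * (max 1 ‖z‖) ^ n := mul_pow _ _ _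
      _ ≤ 2 ^ n * (1 + ‖z‖ ^ n) := by
        gcongr
        rcases le_total 1 ‖z‖ with h | h
        · rw [max_eq_right h]; linarith
        · rw [max_eq_left h, one_pow]
          have : 0 ≤ ‖z‖ ^ n := by positivity
          linarith
  calc (1 + ‖z‖) ^ n * ‖lap g z‖ ≤ 2 ^ n * (1 + ‖z‖ ^ n) * ‖lap g z‖ := by gcongr
    _ = 2 ^ n * (‖lap g z‖ + ‖z‖ ^ n * ‖lap g z‖) := by ring
    _ ≤ 2 ^ n * (Real.exp (b * |z.re|) * (∫ x, ‖g x‖) +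
        Real.exp (b * |z.re|) * ∫ x, ‖iteratedDeriv n g x‖) := by gcongr
    _ = _ := by ring

theorem exists_support_bound {g : ℝ → ℂ} (hc : HasCompactSupport g) :
    ∃ b : ℝ, 0 ≤ b ∧ ∀ x, b < |x| → g x = 0 := by
  obtain ⟨b, hb⟩ := hc.isCompact.isBounded.subset_closedBall 0
  refine ⟨max b 0, le_max_right _ _, fun x hx => image_eq_zero_of_notMem_tsupport fun h => ?_⟩
  have := hb h
  simp only [Metric.mem_closedBall, dist_zero_right, Real.norm_eq_abs] at this
  exact absurd (this.trans (le_max_left _ _)) (not_le.2 hx)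

theorem continuous_lap {g : ℝ → ℂ} (hg : Continuous g) (hc : HasCompactSupport g) :
    Continuous (lap g) := by
  obtain ⟨b, -, hb⟩ := exists_support_bound hc
  have h1 : lap g = fun z : ℂ => ∫ x in Set.Icc (-b) b, g x * Complex.exp (x * z) := by
    funext z
    rw [setIntegral_eq_integral_of_forall_compl_eq_zero]
    · rfl
    · intro x hx
      rw [hb x, zero_mul]
      by_contra! h
      exact hx (abs_le.1 h)
  rw [h1]
  exact continuous_parametric_integral_of_continuous (by fun_prop) isCompact_Icc

/-- The point `c + ir` on the vertical line with abscissa `c`. -/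
def vline (c r : ℝ) : ℂ := c + r * Complex.I

@[simp] theorem vline_re (c r : ℝ) : (vline c r).re = c := by simp [vline]

theorem abs_le_norm_vline (c r : ℝ) : |r| ≤ ‖vline c r‖ := by
  have := Complex.abs_im_le_norm (vline c r)
  simpa [vline] using this

theorem continuous_vline (c : ℝ) : Continuous (vline c) := by unfold vline; fun_prop

theorem integrable_pow_mul_lap {g : ℝ → ℂ} (hg : ContDiff ℝ ∞ g) (hc : HasCompactSupport g) (n : ℕ)
    (c : ℝ) : Integrable fun r : ℝ => (1 + ‖vline c r‖) ^ n * ‖lap g (vline c r)‖ := by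
  obtain ⟨b, -, hb⟩ := exists_support_bound hc
  obtain ⟨C, hC, h⟩ := exists_pow_mul_norm_lap_le hg hc hb (n + 2)
  have hcont := (continuous_lap hg.continuous hc).comp (continuous_vline c)
  have hv := continuous_vline c
  refine Integrable.mono' (integrable_inv_one_add_sq.const_mul (C * Real.exp (b * |c|))) ?_ ?_
  · exact Continuous.aestronglyMeasurable (by
      have : Continuous fun r => ‖lap g (vline c r)‖ := hcont.norm
      fun_prop)
  · refine Eventually.of_forall fun r => ?_
    have h1 := h (vline c r)
    rw [vline_re] at h1
    rw [Real.norm_of_nonneg (by positivity), ← div_eq_mul_inv, le_div_iff₀ (by positivity)]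
    refine le_trans ?_ h1
    have h2 := abs_le_norm_vline c r
    have h3 : 1 + r ^ 2 ≤ (1 + ‖vline c r‖) ^ 2 := by
      rw [← sq_abs r]
      nlinarith [abs_nonneg r, norm_nonneg (vline c r)]
    rw [pow_add]
    calc (1 + ‖vline c r‖) ^ n * ‖lap g (vline c r)‖ * (1 + r ^ 2)
        ≤ (1 + ‖vline c r‖) ^ n * ‖lap g (vline c r)‖ * (1 + ‖vline c r‖) ^ 2 := by gcongr
      _ = _ := by ring

theorem integrable_lap {g : ℝ → ℂ} (hg : ContDiff ℝ ∞ g) (hc : HasCompactSupport g) (c : ℝ) :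
    Integrable fun r : ℝ => lap g (vline c r) := by
  have h := integrable_pow_mul_lap hg hc 0 c
  simp only [pow_zero, one_mul] at h
  exact (integrable_norm_iff ((continuous_lap hg.continuous hc).comp
    (continuous_vline c)).aestronglyMeasurable).1 h

/-- On the line Re z = c the transform is the Fourier transform of g(x)e^(cx), up to the scaling r =
-2πξ, so Fourier inversion applies. -/
theorem lap_inversion {g : ℝ → ℂ} (hg : ContDiff ℝ ∞ g) (hc : HasCompactSupport g) (c x : ℝ) :
    ∫ r : ℝ, lap g (vline c r) * Complex.exp (-(x * vline c r)) = 2 * Real.pi * g x := by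
  set h : ℝ → ℂ := fun x => g x * Complex.exp (x * c) with hh
  have hhc : Continuous h := by have := hg.continuous; fun_prop
  have hhi : Integrable h := integrable_mul_exp hg.continuous hc c
  have hF : ∀ ξ : ℝ, 𝓕 h ξ = lap g (vline c (-2 * Real.pi * ξ)) := by
    intro ξ
    rw [Real.fourier_eq', lap]
    congr 1 with y
    simp only [hh, smul_eq_mul, vline]
    rw [mul_comm, mul_assoc, ← Complex.exp_add]
    congr 2
    simp
    ring
  have hpi : (-2 * Real.pi) ≠ 0 := by have := Real.pi_pos; nlinarith
  have hFi : Integrable (𝓕 h) := by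
    have := (integrable_lap hg hc c).comp_mul_left' hpi
    exact this.congr (Eventually.of_forall fun ξ => (hF ξ).symm)
  have hinv := congrFun (hhc.fourierInv_fourier_eq hhi hFi) x
  rw [Real.fourierInv_eq'] at hinv
  have h1 : ∀ ξ : ℝ, Complex.exp (((2 * Real.pi * inner ℝ ξ x : ℝ) : ℂ) * Complex.I) • 𝓕 h ξ =
      Complex.exp (x * c) * (fun r : ℝ => lap g (vline c r) * Complex.exp (-(x * vline c r)))
        ((-2 * Real.pi) * ξ) := by
    intro ξ
    rw [hF, smul_eq_mul]
    simp only
    rw [mul_left_comm, ← Complex.exp_add, mul_comm]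
    congr 2
    simp [vline]
    ring
  have h2 := Measure.integral_comp_mul_left
    (fun r : ℝ => lap g (vline c r) * Complex.exp (-(x * vline c r))) (-2 * Real.pi)
  simp_rw [h1] at hinv
  rw [integral_const_mul, h2] at hinv
  have h3 : |(-2 * Real.pi)⁻¹| = (2 * Real.pi)⁻¹ := by
    rw [abs_inv, abs_of_neg (by have := Real.pi_pos; linarith)]
    congr 1; ring
  rw [h3, Complex.real_smul] at hinv
  simp only [hh] at hinv
  have hpi' : (Real.pi : ℂ) ≠ 0 := by exact_mod_cast Real.pi_ne_zero
  have he := Complex.exp_ne_zero ((x : ℂ) * c)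
  push_cast at hinv
  set J := ∫ r : ℝ, lap g (vline c r) * Complex.exp (-(x * vline c r))
  rw [mul_comm (g x)] at hinv
  have h4 := mul_left_cancel₀ he hinv
  rw [← h4]
  field_simp

end ZetaStatistics
end

/-! ### Integration along the line Re z = 1, and the two expansions of ξ'/ξ. -/

noncomputable section
namespace ZetaStatistics

/-- The integral of `h` against the Laplace transform of `g` on the line `Re z = 1`. -/
def lineInt (g : ℝ → ℂ) (h : ℂ → ℂ) : ℂ :=
  (2 * Real.pi : ℂ)⁻¹ * ∫ r : ℝ, lap g (vline 1 r) * h (vline 1 r)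

theorem lineInt_exp {g : ℝ → ℂ} (hg : ContDiff ℝ ∞ g) (hc : HasCompactSupport g) (x : ℝ) :
    lineInt g (fun z => Complex.exp (-(x * z))) = g x := by
  rw [lineInt, lap_inversion hg hc]
  have hpi' : (Real.pi : ℂ) ≠ 0 := by exact_mod_cast Real.pi_ne_zero
  field_simp

theorem lineInt_one {g : ℝ → ℂ} (hg : ContDiff ℝ ∞ g) (hc : HasCompactSupport g) :
    lineInt g (fun _ => 1) = g 0 := by
  have := lineInt_exp hg hc 0
  simpa using this

theorem integrable_lap_mul {g : ℝ → ℂ} (hg : ContDiff ℝ ∞ g) (hc : HasCompactSupport g)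
    {h : ℂ → ℂ} (hm : AEStronglyMeasurable fun r => h (vline 1 r)) {K : ℝ} {n : ℕ}
    (hle : ∀ r, ‖h (vline 1 r)‖ ≤ K * (1 + ‖vline 1 r‖) ^ n) :
    Integrable fun r : ℝ => lap g (vline 1 r) * h (vline 1 r) := by
  refine Integrable.mono' ((integrable_pow_mul_lap hg hc n 1).const_mul K)
    ((integrable_lap hg hc 1).aestronglyMeasurable.mul hm) (Eventually.of_forall fun r => ?_)
  rw [norm_mul]
  calc _ ≤ ‖lap g (vline 1 r)‖ * (K * (1 + ‖vline 1 r‖) ^ n) := by gcongr; exact hle r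
    _ = _ := by ring

theorem lineInt_const_mul (g : ℝ → ℂ) (k : ℂ) (h : ℂ → ℂ) :
    lineInt g (fun z => k * h z) = k * lineInt g h := by
  unfold lineInt
  rw [mul_left_comm, ← integral_const_mul k]
  congr 2
  funext r
  ring

theorem lineInt_congr {g : ℝ → ℂ} {h₁ h₂ : ℂ → ℂ} (h : ∀ r, h₁ (vline 1 r) = h₂ (vline 1 r)) :
    lineInt g h₁ = lineInt g h₂ := by
  unfold lineInt
  simp_rw [h]

/-- Interchange of `lineInt` with an integral of exponentials. -/
theorem lineInt_integral {g : ℝ → ℂ} (hg : ContDiff ℝ ∞ g) (hc : HasCompactSupport g)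
    {F : ℝ → ℂ → ℂ} (hF : Measurable (Function.uncurry F)) {k : ℝ → ℝ}
    (hk : IntegrableOn k (Set.Ioi 0)) {n : ℕ}
    (hle : ∀ y, 0 < y → ∀ r, ‖F y (vline 1 r)‖ ≤ (1 + ‖vline 1 r‖) ^ n * k y) :
    lineInt g (fun z => ∫ y in Set.Ioi (0 : ℝ), F y z) =
      ∫ y in Set.Ioi (0 : ℝ), lineInt g (F y) := by
  unfold lineInt
  rw [integral_const_mul]
  congr 1
  simp_rw [← integral_const_mul]
  refine integral_integral_swap ?_
  have hprod := (integrable_pow_mul_lap hg hc n 1).mul_prod hk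
  have hm1 : Measurable fun p : ℝ × ℝ => lap g (vline 1 p.1) :=
    ((continuous_lap hg.continuous hc).comp (continuous_vline 1)).measurable.comp measurable_fst
  have hm2 : Measurable fun p : ℝ × ℝ => F p.2 (vline 1 p.1) :=
    hF.comp (measurable_snd.prodMk ((continuous_vline 1).measurable.comp measurable_fst))
  refine Integrable.mono' hprod (hm1.mul hm2).aestronglyMeasurable ?_
  have h0 : ∀ᵐ p : ℝ × ℝ ∂(volume.prod (volume.restrict (Set.Ioi (0 : ℝ)))), 0 < p.2 := by
    have h1 : ∀ᵐ y ∂(volume.restrict (Set.Ioi (0 : ℝ))), 0 < y := ae_restrict_mem measurableSet_Ioi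
    exact (Measure.quasiMeasurePreserving_snd).ae h1
  filter_upwards [h0] with p hp
  simp only [Function.uncurry, norm_mul]
  calc _ ≤ ‖lap g (vline 1 p.1)‖ * ((1 + ‖vline 1 p.1‖) ^ n * k p.2) := by
        gcongr; exact hle p.2 hp p.1
    _ = _ := by ring

theorem one_div_sub_eq_integral {z ρ : ℂ} (h : ρ.re < z.re) :
    1 / (z - ρ) = ∫ x in Set.Ioi (0 : ℝ), Complex.exp (x * ρ) * Complex.exp (-(x * z)) := by
  have := integral_exp_mul_complex_Ioi (a := ρ - z) (by simpa using h) 0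
  simp only [Complex.ofReal_zero, mul_zero, Complex.exp_zero] at this
  rw [← neg_sub, one_div_neg_eq_neg_one_div, ← neg_div, ← this]
  refine setIntegral_congr_fun measurableSet_Ioi fun x _ => ?_
  rw [← Complex.exp_add]
  congr 1
  ring

/-- To the right of ρ the simple fraction is a superposition of exponentials e^(-xz) with x > 0, and
`lineInt_exp` evaluates each one. This takes the place of a residue computation. -/
theorem lineInt_one_div_sub {g : ℝ → ℂ} (hg : ContDiff ℝ ∞ g) (hc : HasCompactSupport g) {ρ : ℂ}
    (hρ : ρ.re < 1) :
    lineInt g (fun z => 1 / (z - ρ)) = ∫ x in Set.Ioi (0 : ℝ), g x * Complex.exp (x * ρ) := by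
  have h1 : lineInt g (fun z => 1 / (z - ρ)) = lineInt g (fun z => ∫ x in Set.Ioi (0 : ℝ),
      Complex.exp (x * ρ) * Complex.exp (-(x * z))) :=
    lineInt_congr fun r => one_div_sub_eq_integral (by simpa using hρ)
  rw [h1, lineInt_integral hg hc (n := 0) (k := fun x => Real.exp ((ρ.re - 1) * x))]
  · refine setIntegral_congr_fun measurableSet_Ioi fun x _ => ?_
    rw [lineInt_const_mul, lineInt_exp hg hc, mul_comm]
  · unfold Function.uncurry; fun_prop
  · exact integrableOn_exp_mul_Ioi (by linarith) 0
  · intro y hy r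
    rw [pow_zero, one_mul, ← Complex.exp_add, Complex.norm_exp]
    refine Real.exp_le_exp.2 (le_of_eq ?_)
    simp
    ring

/-- For even g the half-line transforms from the fractions at z and -z combine to the full
transform. -/
theorem integral_Ioi_add_eq_lap {g : ℝ → ℂ} (hg : Continuous g) (hc : HasCompactSupport g)
    (he : ∀ x, g (-x) = g x) (z : ℂ) :
    (∫ x in Set.Ioi (0 : ℝ), g x * Complex.exp (x * z)) +
      ∫ x in Set.Ioi (0 : ℝ), g x * Complex.exp (x * -z) = lap g z := by
  have h1 : ∫ x in Set.Ioi (0 : ℝ), g x * Complex.exp (x * -z) =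
      ∫ x in Set.Iic (0 : ℝ), g x * Complex.exp (x * z) := by
    have := integral_comp_neg_Ioi (0 : ℝ) (fun x : ℝ => g x * Complex.exp (x * z))
    rw [neg_zero] at this
    rw [← this]
    refine setIntegral_congr_fun measurableSet_Ioi fun x _ => ?_
    simp only [he]
    push_cast
    ring_nf
  rw [h1, add_comm, lap]
  exact intervalIntegral.integral_Iic_add_Ioi
    (integrable_mul_exp hg hc z).integrableOn (integrable_mul_exp hg hc z).integrableOn

/-- Pairing ρ with -ρ gains a second power of |ρ|, enough for `summable_order_xi`. The polynomial
loss in z is harmless against the rapid decay of `lap`. -/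
theorem norm_one_div_add_le {z ρ : ℂ} (hz : z.re = 1) (hρ : |ρ.re| < 1 / 2) :
    ‖1 / (z - ρ) + 1 / (z + ρ)‖ ≤ 18 * (1 + ‖z‖) ^ 3 * (1 / (1 + ‖ρ‖) ^ 2) := by
  rw [abs_lt] at hρ
  have h1 : 1 / 2 ≤ ‖z - ρ‖ := by
    have := Complex.re_le_norm (z - ρ)
    simp only [Complex.sub_re] at this
    linarith
  have h2 : 1 / 2 ≤ ‖z + ρ‖ := by
    have := Complex.re_le_norm (z + ρ)
    simp only [Complex.add_re] at this
    linarith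
  have n1 : z - ρ ≠ 0 := norm_pos_iff.1 (by linarith)
  have n2 : z + ρ ≠ 0 := norm_pos_iff.1 (by linarith)
  have hz0 := norm_nonneg z
  have hr0 := norm_nonneg ρ
  have h3 : 1 + ‖ρ‖ ≤ 3 * (1 + ‖z‖) * ‖z - ρ‖ := by
    have := norm_sub_norm_le ρ z
    rw [norm_sub_rev] at this
    nlinarith
  have h4 : 1 + ‖ρ‖ ≤ 3 * (1 + ‖z‖) * ‖z + ρ‖ := by
    have := norm_sub_norm_le ρ (-z)
    rw [norm_neg, sub_neg_eq_add, add_comm ρ z] at this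
    nlinarith
  have h5 : 1 / (z - ρ) + 1 / (z + ρ) = 2 * z / ((z - ρ) * (z + ρ)) := by
    field_simp
    ring
  rw [h5, norm_div, norm_mul, norm_mul, Complex.norm_ofNat, mul_one_div, div_le_div_iff₀ (by positivity)
    (by positivity)]
  calc 2 * ‖z‖ * (1 + ‖ρ‖) ^ 2
      = 2 * ‖z‖ * ((1 + ‖ρ‖) * (1 + ‖ρ‖)) := by ring
    _ ≤ 2 * (1 + ‖z‖) * ((3 * (1 + ‖z‖) * ‖z - ρ‖) * (3 * (1 + ‖z‖) * ‖z + ρ‖)) := by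
        gcongr
        linarith
    _ = _ := by ring

theorem integrable_lap_mul_one_div {g : ℝ → ℂ} (hg : ContDiff ℝ ∞ g) (hc : HasCompactSupport g)
    {ρ : ℂ} (hρ : ρ.re < 1) :
    Integrable fun r : ℝ => lap g (vline 1 r) * (1 / (vline 1 r - ρ)) := by
  refine integrable_lap_mul hg hc (h := fun z => 1 / (z - ρ)) (K := 1 / (1 - ρ.re)) (n := 0) ?_ ?_
  · have := (continuous_vline 1).measurable
    exact Measurable.aestronglyMeasurable (by fun_prop)
  · intro r
    rw [pow_zero, mul_one, norm_div, norm_one]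
    refine one_div_le_one_div_of_le (by linarith) ?_
    have := Complex.re_le_norm (vline 1 r - ρ)
    simpa using this

theorem lineInt_add {g : ℝ → ℂ} {h₁ h₂ : ℂ → ℂ}
    (i1 : Integrable fun r : ℝ => lap g (vline 1 r) * h₁ (vline 1 r))
    (i2 : Integrable fun r : ℝ => lap g (vline 1 r) * h₂ (vline 1 r)) :
    lineInt g (fun z => h₁ z + h₂ z) = lineInt g h₁ + lineInt g h₂ := by
  unfold lineInt
  rw [← mul_add, ← integral_add i1 i2]
  congr 2
  funext r
  ring

/-- Interchange of `lineInt` with a dominated series. -/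
theorem hasSum_lineInt {ι : Type*} {g : ℝ → ℂ} (hg : ContDiff ℝ ∞ g)
    (hc : HasCompactSupport g) {F : ι → ℂ → ℂ} (hF : ∀ i, Measurable (F i)) {k : ι → ℝ}
    (hk : Summable k) {n : ℕ} (hle : ∀ i r, ‖F i (vline 1 r)‖ ≤ (1 + ‖vline 1 r‖) ^ n * k i)
    {H : ℂ → ℂ} (hH : ∀ r, HasSum (fun i => F i (vline 1 r)) (H (vline 1 r))) :
    HasSum (fun i => lineInt g (F i)) (lineInt g H) := by
  -- The index type may be uncountable (it is ℂ for the sum over zeros), so the series is first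
  -- restricted to the countable support of its majorant.
  have hcount : (Function.support k).Countable := hk.countable_support
  have hz : ∀ i, k i = 0 → ∀ r, F i (vline 1 r) = 0 := by
    intro i hi r
    have := hle i r
    rw [hi, mul_zero] at this
    exact norm_le_zero_iff.1 this
  have : Countable (Function.support k) := hcount
  have hsub : HasSum (fun i : Function.support k => lineInt g (F i)) (lineInt g H) := by
    unfold lineInt
    refine HasSum.mul_left _ ?_
    have hint : ∀ i, Integrable fun r => lap g (vline 1 r) * F i (vline 1 r) := fun i =>
      integrable_lap_mul hg hc (K := k i) (n := n)
        ((hF i).comp (continuous_vline 1).measurable).aestronglyMeasurable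
        (fun r => by rw [mul_comm]; exact hle i r)
    have h1 := hasSum_integral_of_summable_integral_norm
      (F := fun (i : Function.support k) r => lap g (vline 1 r) * F i (vline 1 r))
      (fun i => hint i) ?_
    · have h2 : ∫ r, lap g (vline 1 r) * H (vline 1 r) =
          ∫ r, ∑' i : Function.support k, lap g (vline 1 r) * F i (vline 1 r) := by
        congr 1 with r
        rw [tsum_mul_left]
        congr 1
        refine ((hasSum_subtype_iff_of_support_subset ?_).2 (hH r)).tsum_eq.symm
        intro i hi hki
        exact hi (hz i hki r)
      rw [h2]
      exact h1
    · refine Summable.of_nonneg_of_le (fun i => integral_nonneg fun _ => norm_nonneg _)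
        (fun i => ?_) ((hk.subtype _).mul_left
        (∫ r, (1 + ‖vline 1 r‖) ^ n * ‖lap g (vline 1 r)‖))
      rw [← integral_mul_const]
      refine integral_mono (hint i).norm ((integrable_pow_mul_lap hg hc n 1).mul_const _)
        fun r => ?_
      simp only [norm_mul, Function.comp]
      calc _ ≤ ‖lap g (vline 1 r)‖ * ((1 + ‖vline 1 r‖) ^ n * k i) := by gcongr; exact hle i r
        _ = _ := by ring
  refine (hasSum_subtype_iff_of_support_subset ?_).1 hsub
  intro i hi hki
  refine hi ?_
  change lineInt g (F i) = 0
  rw [lineInt_congr (h₂ := fun _ => 0) (hz i hki)]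
  simp [lineInt]

/-- The zero side of the explicit formula: termwise integration of the partial fractions of ξ'/ξ. -/
theorem hasSum_order_mul_lap {g : ℝ → ℂ} (hg : ContDiff ℝ ∞ g) (hc : HasCompactSupport g)
    (he : ∀ x, g (-x) = g x) :
    HasSum (fun ρ : ℂ => (analyticOrderNatAt xi ρ : ℂ) * lap g ρ)
      (lineInt g fun z => 2 * logDeriv xi z) := by
  have h1 := hasSum_lineInt (ι := ℂ) hg hc
    (F := fun ρ z => (analyticOrderNatAt xi ρ : ℂ) * (1 / (z - ρ) + 1 / (z + ρ)))
    (fun ρ => by fun_prop) (summable_order_xi.mul_left 18) (n := 3) ?_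
    (H := fun z => 2 * logDeriv xi z)
    (fun r => hasSum_logDeriv_xi (xi_ne_zero_of_half_le_re (by simp; norm_num)))
  · convert h1 using 1
    funext ρ
    rw [lineInt_const_mul]
    by_cases h0 : analyticOrderNatAt xi ρ = 0
    · simp [h0]
    have hρ := abs_re_lt_of_order_ne_zero h0
    rw [abs_lt] at hρ
    have i1 := integrable_lap_mul_one_div hg hc (ρ := ρ) (by linarith)
    have i2 := integrable_lap_mul_one_div hg hc (ρ := -ρ) (by simp; linarith)
    have l2 := lineInt_one_div_sub hg hc (ρ := -ρ) (by simp; linarith)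
    simp only [sub_neg_eq_add] at i2 l2
    rw [lineInt_add (h₁ := fun z => 1 / (z - ρ)) (h₂ := fun z => 1 / (z + ρ)) i1 i2,
      lineInt_one_div_sub hg hc (by linarith), l2,
      integral_Ioi_add_eq_lap hg.continuous hc he]
  · intro ρ r
    rw [norm_mul, Complex.norm_natCast]
    by_cases h0 : analyticOrderNatAt xi ρ = 0
    · simp [h0]
    have := norm_one_div_add_le (z := vline 1 r) (by simp) (abs_re_lt_of_order_ne_zero h0)
    calc _ ≤ (analyticOrderNatAt xi ρ : ℝ) * (18 * (1 + ‖vline 1 r‖) ^ 3 * (1 / (1 + ‖ρ‖) ^ 2)) := by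
          gcongr
      _ = _ := by ring

/-- The constant of the archimedean term of the explicit formula. -/
def archConst : ℂ := -(Real.log Real.pi) / 2 + Complex.digamma (1 / 4) / 2

theorem logDeriv_Gammaℝ {s : ℂ} (hs : 0 < s.re) :
    DifferentiableAt ℂ Complex.Gammaℝ s ∧
    logDeriv Complex.Gammaℝ s = -(Real.log Real.pi) / 2 + Complex.digamma (s / 2) / 2 := by
  have hpi : (Real.pi : ℂ) ≠ 0 := by exact_mod_cast Real.pi_ne_zero
  have hs2 : 0 < (s / 2).re := by simp; linarith
  have hd1 : HasDerivAt (fun s : ℂ => (Real.pi : ℂ) ^ (-s / 2))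
      ((Real.pi : ℂ) ^ (-s / 2) * Complex.log Real.pi * (-1 / 2)) s :=
    ((hasDerivAt_id s).neg.div_const 2).const_cpow (Or.inl hpi)
  have hd2 : HasDerivAt (fun s : ℂ => Complex.Gamma (s / 2)) (deriv Complex.Gamma (s / 2) * (1 / 2)) s :=
    (Complex.differentiableAt_Gamma _ (ne_neg_nat_of_re_pos hs2)).hasDerivAt.comp s
      ((hasDerivAt_id s).div_const 2)
  have hd : HasDerivAt Complex.Gammaℝ _ s := hd1.mul hd2
  refine ⟨hd.differentiableAt, ?_⟩
  have hG := Complex.Gamma_ne_zero (ne_neg_nat_of_re_pos hs2)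
  have hp : (Real.pi : ℂ) ^ (-s / 2) ≠ 0 := by simp [Complex.cpow_eq_zero_iff, hpi]
  rw [logDeriv_apply, hd.deriv, Complex.Gammaℝ_def, Complex.digamma_def, logDeriv_apply,
    Complex.ofReal_log Real.pi_pos.le]
  field_simp

/-- The arithmetic side: logarithmic differentiation of s(s - 1)π^(-s/2)Γ(s/2)ζ(s) where the
Dirichlet series of ζ'/ζ converges, with Gauss's integral for the digamma term. -/
theorem logDeriv_xi_eq {z : ℂ} (hz : 1 / 2 < z.re) :
    logDeriv xi z = 1 / (z - -(1 / 2)) + 1 / (z - 1 / 2) +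
      (archConst + ∫ y in Set.Ioi (0 : ℝ), (kappa y : ℂ) * (1 - Complex.exp (-(y * z)))) -
      LSeries (fun n => (ArithmeticFunction.vonMangoldt n : ℂ)) (1 / 2 + z) := by
  have hs : 1 < (1 / 2 + z : ℂ).re := by simp; linarith
  rw [ArithmeticFunction.LSeries_vonMangoldt_eq_deriv_riemannZeta_div hs]
  have e1 : (1 / 2 + z : ℂ) ≠ 0 := by intro h; rw [h] at hs; simp at hs; linarith
  have e2 : (z - 1 / 2 : ℂ) ≠ 0 := by
    intro h
    have := congrArg Complex.re h
    simp at this; linarith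
  obtain ⟨hGd, hGl⟩ := logDeriv_Gammaℝ (s := 1 / 2 + z) (by linarith)
  have hG := Complex.Gammaℝ_ne_zero_of_re_pos (s := 1 / 2 + z) (by linarith)
  have hZ := riemannZeta_ne_zero_of_one_le_re hs.le
  have hZd : DifferentiableAt ℂ riemannZeta (1 / 2 + z) := differentiableAt_riemannZeta (by
    intro h; rw [h] at hs; simp at hs)
  have hev : xi =ᶠ[𝓝 z] fun w => ((1 / 2 + w) * (w - 1 / 2) * Complex.Gammaℝ (1 / 2 + w)) *
      riemannZeta (1 / 2 + w) := by
    have : ∀ᶠ w : ℂ in 𝓝 z, 1 / 2 < w.re := Complex.continuous_re.continuousAt.eventually (lt_mem_nhds hz)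
    filter_upwards [this] with w hw
    exact xi_eq_mul_riemannZeta (by rintro rfl; simp at hw) (by linarith)
  have hc1 : DifferentiableAt ℂ (fun w : ℂ => Complex.Gammaℝ (1 / 2 + w)) z :=
    hGd.comp (f := fun w : ℂ => 1 / 2 + w) z (by fun_prop)
  have hc2 : DifferentiableAt ℂ (fun w : ℂ => riemannZeta (1 / 2 + w)) z :=
    hZd.comp (f := fun w : ℂ => 1 / 2 + w) z (by fun_prop)
  have hlog : logDeriv xi z = logDeriv (fun w => ((1 / 2 + w) * (w - 1 / 2) *
      Complex.Gammaℝ (1 / 2 + w)) * riemannZeta (1 / 2 + w)) z := by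
    rw [logDeriv_apply, logDeriv_apply, hev.deriv_eq, hev.self_of_nhds]
  rw [hlog, logDeriv_mul (f := fun w : ℂ => (1 / 2 + w) * (w - 1 / 2) * Complex.Gammaℝ (1 / 2 + w))
      (g := fun w => riemannZeta (1 / 2 + w)) z (mul_ne_zero (mul_ne_zero e1 e2) hG) hZ
      (by fun_prop) hc2,
    logDeriv_mul (f := fun w : ℂ => (1 / 2 + w) * (w - 1 / 2))
      (g := fun w => Complex.Gammaℝ (1 / 2 + w)) z (mul_ne_zero e1 e2) hG (by fun_prop) hc1,
    logDeriv_mul (f := fun w : ℂ => 1 / 2 + w) (g := fun w => w - 1 / 2) z e1 e2 (by fun_prop)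
      (by fun_prop)]
  have l1 : logDeriv (fun w : ℂ => 1 / 2 + w) z = 1 / (z - -(1 / 2)) := by
    rw [logDeriv_apply, deriv_const_add, deriv_id'']
    congr 1; ring
  have l2 : logDeriv (fun w : ℂ => w - 1 / 2) z = 1 / (z - 1 / 2) := by
    rw [logDeriv_apply, deriv_sub_const, deriv_id'']
  have l3 : logDeriv (fun w : ℂ => Complex.Gammaℝ (1 / 2 + w)) z =
      logDeriv Complex.Gammaℝ (1 / 2 + z) := by
    rw [logDeriv_apply, logDeriv_apply, deriv_comp_const_add]
  have l4 : logDeriv (fun w : ℂ => riemannZeta (1 / 2 + w)) z =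
      deriv riemannZeta (1 / 2 + z) / riemannZeta (1 / 2 + z) := by
    rw [logDeriv_apply, deriv_comp_const_add]
  have l5 := digamma_sub_eq_integral (z := z) (by linarith)
  rw [l1, l2, l3, l4, hGl, archConst, show ((1 / 2 + z) / 2 : ℂ) = 1 / 4 + z / 2 by ring]
  linear_combination l5 / 2

end ZetaStatistics
end

/-! ### The explicit formula. -/

noncomputable section
namespace ZetaStatistics

open ArithmeticFunction (vonMangoldt)

/-- The archimedean term of the explicit formula for an even test function. -/
def archTerm (g : ℝ → ℂ) : ℂ :=
  archConst * g 0 + ∫ y in Set.Ioi (0 : ℝ), (kappa y : ℂ) * (g 0 - g y)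

theorem norm_kappa_integral_le {z : ℂ} (hz : 0 ≤ z.re) :
    ‖∫ y in Set.Ioi (0 : ℝ), (kappa y : ℂ) * (1 - Complex.exp (-(y * z)))‖ ≤
      ‖z‖ * ∫ y in Set.Ioi (0 : ℝ), y * kappa y := by
  rw [← integral_const_mul]
  refine norm_integral_le_of_norm_le (integrableOn_mul_kappa.const_mul _) ?_
  filter_upwards [ae_restrict_mem measurableSet_Ioi] with y hy
  exact norm_kappa_mul_le hy hz

theorem measurable_kappa_uncurry : Measurable (Function.uncurry fun (y : ℝ) (z : ℂ) =>
    (kappa y : ℂ) * (1 - Complex.exp (-(y * z)))) := by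
  have := measurable_kappa
  unfold Function.uncurry
  fun_prop

theorem integrable_lap_mul_const {g : ℝ → ℂ} (hg : ContDiff ℝ ∞ g) (hc : HasCompactSupport g)
    (k : ℂ) : Integrable fun r : ℝ => lap g (vline 1 r) * k :=
  (integrable_lap hg hc 1).mul_const k

theorem integrable_lap_mul_kappa_integral {g : ℝ → ℂ} (hg : ContDiff ℝ ∞ g)
    (hc : HasCompactSupport g) :
    Integrable fun r : ℝ => lap g (vline 1 r) *
      ∫ y in Set.Ioi (0 : ℝ), (kappa y : ℂ) * (1 - Complex.exp (-(y * vline 1 r))) := by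
  refine integrable_lap_mul hg hc
    (h := fun z => ∫ y in Set.Ioi (0 : ℝ), (kappa y : ℂ) * (1 - Complex.exp (-(y * z)))) (n := 1)
    (K := ∫ y in Set.Ioi (0 : ℝ), y * kappa y) ?_ ?_
  · have h1 : Measurable fun p : ℝ × ℝ => (kappa p.2 : ℂ) * (1 - Complex.exp (-(p.2 * vline 1 p.1))) :=
      measurable_kappa_uncurry.comp (measurable_snd.prodMk
        ((continuous_vline 1).measurable.comp measurable_fst))
    exact (h1.stronglyMeasurable.integral_prod_right
      (ν := volume.restrict (Set.Ioi (0 : ℝ)))).aestronglyMeasurable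
  · intro r
    refine (norm_kappa_integral_le (by simp)).trans ?_
    have h0 : 0 ≤ ∫ y in Set.Ioi (0 : ℝ), y * kappa y :=
      setIntegral_nonneg measurableSet_Ioi fun y hy => mul_nonneg (le_of_lt hy) (kappa_nonneg hy)
    rw [pow_one, mul_comm]
    gcongr
    linarith

theorem lineInt_kappa_integral {g : ℝ → ℂ} (hg : ContDiff ℝ ∞ g) (hc : HasCompactSupport g) :
    lineInt g (fun z => ∫ y in Set.Ioi (0 : ℝ), (kappa y : ℂ) * (1 - Complex.exp (-(y * z)))) =
      ∫ y in Set.Ioi (0 : ℝ), (kappa y : ℂ) * (g 0 - g y) := by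
  rw [lineInt_integral hg hc measurable_kappa_uncurry integrableOn_mul_kappa (n := 1)]
  · refine setIntegral_congr_fun measurableSet_Ioi fun y hy => ?_
    rw [lineInt_const_mul]
    congr 1
    have h1 : lineInt g (fun z => 1 + -1 * Complex.exp (-(y * z))) = g 0 + -1 * g y := by
      rw [lineInt_add (h₁ := fun _ => 1) (h₂ := fun z => -1 * Complex.exp (-(y * z))), lineInt_one hg hc,
        lineInt_const_mul, lineInt_exp hg hc]
      · exact integrable_lap_mul_const hg hc 1
      · refine integrable_lap_mul hg hc (h := fun z => -1 * Complex.exp (-(y * z))) (K := 1) (n := 0) ?_ ?_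
        · have := (continuous_vline 1).measurable
          exact Measurable.aestronglyMeasurable (by fun_prop)
        · intro r
          have hy0 : (0 : ℝ) < y := hy
          rw [norm_mul, Complex.norm_exp]
          simp [hy0.le]
    rw [show g 0 - g y = g 0 + -1 * g y by ring, ← h1]
    congr 1
    funext z
    ring
  · intro y hy r
    refine (norm_kappa_mul_le hy (by simp)).trans ?_
    rw [pow_one]
    have := mul_nonneg hy.le (kappa_nonneg hy)
    gcongr
    linarith

theorem term_vonMangoldt {n : ℕ} (hn : n ≠ 0) (z : ℂ) :
    LSeries.term (fun n => (vonMangoldt n : ℂ)) (1 / 2 + z) n =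
      ((vonMangoldt n / Real.sqrt n : ℝ) : ℂ) * Complex.exp (-((Real.log n : ℝ) * z)) := by
  have hn0 : (n : ℂ) ≠ 0 := by exact_mod_cast hn
  have hs : (Real.sqrt n : ℂ) = (n : ℂ) ^ (1 / 2 : ℂ) := by
    rw [Real.sqrt_eq_rpow, Complex.ofReal_cpow (by positivity)]
    norm_num
  rw [LSeries.term_of_ne_zero hn, Complex.cpow_add _ _ hn0, Complex.exp_neg,
    Complex.ofReal_div, hs, Complex.cpow_def_of_ne_zero hn0 z, Complex.ofReal_log (by positivity)]
  simp only [Complex.ofReal_natCast]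
  field_simp

theorem hasSum_lineInt_LSeries {g : ℝ → ℂ} (hg : ContDiff ℝ ∞ g) (hc : HasCompactSupport g) :
    HasSum (fun n : ℕ => ((vonMangoldt n / Real.sqrt n : ℝ) : ℂ) * g (Real.log n))
      (lineInt g fun z => LSeries (fun n => (vonMangoldt n : ℂ)) (1 / 2 + z)) := by
  have hsum : ∀ s : ℂ, 1 < s.re → LSeriesSummable (fun n => (vonMangoldt n : ℂ)) s := fun s hs =>
    ArithmeticFunction.LSeriesSummable_vonMangoldt hs
  have h1 := hasSum_lineInt (ι := ℕ) hg hc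
    (F := fun n z => LSeries.term (fun n => (vonMangoldt n : ℂ)) (1 / 2 + z) n)
    (k := fun n => ‖LSeries.term (fun n => (vonMangoldt n : ℂ)) (3 / 2) n‖) (n := 0)
    (H := fun z => LSeries (fun n => (vonMangoldt n : ℂ)) (1 / 2 + z)) ?_
    (hsum _ (by norm_num)).norm ?_
    (fun r => (hsum (1 / 2 + vline 1 r) (by simp)).LSeriesHasSum)
  · convert h1 using 1
    funext n
    rcases eq_or_ne n 0 with rfl | hn
    · rw [lineInt_congr (h₂ := fun _ => 0) (fun r => LSeries.term_zero _ _)]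
      simp [lineInt]
    · simp_rw [term_vonMangoldt hn]
      rw [lineInt_const_mul, lineInt_exp hg hc]
  · intro n
    rcases eq_or_ne n 0 with rfl | hn
    · simp [LSeries.term_zero]
    · simp_rw [term_vonMangoldt hn]
      fun_prop
  · intro n r
    rw [LSeries.norm_term_eq, LSeries.norm_term_eq, pow_zero, one_mul]
    refine le_of_eq ?_
    congr 3
    simp
    norm_num

theorem integrable_lap_mul_LSeries {g : ℝ → ℂ} (hg : ContDiff ℝ ∞ g) (hc : HasCompactSupport g) :
    Integrable fun r : ℝ => lap g (vline 1 r) *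
      LSeries (fun n => (vonMangoldt n : ℂ)) (1 / 2 + vline 1 r) := by
  have hsum : ∀ s : ℂ, 1 < s.re → LSeriesSummable (fun n => (vonMangoldt n : ℂ)) s := fun s hs =>
    ArithmeticFunction.LSeriesSummable_vonMangoldt hs
  refine integrable_lap_mul hg hc (h := fun z => LSeries (fun n => (vonMangoldt n : ℂ)) (1 / 2 + z))
    (n := 0) (K := ∑' n, ‖LSeries.term (fun n => (vonMangoldt n : ℂ)) (3 / 2) n‖) ?_ ?_
  · refine Continuous.aestronglyMeasurable (continuous_iff_continuousAt.2 fun r => ?_)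
    -- Any abscissa strictly between 1 and 3/2, the real part on the line, would serve.
    have habs := (hsum (5 / 4) (by norm_num)).abscissaOfAbsConv_le
    have h2 : LSeries.abscissaOfAbsConv (fun n => (vonMangoldt n : ℂ)) <
        (1 / 2 + vline 1 r : ℂ).re := by
      refine habs.trans_lt ?_
      simp only [Complex.add_re, vline_re]
      exact_mod_cast (by norm_num : (5 / 4 : ℂ).re < (1 / 2 : ℂ).re + 1)
    have h3 : ContinuousAt (LSeries fun n => (vonMangoldt n : ℂ)) (1 / 2 + vline 1 r) :=
      (LSeries_hasDerivAt h2).continuousAt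
    have h4 : ContinuousAt (fun r => 1 / 2 + vline 1 r) r := by
      have := continuous_vline 1
      exact Continuous.continuousAt (by fun_prop)
    exact ContinuousAt.comp (f := fun r => 1 / 2 + vline 1 r) h3 h4
  · intro r
    rw [pow_zero, mul_one]
    refine tsum_of_norm_bounded (hsum (3 / 2) (by norm_num)).norm.hasSum fun n => ?_
    rw [LSeries.norm_term_eq, LSeries.norm_term_eq]
    refine le_of_eq ?_
    congr 3
    simp
    norm_num

/-- The fractions at z = 1/2 and z = -1/2 come from the factors of s(s - 1). For even g they merge
into one full transform. -/
theorem lineInt_two_mul_logDeriv_xi {g : ℝ → ℂ} (hg : ContDiff ℝ ∞ g) (hc : HasCompactSupport g)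
    (he : ∀ x, g (-x) = g x) :
    lineInt g (fun z => 2 * logDeriv xi z) = 2 * (lap g (1 / 2) + archTerm g -
      ∑' n : ℕ, ((vonMangoldt n / Real.sqrt n : ℝ) : ℂ) * g (Real.log n)) := by
  rw [lineInt_const_mul, (hasSum_lineInt_LSeries hg hc).tsum_eq]
  congr 1
  set K : ℂ → ℂ := fun z => ∫ y in Set.Ioi (0 : ℝ), (kappa y : ℂ) * (1 - Complex.exp (-(y * z)))
  set Q : ℂ → ℂ := fun z => LSeries (fun n => (vonMangoldt n : ℂ)) (1 / 2 + z)
  have i1 := integrable_lap_mul_one_div hg hc (ρ := -(1 / 2)) (by norm_num)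
  have i2 := integrable_lap_mul_one_div hg hc (ρ := 1 / 2) (by norm_num)
  have i3 := integrable_lap_mul_const hg hc archConst
  have i4 := integrable_lap_mul_kappa_integral hg hc
  have i5 := integrable_lap_mul_LSeries hg hc
  have e1 : lineInt g (logDeriv xi) = lineInt g fun z => (1 / (z - -(1 / 2)) + 1 / (z - 1 / 2)) +
      ((archConst * 1 + K z) + (-1) * Q z) := by
    refine lineInt_congr fun r => ?_
    rw [logDeriv_xi_eq (by simp; norm_num)]
    simp only [K, Q]
    ring
  have j12 : Integrable fun r : ℝ => lap g (vline 1 r) *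
      (1 / (vline 1 r - -(1 / 2)) + 1 / (vline 1 r - 1 / 2)) := by
    refine (i1.add i2).congr (Eventually.of_forall fun r => ?_)
    simp only [Pi.add_apply]; ring
  have j3 : Integrable fun r : ℝ => lap g (vline 1 r) * (archConst * 1) := by simpa using i3
  have j34 : Integrable fun r : ℝ => lap g (vline 1 r) * (archConst * 1 + K (vline 1 r)) := by
    refine (i3.add i4).congr (Eventually.of_forall fun r => ?_)
    simp only [Pi.add_apply, K]; ring
  have j5 : Integrable fun r : ℝ => lap g (vline 1 r) * (-1 * Q (vline 1 r)) := by
    refine i5.neg.congr (Eventually.of_forall fun r => ?_)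
    simp only [Pi.neg_apply, Q]; ring
  have j345 : Integrable fun r : ℝ => lap g (vline 1 r) *
      ((archConst * 1 + K (vline 1 r)) + -1 * Q (vline 1 r)) := by
    refine (j34.add j5).congr (Eventually.of_forall fun r => ?_)
    simp only [Pi.add_apply]; ring
  rw [e1, lineInt_add (h₁ := fun z => 1 / (z - -(1 / 2)) + 1 / (z - 1 / 2))
      (h₂ := fun z => (archConst * 1 + K z) + (-1) * Q z) j12 j345,
    lineInt_add (h₁ := fun z => 1 / (z - -(1 / 2))) (h₂ := fun z => 1 / (z - 1 / 2)) i1 i2,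
    lineInt_add (h₁ := fun z => archConst * 1 + K z) (h₂ := fun z => (-1) * Q z) j34 j5,
    lineInt_add (h₁ := fun _ => archConst * 1) (h₂ := K) j3 i4, lineInt_const_mul, lineInt_const_mul,
    lineInt_one hg hc, lineInt_one_div_sub hg hc (by norm_num), lineInt_one_div_sub hg hc (by norm_num),
    lineInt_kappa_integral hg hc, ← integral_Ioi_add_eq_lap hg.continuous hc he (1 / 2), archTerm]
  ring

theorem analyticOrderNatAt_xi_neg (ρ : ℂ) :
    analyticOrderNatAt xi (-ρ) = analyticOrderNatAt xi ρ := by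
  have := analyticOrderAt_comp_of_deriv_ne_zero (f := xi) (g := fun w : ℂ => -w)
    (z₀ := ρ) (by fun_prop) (by rw [(hasDerivAt_neg ρ).deriv]; norm_num)
  have h2 : xi ∘ (fun w : ℂ => -w) = xi := funext xi_neg
  rw [h2] at this
  simp only [analyticOrderNatAt, this]

theorem summable_order_mul_lap {g : ℝ → ℂ} (hg : ContDiff ℝ ∞ g) (hc : HasCompactSupport g) :
    Summable fun ρ : ℂ => (analyticOrderNatAt xi ρ : ℂ) * lap g ρ := by
  obtain ⟨b, hb0, hb⟩ := exists_support_bound hc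
  obtain ⟨C, hC, h⟩ := exists_pow_mul_norm_lap_le hg hc hb 2
  refine Summable.of_norm_bounded (summable_order_xi.mul_left (C * Real.exp (b * (1 / 2)))) fun ρ => ?_
  rw [norm_mul, Complex.norm_natCast]
  by_cases h0 : analyticOrderNatAt xi ρ = 0
  · simp [h0]
  have h1 : ‖lap g ρ‖ ≤ C * Real.exp (b * (1 / 2)) / (1 + ‖ρ‖) ^ 2 := by
    rw [le_div_iff₀ (by positivity), mul_comm]
    refine (h ρ).trans ?_
    have := (abs_re_lt_of_order_ne_zero h0).le
    gcongr
  calc _ ≤ (analyticOrderNatAt xi ρ : ℝ) * (C * Real.exp (b * (1 / 2)) / (1 + ‖ρ‖) ^ 2) := by gcongr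
    _ = _ := by ring

theorem lap_symm {g : ℝ → ℂ} (hg : Continuous g) (hc : HasCompactSupport g) (z : ℂ) :
    lap (fun x => g x + g (-x)) z = lap g z + lap g (-z) := by
  have h1 : lap g (-z) = ∫ x : ℝ, g (-x) * Complex.exp (x * z) := by
    rw [lap, ← integral_neg_eq_self]
    congr 1 with x
    push_cast
    ring_nf
  have i2 : Integrable fun x : ℝ => g (-x) * Complex.exp (x * z) := by
    refine (integrable_mul_exp hg hc (-z)).comp_neg.congr (Eventually.of_forall fun x => ?_)
    simp
  rw [h1, lap, lap, ← integral_add (integrable_mul_exp hg hc z) i2]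
  congr 1 with x
  ring

/-- The **explicit formula** for the zeros of `ξ(1/2 + z)`. -/
theorem explicit_formula {g : ℝ → ℂ} (hg : ContDiff ℝ ∞ g) (hc : HasCompactSupport g) :
    HasSum (fun ρ : ℂ => (analyticOrderNatAt xi ρ : ℂ) * lap g ρ)
      (lap g (1 / 2) + lap g (-(1 / 2)) + archTerm (fun x => g x + g (-x)) -
        ∑' n : ℕ, ((vonMangoldt n / Real.sqrt n : ℝ) : ℂ) *
          (g (Real.log n) + g (-Real.log n))) := by
  have hG : ContDiff ℝ ∞ fun x => g x + g (-x) := hg.add (hg.comp contDiff_neg)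
  have hGc : HasCompactSupport fun x => g x + g (-x) :=
    hc.add (hc.comp_homeomorph (Homeomorph.neg ℝ))
  have h1 := hasSum_order_mul_lap hG hGc (fun x => by simp only [neg_neg]; ring)
  rw [lineInt_two_mul_logDeriv_xi hG hGc (fun x => by simp only [neg_neg]; ring)] at h1
  have hs := summable_order_mul_lap hg hc
  have h2 := hs.hasSum
  -- The multiplicities are invariant under ρ ↦ -ρ, so the sum for the even function g(x) + g(-x) is
  -- twice the sum for g; this removes the evenness assumption.
  have h3 := (Equiv.neg ℂ).hasSum_iff.2 h2
  have h4 : HasSum (fun ρ : ℂ => (analyticOrderNatAt xi ρ : ℂ) * lap (fun x => g x + g (-x)) ρ)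
      ((∑' ρ : ℂ, (analyticOrderNatAt xi ρ : ℂ) * lap g ρ) +
        ∑' ρ : ℂ, (analyticOrderNatAt xi ρ : ℂ) * lap g ρ) := by
    convert h2.add h3 using 1
    funext ρ
    simp only [Function.comp, Equiv.neg_apply, analyticOrderNatAt_xi_neg,
      lap_symm hg.continuous hc]
    ring
  have h5 := h4.unique h1
  rw [lap_symm hg.continuous hc] at h5
  convert h2 using 1
  linear_combination -h5 / 2

end ZetaStatistics
end

/-! ### Size of the archimedean term. -/

noncomputable section
namespace ZetaStatistics

/-- A nonnegative band-limited function of logarithmic growth. -/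
def logKernel (x : ℝ) : ℝ := ∫ t in Set.Ioo (0 : ℝ) 1, (1 - Real.cos (x * t)) / t

theorem abs_one_sub_cos_le (x : ℝ) : |1 - Real.cos x| ≤ |x| := by
  rw [abs_le]
  have h0 := Real.cos_le_one x
  have hx := abs_nonneg x
  refine ⟨by linarith, ?_⟩
  rcases le_total 2 |x| with h2 | h2
  · linarith [Real.neg_one_le_cos x]
  · have := Real.one_sub_sq_div_two_le_cos (x := x)
    have : x ^ 2 ≤ 2 * |x| := by rw [← sq_abs]; nlinarith
    linarith

theorem one_sub_cos_div_nonneg (x : ℝ) {t : ℝ} (ht : 0 < t) : 0 ≤ (1 - Real.cos (x * t)) / t :=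
  div_nonneg (by linarith [Real.cos_le_one (x * t)]) ht.le

theorem norm_one_sub_cos_div_le (x : ℝ) {t : ℝ} (ht : 0 < t) : ‖(1 - Real.cos (x * t)) / t‖ ≤ |x| := by
  rw [Real.norm_eq_abs, abs_div, abs_of_pos ht, div_le_iff₀ ht]
  have := abs_one_sub_cos_le (x * t)
  rwa [abs_mul, abs_of_pos ht] at this

theorem integrableOn_logKernel (x : ℝ) :
    IntegrableOn (fun t => (1 - Real.cos (x * t)) / t) (Set.Ioo 0 1) := by
  refine Integrable.mono' (integrableOn_const (C := |x|) (by simp)) ?_ ?_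
  · exact Measurable.aestronglyMeasurable (by fun_prop)
  · filter_upwards [ae_restrict_mem measurableSet_Ioo] with t ht
    exact norm_one_sub_cos_div_le x ht.1

theorem logKernel_nonneg (x : ℝ) : 0 ≤ logKernel x :=
  setIntegral_nonneg measurableSet_Ioo fun _ ht => one_sub_cos_div_nonneg x ht.1

theorem logKernel_le_abs (x : ℝ) : logKernel x ≤ |x| := by
  have h := norm_setIntegral_le_of_norm_le_const (s := Set.Ioo (0 : ℝ) 1) (μ := volume)
    (f := fun t => (1 - Real.cos (x * t)) / t) (C := |x|) (by simp)
    (fun t ht => norm_one_sub_cos_div_le x ht.1)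
  have h2 := le_abs_self (logKernel x)
  simp only [Measure.real, Real.volume_Ioo, sub_zero, ENNReal.toReal_ofReal zero_le_one, mul_one,
    Real.norm_eq_abs] at h
  exact h2.trans h

theorem logKernel_abs (x : ℝ) : logKernel |x| = logKernel x := by
  unfold logKernel
  congr 1 with t
  rcases abs_cases x with ⟨h, _⟩ | ⟨h, _⟩ <;> rw [h]
  rw [neg_mul, Real.cos_neg]

theorem abs_integral_cos_div_le {τ : ℝ} (hτ : 1 ≤ τ) : |∫ t in (1 : ℝ)..τ, Real.cos t / t| ≤ 3 := by
  have h1 : ∀ t ∈ Set.uIcc 1 τ, HasDerivAt (fun t : ℝ => t⁻¹) (-(t ^ 2)⁻¹) t := by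
    intro t ht
    rw [Set.uIcc_of_le hτ] at ht
    exact hasDerivAt_inv (by linarith [ht.1])
  have hne : ∀ t ∈ Set.uIcc 1 τ, t ≠ 0 := fun t ht => by
    rw [Set.uIcc_of_le hτ] at ht
    linarith [ht.1]
  have hc2 : IntervalIntegrable (fun t : ℝ => -(t ^ 2)⁻¹) volume 1 τ := by
    refine ContinuousOn.intervalIntegrable ?_
    exact ((continuousOn_pow 2).inv₀ (fun t ht => pow_ne_zero 2 (hne t ht))).neg
  have h2 := intervalIntegral.integral_mul_deriv_eq_deriv_mul (a := 1) (b := τ) (u := fun t : ℝ => t⁻¹)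
    (v := Real.sin) (u' := fun t => -(t ^ 2)⁻¹) (v' := Real.cos) h1
    (fun t _ => Real.hasDerivAt_sin t) hc2 (Real.continuous_cos.intervalIntegrable _ _)
  have h3 : ∫ t in (1 : ℝ)..τ, Real.cos t / t = ∫ t in (1 : ℝ)..τ, t⁻¹ * Real.cos t := by
    congr 1 with t; rw [div_eq_inv_mul]
  have h4 : |∫ t in (1 : ℝ)..τ, -(t ^ 2)⁻¹ * Real.sin t| ≤ ∫ t in (1 : ℝ)..τ, (t ^ 2)⁻¹ := by
    have := intervalIntegral.norm_integral_le_of_norm_le hτ (f := fun t => -(t ^ 2)⁻¹ * Real.sin t)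
      (g := fun t => (t ^ 2)⁻¹) (μ := volume) (Eventually.of_forall fun t _ => by
        rw [norm_mul, norm_neg, Real.norm_eq_abs, Real.norm_eq_abs, abs_of_nonneg (by positivity)]
        exact mul_le_of_le_one_right (by positivity) (Real.abs_sin_le_one t))
      (by have h9 := hc2.neg; simpa only [Pi.neg_apply, neg_neg, Pi.neg_def] using h9)
    simpa using this
  have h5 : ∫ t in (1 : ℝ)..τ, (t ^ 2)⁻¹ = 1 - τ⁻¹ := by
    have h6 := intervalIntegral.integral_eq_sub_of_hasDerivAt (a := 1) (b := τ) h1 hc2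
    rw [intervalIntegral.integral_neg] at h6
    simp only [inv_one] at h6
    linarith
  have hτ0 : 0 < τ⁻¹ := by positivity
  have hτ1 : τ⁻¹ ≤ 1 := inv_le_one_of_one_le₀ hτ
  have h7 : |τ⁻¹ * Real.sin τ| ≤ 1 := by
    rw [abs_mul, abs_of_pos hτ0]
    have := Real.abs_sin_le_one τ
    nlinarith [abs_nonneg (Real.sin τ)]
  have h8 := Real.abs_sin_le_one 1
  rw [h3, h2]
  rw [h5] at h4
  simp only [inv_one, one_mul]
  rw [abs_le] at *
  constructor <;> linarith [h4.1, h4.2, h7.1, h7.2, h8.1, h8.2]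

/-- Rescaling gives the integral of (1 - cos t)/t over (0,τ). On (0,1) it is at most 1; beyond, 1/t
integrates to log τ and the cosine part is bounded by 3. -/
theorem abs_logKernel_sub_log_le {τ : ℝ} (hτ : 1 ≤ τ) : |logKernel τ - Real.log τ| ≤ 4 := by
  have hτ0 : 0 < τ := by linarith
  have e1 : logKernel τ = ∫ t in (0 : ℝ)..τ, (1 - Real.cos t) / t := by
    have h := intervalIntegral.smul_integral_comp_mul_left (a := 0) (b := 1)
      (fun t => (1 - Real.cos t) / t) τ
    rw [mul_zero, mul_one] at h
    rw [← h, logKernel, ← integral_Ioc_eq_integral_Ioo, ← intervalIntegral.integral_of_le zero_le_one,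
      ← intervalIntegral.integral_smul]
    congr 1 with t
    rw [smul_eq_mul]
    field_simp
  have hi : ∀ c d : ℝ, 0 ≤ c → c ≤ d → IntervalIntegrable (fun t => (1 - Real.cos t) / t) volume c d := by
    intro c d hc hcd
    rw [intervalIntegrable_iff_integrableOn_Ioc_of_le hcd]
    refine Integrable.mono' (integrableOn_const (C := (1 : ℝ)) (by simp)) ?_ ?_
    · exact Measurable.aestronglyMeasurable (by fun_prop)
    · filter_upwards [ae_restrict_mem measurableSet_Ioc] with t ht
      have := norm_one_sub_cos_div_le 1 (t := t) (by linarith [ht.1])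
      simpa using this
  have e2 := intervalIntegral.integral_add_adjacent_intervals (hi 0 1 le_rfl zero_le_one)
    (hi 1 τ zero_le_one hτ)
  have e3 : ∫ t in (1 : ℝ)..τ, (1 - Real.cos t) / t =
      Real.log τ - ∫ t in (1 : ℝ)..τ, Real.cos t / t := by
    have hne : ∀ t ∈ Set.uIcc 1 τ, t ≠ 0 := fun t ht => by
      rw [Set.uIcc_of_le hτ] at ht
      linarith [ht.1]
    have h1 : IntervalIntegrable (fun t : ℝ => 1 / t) volume 1 τ :=
      ContinuousOn.intervalIntegrable (continuousOn_const.div continuousOn_id hne)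
    have h2 : IntervalIntegrable (fun t : ℝ => Real.cos t / t) volume 1 τ :=
      ContinuousOn.intervalIntegrable (Real.continuous_cos.continuousOn.div continuousOn_id hne)
    have h3 := integral_one_div_of_pos one_pos hτ0
    rw [div_one] at h3
    rw [← h3, ← intervalIntegral.integral_sub h1 h2]
    congr 1 with t
    ring
  have e4 : |∫ t in (0 : ℝ)..1, (1 - Real.cos t) / t| ≤ 1 := by
    have h := logKernel_le_abs 1
    have h' := logKernel_nonneg 1
    simp only [logKernel, one_mul, abs_one] at h h'
    rw [intervalIntegral.integral_of_le zero_le_one, integral_Ioc_eq_integral_Ioo, abs_of_nonneg h']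
    exact h
  have e5 := abs_integral_cos_div_le hτ
  rw [e1, ← e2, e3]
  rw [abs_le] at *
  constructor <;> linarith [e4.1, e4.2, e5.1, e5.2]

theorem logKernel_le (x : ℝ) : logKernel x ≤ Real.log (1 + |x|) + 4 := by
  rcases le_total 1 |x| with h | h
  · have h1 := (abs_le.1 (abs_logKernel_sub_log_le h)).2
    rw [logKernel_abs] at h1
    have := Real.log_le_log (by linarith) (by linarith : |x| ≤ 1 + |x|)
    linarith
  · have := Real.log_nonneg (by linarith [abs_nonneg x] : 1 ≤ 1 + |x|)
    linarith [logKernel_le_abs x]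

theorem le_logKernel (x : ℝ) : Real.log |x| - 4 ≤ logKernel x := by
  rcases le_total 1 |x| with h | h
  · have h1 := (abs_le.1 (abs_logKernel_sub_log_le h)).1
    rw [logKernel_abs] at h1
    linarith
  · have := Real.log_nonpos (abs_nonneg x) h
    linarith [logKernel_nonneg x]

theorem measurable_logKernel : Measurable logKernel := by
  have h : Measurable fun p : ℝ × ℝ => (1 - Real.cos (p.1 * p.2)) / p.2 := by fun_prop
  exact (h.stronglyMeasurable.integral_prod_right (ν := volume.restrict (Set.Ioo (0 : ℝ) 1))).measurable

/-- The two kernels have the same singularity at 0. This is what allows `kappa` to be exchanged for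
the kernel of `logKernel` on (0,1). -/
theorem abs_two_mul_kappa_sub_le {y : ℝ} (hy : 0 < y) : |2 * kappa y - 1 / y| ≤ 2 := by
  have h1 := one_sub_exp_pos hy
  have e1 : Real.exp (-2 * y) * (1 + 2 * y) ≤ 1 := by
    have := Real.add_one_le_exp (2 * y)
    calc Real.exp (-2 * y) * (1 + 2 * y) ≤ Real.exp (-2 * y) * Real.exp (2 * y) := by
          gcongr; linarith
      _ = 1 := by rw [← Real.exp_add]; simp
  have e2 : 1 - 2 * y ≤ Real.exp (-2 * y) := by linarith [Real.add_one_le_exp (-2 * y)]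
  have e3 : 1 - y / 2 ≤ Real.exp (-y / 2) := by linarith [Real.add_one_le_exp (-y / 2)]
  have e4 : Real.exp (-y / 2) ≤ 1 := Real.exp_le_one_iff.2 (by linarith)
  have e5 : 2 * kappa y - 1 / y =
      (2 * y * Real.exp (-y / 2) - (1 - Real.exp (-2 * y))) / (y * (1 - Real.exp (-2 * y))) := by
    unfold kappa
    have hy' : y ≠ 0 := hy.ne'
    generalize 1 - Real.exp (-2 * y) = D at h1
    have hD : D ≠ 0 := h1.ne'
    field_simp
  rw [e5, abs_div, abs_of_pos (mul_pos hy h1), div_le_iff₀ (mul_pos hy h1), abs_le]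
  have p0 := Real.exp_pos (-y / 2)
  set D := Real.exp (-2 * y)
  set E := Real.exp (-y / 2)
  have e6 : 2 * y ≤ (1 - D) * (1 + 2 * y) := by linarith
  constructor
  · nlinarith
  · nlinarith

theorem integrableOn_kappa_Ici : IntegrableOn kappa (Set.Ici 1) := by
  refine Integrable.mono' (integrableOn_mul_kappa.mono_set
    (fun y hy => Set.mem_Ioi.2 (lt_of_lt_of_le zero_lt_one (Set.mem_Ici.1 hy)))) measurable_kappa.aestronglyMeasurable ?_
  filter_upwards [ae_restrict_mem measurableSet_Ici] with y hy
  have hy1 : (1 : ℝ) ≤ y := hy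
  have := kappa_nonneg (by linarith : 0 < y)
  rw [Real.norm_of_nonneg this]
  nlinarith

theorem norm_kappa_mul_one_sub_cos_le {y : ℝ} (hy : 0 < y) (τ : ℝ) :
    ‖kappa y * (1 - Real.cos (τ * y))‖ ≤ |τ| * (y * kappa y) := by
  rw [norm_mul, Real.norm_of_nonneg (kappa_nonneg hy), Real.norm_eq_abs]
  have := abs_one_sub_cos_le (τ * y)
  rw [abs_mul, abs_of_pos hy] at this
  have := mul_le_mul_of_nonneg_left this (kappa_nonneg hy)
  linarith

theorem integrableOn_kappa_mul_one_sub_cos (τ : ℝ) :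
    IntegrableOn (fun y => kappa y * (1 - Real.cos (τ * y))) (Set.Ioi 0) := by
  refine Integrable.mono' (integrableOn_mul_kappa.const_mul |τ|) ?_ ?_
  · have := measurable_kappa
    exact Measurable.aestronglyMeasurable (by fun_prop)
  · filter_upwards [ae_restrict_mem measurableSet_Ioi] with y hy
    exact norm_kappa_mul_one_sub_cos_le hy τ

/-- The part y ≥ 1 is bounded because `kappa` is integrable there. Dropping it leaves only
frequencies below 1 in τ, so the archimedean term is compared with a band-limited function rather
than with log |τ|, which is what the moment computation needs. -/
theorem exists_abs_kappa_integral_sub_logKernel_le :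
    ∃ C : ℝ, 0 ≤ C ∧ ∀ τ : ℝ,
      |2 * (∫ y in Set.Ioi (0 : ℝ), kappa y * (1 - Real.cos (τ * y))) - logKernel τ| ≤ C := by
  refine ⟨4 + 4 * ∫ y in Set.Ici (1 : ℝ), kappa y, ?_, fun τ => ?_⟩
  · have : 0 ≤ ∫ y in Set.Ici (1 : ℝ), kappa y :=
      setIntegral_nonneg measurableSet_Ici fun y hy => kappa_nonneg (lt_of_lt_of_le zero_lt_one hy)
    linarith
  have hsplit : Set.Ioi (0 : ℝ) = Set.Ioo 0 1 ∪ Set.Ici 1 := (Set.Ioo_union_Ici_eq_Ioi zero_lt_one).symm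
  have hI := integrableOn_kappa_mul_one_sub_cos τ
  have hdisj : Disjoint (Set.Ioo (0 : ℝ) 1) (Set.Ici 1) :=
    Set.disjoint_left.2 fun y h1 h2 => absurd h1.2 (not_lt.2 h2)
  have h1 : ∫ y in Set.Ioi (0 : ℝ), kappa y * (1 - Real.cos (τ * y)) =
      (∫ y in Set.Ioo (0 : ℝ) 1, kappa y * (1 - Real.cos (τ * y))) +
        ∫ y in Set.Ici (1 : ℝ), kappa y * (1 - Real.cos (τ * y)) := by
    rw [hsplit]
    exact setIntegral_union hdisj measurableSet_Ici (hI.mono_set (by rw [hsplit]; exact Set.subset_union_left))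
      (hI.mono_set (by rw [hsplit]; exact Set.subset_union_right))
  have hI1 : IntegrableOn (fun y => kappa y * (1 - Real.cos (τ * y))) (Set.Ioo 0 1) :=
    hI.mono_set (by rw [hsplit]; exact Set.subset_union_left)
  have h2 : |2 * (∫ y in Set.Ioo (0 : ℝ) 1, kappa y * (1 - Real.cos (τ * y))) - logKernel τ| ≤ 4 := by
    rw [logKernel, ← integral_const_mul, ← integral_sub (hI1.const_mul 2) (integrableOn_logKernel τ)]
    have := norm_setIntegral_le_of_norm_le_const (s := Set.Ioo (0 : ℝ) 1) (μ := volume)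
      (f := fun y => 2 * (kappa y * (1 - Real.cos (τ * y))) - (1 - Real.cos (τ * y)) / y) (C := 4)
      (by simp) (fun y hy => by
        have e1 : 2 * (kappa y * (1 - Real.cos (τ * y))) - (1 - Real.cos (τ * y)) / y =
          (2 * kappa y - 1 / y) * (1 - Real.cos (τ * y)) := by ring
        have e2 := abs_two_mul_kappa_sub_le hy.1
        have e3 : |1 - Real.cos (τ * y)| ≤ 2 := by
          rw [abs_le]
          constructor <;> linarith [Real.cos_le_one (τ * y), Real.neg_one_le_cos (τ * y)]
        rw [e1, norm_mul, Real.norm_eq_abs, Real.norm_eq_abs]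
        nlinarith [abs_nonneg (2 * kappa y - 1 / y), abs_nonneg (1 - Real.cos (τ * y))])
    simpa [Measure.real] using this
  have h3 : |∫ y in Set.Ici (1 : ℝ), kappa y * (1 - Real.cos (τ * y))| ≤
      2 * ∫ y in Set.Ici (1 : ℝ), kappa y := by
    rw [← integral_const_mul, ← Real.norm_eq_abs]
    refine norm_integral_le_of_norm_le (integrableOn_kappa_Ici.const_mul 2) ?_
    filter_upwards [ae_restrict_mem measurableSet_Ici] with y hy
    have hk := kappa_nonneg (lt_of_lt_of_le zero_lt_one hy : (0 : ℝ) < y)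
    have e3 : |1 - Real.cos (τ * y)| ≤ 2 := by
      rw [abs_le]
      constructor <;> linarith [Real.cos_le_one (τ * y), Real.neg_one_le_cos (τ * y)]
    rw [norm_mul, Real.norm_of_nonneg hk, Real.norm_eq_abs, mul_comm]
    gcongr
  rw [h1]
  rw [abs_le] at *
  constructor <;> linarith [h2.1, h2.2, h3.1, h3.2]

/-- The even test function attached to `φ` at the scale `L`, modulated to frequency `τ`. -/
def modulated (φ : ℝ → ℝ) (L τ y : ℝ) : ℝ := 2 / L * (φ (y / L) * Real.cos (τ * y))

theorem exists_abs_sub_le_of_contDiff {φ : ℝ → ℝ} (hφ : ContDiff ℝ ∞ φ) (hc : HasCompactSupport φ) :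
    ∃ K : ℝ, 0 ≤ K ∧ ∀ u, |φ 0 - φ u| ≤ K * |u| := by
  obtain ⟨K, hK⟩ := (hφ.of_le (by exact_mod_cast le_top : (1 : WithTop ℕ∞) ≤ ∞)).lipschitzWith_of_hasCompactSupport hc
    (by norm_num)
  refine ⟨K, K.2, fun u => ?_⟩
  have := hK.dist_le_mul 0 u
  rwa [Real.dist_eq, Real.dist_eq, zero_sub, abs_neg] at this

/-- Split φ(0) - φ(y/L)cos(τy) as (φ(0) - φ(y/L))cos(τy) + φ(0)(1 - cos(τy)). The first part is
O(y/L) because φ is Lipschitz, the second produces `logKernel`. -/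
theorem exists_norm_archTerm_sub_le {φ : ℝ → ℝ} (hφ : ContDiff ℝ ∞ φ) (hc : HasCompactSupport φ) :
    ∃ C : ℝ, 0 ≤ C ∧ ∀ L : ℝ, 0 < L → ∀ τ : ℝ,
      ‖archTerm (fun y => (modulated φ L τ y : ℂ)) - (φ 0 * logKernel τ / L : ℝ)‖ ≤
        C * (1 + 1 / L) / L := by
  obtain ⟨K, hK0, hK⟩ := exists_abs_sub_le_of_contDiff hφ hc
  obtain ⟨C₁, hC₁, h₁⟩ := exists_abs_kappa_integral_sub_logKernel_le
  set J := ∫ y in Set.Ioi (0 : ℝ), y * kappa y with hJ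
  have hJ0 : 0 ≤ J := setIntegral_nonneg measurableSet_Ioi fun y hy =>
    mul_nonneg (le_of_lt hy) (kappa_nonneg hy)
  refine ⟨2 * ‖archConst‖ * |φ 0| + |φ 0| * C₁ + 2 * K * J, by positivity, fun L hL τ => ?_⟩
  set A : ℝ → ℝ := fun y => kappa y * ((φ 0 - φ (y / L)) * Real.cos (τ * y)) with hA
  set B : ℝ → ℝ := fun y => kappa y * (1 - Real.cos (τ * y)) with hB
  have hAle : ∀ y, 0 < y → ‖A y‖ ≤ K / L * (y * kappa y) := by
    intro y hy
    rw [hA, norm_mul, norm_mul, Real.norm_of_nonneg (kappa_nonneg hy), Real.norm_eq_abs, Real.norm_eq_abs]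
    have e1 := hK (y / L)
    rw [abs_div, abs_of_pos hy, abs_of_pos hL] at e1
    have e2 := Real.abs_cos_le_one (τ * y)
    have hk := kappa_nonneg hy
    calc _ ≤ kappa y * (K * (y / L) * 1) := by gcongr
      _ = _ := by ring
  have hAi : IntegrableOn A (Set.Ioi 0) := by
    refine Integrable.mono' (integrableOn_mul_kappa.const_mul (K / L)) ?_ ?_
    · have := measurable_kappa
      have h2 := hφ.continuous.measurable
      exact Measurable.aestronglyMeasurable (by fun_prop)
    · filter_upwards [ae_restrict_mem measurableSet_Ioi] with y hy using hAle y hy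
  have hBi : IntegrableOn B (Set.Ioi 0) := integrableOn_kappa_mul_one_sub_cos τ
  have hAb : |∫ y in Set.Ioi (0 : ℝ), A y| ≤ K / L * J := by
    rw [hJ, ← integral_const_mul, ← Real.norm_eq_abs]
    refine norm_integral_le_of_norm_le (integrableOn_mul_kappa.const_mul (K / L)) ?_
    filter_upwards [ae_restrict_mem measurableSet_Ioi] with y hy using hAle y hy
  have hm0 : modulated φ L τ 0 = 2 / L * φ 0 := by simp [modulated]
  have hmain : archTerm (fun y => (modulated φ L τ y : ℂ)) = archConst * (2 / L * φ 0 : ℝ) +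
      ((2 / L * (∫ y in Set.Ioi (0 : ℝ), A y) + 2 / L * (φ 0 * ∫ y in Set.Ioi (0 : ℝ), B y) : ℝ) : ℂ) := by
    rw [archTerm, hm0]
    congr 1
    rw [← integral_const_mul, ← integral_const_mul, ← integral_const_mul,
      ← integral_add (hAi.const_mul _) ((hBi.const_mul _).const_mul _), ← integral_complex_ofReal]
    refine setIntegral_congr_fun measurableSet_Ioi fun y _ => ?_
    simp only [hA, hB, modulated]
    push_cast
    ring
  have hB' := h₁ τ
  have hsplit : archTerm (fun y => (modulated φ L τ y : ℂ)) - (φ 0 * logKernel τ / L : ℝ) =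
      archConst * (2 / L * φ 0 : ℝ) + ((2 / L * (∫ y in Set.Ioi (0 : ℝ), A y) +
        φ 0 / L * (2 * (∫ y in Set.Ioi (0 : ℝ), B y) - logKernel τ) : ℝ) : ℂ) := by
    rw [hmain]
    push_cast
    ring
  rw [hsplit]
  refine (norm_add_le _ _).trans ?_
  rw [norm_mul, Complex.norm_real, Complex.norm_real]
  have n1 : ‖2 / L * φ 0‖ = 2 / L * |φ 0| := by
    rw [norm_mul, Real.norm_eq_abs, Real.norm_eq_abs, abs_of_pos (by positivity)]
  have n2 : ‖2 / L * (∫ y in Set.Ioi (0 : ℝ), A y) +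
      φ 0 / L * (2 * (∫ y in Set.Ioi (0 : ℝ), B y) - logKernel τ)‖ ≤
      2 / L * (K / L * J) + |φ 0| / L * C₁ := by
    refine (norm_add_le _ _).trans ?_
    rw [norm_mul, norm_mul, Real.norm_eq_abs, Real.norm_eq_abs, Real.norm_eq_abs, Real.norm_eq_abs,
      abs_of_pos (by positivity : 0 < 2 / L), abs_div, abs_of_pos hL]
    gcongr
  rw [n1]
  refine (add_le_add_right n2 _).trans ?_
  have hL' : 0 < 1 / L := by positivity
  have : 2 * K * J * (1 / L) ≤ (2 * ‖archConst‖ * |φ 0| + |φ 0| * C₁ + 2 * K * J) * (1 / L) := by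
    gcongr
    have : 0 ≤ 2 * ‖archConst‖ * |φ 0| + |φ 0| * C₁ := by positivity
    linarith
  rw [le_div_iff₀ hL]
  have e9 : (‖archConst‖ * (2 / L * |φ 0|) + (2 / L * (K / L * J) + |φ 0| / L * C₁)) * L =
      2 * ‖archConst‖ * |φ 0| + |φ 0| * C₁ + 2 * K * J * (1 / L) := by
    field_simp
    ring
  rw [e9]
  have : 0 ≤ 2 * K * J := by positivity
  nlinarith

end ZetaStatistics
end

/-! ### The explicit formula for the zero statistic. -/

noncomputable section
namespace ZetaStatistics

open ArithmeticFunction (vonMangoldt)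

theorem hat_eq_integral (g : ℝ → ℝ) (u : ℝ) :
    hat g u = ∫ x : ℝ, (g x : ℂ) * Complex.exp (-(2 * Real.pi * x * u : ℝ) * Complex.I) := by
  rw [hat, Real.fourier_eq']
  refine integral_congr_ae (Eventually.of_forall fun x => ?_)
  simp only [smul_eq_mul, RCLike.inner_apply, conj_trivial]
  rw [mul_comm]
  congr 2
  push_cast
  ring

theorem hat_zero (g : ℝ → ℝ) : hat g 0 = (∫ x, g x : ℝ) := by
  rw [hat_eq_integral, ← integral_complex_ofReal]
  simp

theorem hat_neg_eq_conj (g : ℝ → ℝ) (u : ℝ) : hat g (-u) = (starRingEnd ℂ) (hat g u) := by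
  rw [hat_eq_integral, hat_eq_integral, ← integral_conj]
  congr 1 with x
  rw [map_mul, Complex.conj_ofReal, ← Complex.exp_conj]
  congr 2
  simp only [map_mul, map_neg, Complex.conj_ofReal, Complex.conj_I]
  push_cast
  ring

theorem hat_neg_of_even {g : ℝ → ℝ} (hg : ∀ x, g (-x) = g x) (u : ℝ) : hat g (-u) = hat g u := by
  rw [hat_eq_integral, hat_eq_integral, ← integral_neg_eq_self]
  congr 1 with x
  rw [hg]
  congr 2
  push_cast
  ring

theorem ofReal_re_hat {g : ℝ → ℝ} (hg : ∀ x, g (-x) = g x) (u : ℝ) : ((hat g u).re : ℂ) = hat g u := by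
  have h := hat_neg_eq_conj g u
  rw [hat_neg_of_even hg] at h
  exact Complex.conj_eq_iff_re.1 h.symm

/-- The test function on the logarithmic scale whose two-sided Laplace transform at the zeros
gives the terms of the zero-counting statistic. -/
def scaled (φ : ℝ → ℝ) (L τ x : ℝ) : ℂ := (φ (x / L) / L : ℝ) * Complex.exp (-(τ * x : ℝ) * Complex.I)

theorem lap_scaled (φ : ℝ → ℝ) {L : ℝ} (hL : 0 < L) (τ : ℝ) (z : ℂ) :
    lap (scaled φ L τ) z = lap (fun u => (φ u : ℂ)) (L * (z - τ * Complex.I)) := by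
  have h := Measure.integral_comp_div
    (fun u : ℝ => (φ u : ℂ) * Complex.exp (u * (L * (z - τ * Complex.I)))) L
  rw [abs_of_pos hL] at h
  have hL' : (L : ℂ) ≠ 0 := by exact_mod_cast hL.ne'
  have h2 : lap (fun u => (φ u : ℂ)) (L * (z - τ * Complex.I)) =
      (L : ℂ)⁻¹ * ∫ x : ℝ, (φ (x / L) : ℂ) * Complex.exp ((x / L : ℝ) * (L * (z - τ * Complex.I))) := by
    rw [h, Complex.real_smul, lap, inv_mul_cancel_left₀ hL']
  rw [h2, ← integral_const_mul, lap]
  congr 1 with x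
  have e : ((x / L : ℝ) : ℂ) * (L * (z - τ * Complex.I)) = -(τ * x : ℝ) * Complex.I + x * z := by
    push_cast
    field_simp
    ring
  rw [e, Complex.exp_add, scaled]
  push_cast
  ring

theorem contDiff_scaled {φ : ℝ → ℝ} (hφ : ContDiff ℝ ∞ φ) (L τ : ℝ) : ContDiff ℝ ∞ (scaled φ L τ) := by
  unfold scaled
  have h1 : ContDiff ℝ ∞ fun x : ℝ => ((φ (x / L) / L : ℝ) : ℂ) :=
    Complex.ofRealCLM.contDiff.comp ((hφ.comp (contDiff_id.div_const L)).div_const L)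
  have h2 : ContDiff ℝ ∞ fun x : ℝ => ((τ * x : ℝ) : ℂ) :=
    Complex.ofRealCLM.contDiff.comp (contDiff_const.mul contDiff_id)
  exact h1.mul (h2.neg.mul contDiff_const).cexp

theorem hasCompactSupport_scaled {φ : ℝ → ℝ} (hc : HasCompactSupport φ) {L : ℝ} (hL : 0 < L) (τ : ℝ) :
    HasCompactSupport (scaled φ L τ) := by
  obtain ⟨b, -, hb⟩ := exists_support_bound (hc.comp_left (g := ((↑) : ℝ → ℂ)) rfl)
  replace hb : ∀ x, b < |x| → φ x = 0 := fun x hx => Complex.ofReal_eq_zero.1 (hb x hx)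
  refine HasCompactSupport.intro (isCompact_Icc (a := -(b * L)) (b := b * L)) fun x hx => ?_
  rw [scaled, hb, zero_div, Complex.ofReal_zero, zero_mul]
  rw [abs_div, abs_of_pos hL, lt_div_iff₀ hL]
  rw [Set.mem_Icc, ← abs_le] at hx
  exact not_le.1 hx

theorem scaled_add_neg {φ : ℝ → ℝ} (he : ∀ u, φ (-u) = φ u) (L τ x : ℝ) :
    scaled φ L τ x + scaled φ L τ (-x) = (modulated φ L τ x : ℂ) := by
  rw [scaled, scaled, modulated, neg_div, he]
  push_cast
  rw [Complex.cos]
  rw [show -(τ * -x : ℂ) * Complex.I = τ * x * Complex.I by ring,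
    show -(τ * x : ℂ) * Complex.I = -(τ * x) * Complex.I by ring]
  ring

/-- The contribution of the prime powers to the explicit formula, up to `N`. -/
def primeSum (φ : ℝ → ℝ) (L : ℝ) (N : ℕ) (τ : ℝ) : ℝ :=
  -∑ n ∈ Finset.range N, vonMangoldt n / √n * modulated φ L τ (Real.log n)

/-- The contribution of the pole of the zeta function to the explicit formula. -/
def poleTerm (φ : ℝ → ℝ) (L τ : ℝ) : ℂ :=
  lap (fun u => (φ u : ℂ)) (L * (1 / 2 - τ * Complex.I)) +
    lap (fun u => (φ u : ℂ)) (L * (-(1 / 2) - τ * Complex.I))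

/-- Dilating φ by L and modulating by e^(-iτx) puts the zeros at L(z - iτ). As φ vanishes beyond b,
the prime side stops at e^(bL). -/
theorem hasSum_order_mul_lap_scaled {φ : ℝ → ℝ} (hφ : ContDiff ℝ ∞ φ) (hc : HasCompactSupport φ)
    (he : ∀ u, φ (-u) = φ u) {b : ℝ} (hb : ∀ u, b < |u| → φ u = 0) {L : ℝ} (hL : 0 < L) (τ : ℝ) {N : ℕ}
    (hN : Real.exp (b * L) < N) :
    HasSum (fun z : ℂ => (analyticOrderNatAt xi z : ℂ) * lap (fun u => (φ u : ℂ)) (L * (z - τ * Complex.I)))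
      (poleTerm φ L τ + archTerm (fun y => (modulated φ L τ y : ℂ)) + (primeSum φ L N τ : ℂ)) := by
  have h := explicit_formula (contDiff_scaled hφ L τ) (hasCompactSupport_scaled hc hL τ)
  simp only [lap_scaled φ hL, scaled_add_neg he] at h
  convert h using 1
  rw [sub_eq_add_neg]
  congr 1
  rw [primeSum, Complex.ofReal_neg, tsum_eq_sum (s := Finset.range N)]
  · push_cast
    rfl
  · intro n hn
    rw [Finset.mem_range, not_lt] at hn
    have hn' : Real.exp (b * L) < n := hN.trans_le (by exact_mod_cast hn)
    have h1 : b * L < Real.log n := (Real.lt_log_iff_exp_lt ((Real.exp_pos _).trans hn')).2 hn'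
    rw [modulated, hb, zero_mul, mul_zero, Complex.ofReal_zero, mul_zero]
    refine lt_of_lt_of_le ?_ (le_abs_self _)
    rwa [lt_div_iff₀ hL]

/-- Both sides are one integral of f̂ against an exponential, since i(γ - τ) = ρ - 1/2 - iτ.
Evenness of f enters only to make f̂ real. -/
theorem extension_eq_lap {f : ℝ → ℝ} (hf : ∀ x, f (-x) = f x) (L τ : ℝ) (ρ : ℂ) :
    extension f ((L / (2 * Real.pi) : ℝ) * (gam ρ - τ)) =
      lap (fun u => ((hat f u).re : ℂ)) (L * (ρ - 1 / 2 - τ * Complex.I)) := by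
  rw [extension, lap]
  congr 1 with u
  rw [ofReal_re_hat hf, gam]
  congr 2
  have hpi : (Real.pi : ℂ) ≠ 0 := by exact_mod_cast Real.pi_ne_zero
  push_cast
  field_simp

/-- The explicit formula for the zero-counting statistic. -/
theorem hasSum_zeroTerm {f : ℝ → ℝ} (hf : ∀ x, f (-x) = f x) (hs : ContDiff ℝ ∞ (hat f))
    (hc : HasCompactSupport (hat f)) {b : ℝ} (hb : ∀ u, b < |u| → hat f u = 0) {T : ℝ} (hT : 1 < T) (τ : ℝ)
    {N : ℕ} (hN : Real.exp (b * Real.log T) < N) :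
    HasSum (fun ρ : nontrivialZeros => zeroTerm f T τ ρ)
      (poleTerm (fun u => (hat f u).re) (Real.log T) τ +
        archTerm (fun y => (modulated (fun u => (hat f u).re) (Real.log T) τ y : ℂ)) +
        (primeSum (fun u => (hat f u).re) (Real.log T) N τ : ℂ)) := by
  have hL : 0 < Real.log T := Real.log_pos hT
  have hφ : ContDiff ℝ ∞ fun u => (hat f u).re := Complex.reCLM.contDiff.comp hs
  have hφc : HasCompactSupport fun u => (hat f u).re := hc.comp_left (g := Complex.re) rfl
  have h := hasSum_order_mul_lap_scaled hφ hφc (fun u => by rw [hat_neg_of_even hf]) (b := b)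
    (fun u hu => by rw [hb u hu, Complex.zero_re]) hL τ hN
  have hinj : Function.Injective fun ρ : nontrivialZeros => (ρ : ℂ) - 1 / 2 := fun x y hxy =>
    Subtype.ext (sub_left_injective hxy)
  rw [← hinj.hasSum_iff] at h
  · convert h using 1
    funext ρ
    have hρ := ρ.2
    have hz : |((ρ : ℂ) - 1 / 2).re| < 1 / 2 := by
      rw [Complex.sub_re, abs_lt]
      norm_num
      exact ⟨hρ.2.1, by linarith [hρ.2.2]⟩
    have := analyticOrderNatAt_riemannZeta hz
    rw [add_sub_cancel] at this
    simp only [Function.comp_apply, zeroTerm]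
    rw [this, extension_eq_lap hf]
  -- Outside the shifted critical zeros the order of ξ is 0, so the sum over ℂ loses nothing when
  -- restricted to them.
  · intro z hz
    have : analyticOrderNatAt xi z = 0 := by
      by_contra h0
      have hre := abs_re_lt_of_order_ne_zero h0
      have hord := analyticOrderNatAt_riemannZeta hre
      refine hz ⟨⟨1 / 2 + z, ?_, ?_, ?_⟩, by simp⟩
      · by_contra hne
        rw [← hord] at h0
        apply h0
        rw [analyticOrderNatAt, ENat.toNat_eq_zero]
        left
        rw [analyticOrderAt_eq_zero]
        exact Or.inr hne
      · rw [abs_lt] at hre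
        simp only [Complex.add_re]
        norm_num
        linarith
      · rw [abs_lt] at hre
        simp only [Complex.add_re]
        norm_num
        linarith
    rw [this, Nat.cast_zero, zero_mul]

end ZetaStatistics
end

/-! ### Weighted sums over primes from Mertens' estimate. -/

noncomputable section
namespace ZetaStatistics

open ArithmeticFunction (vonMangoldt)

theorem log_factorial_eq_sum (N : ℕ) :
    Real.log (N.factorial) = ∑ n ∈ Finset.Ioc 0 N, vonMangoldt n * ((N / n : ℕ) : ℝ) := by
  have h : Real.log (N.factorial) = ∑ n ∈ Finset.Ioc 0 N, Real.log n := by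
    induction N with
    | zero => simp
    | succ N ih =>
      rw [Finset.sum_Ioc_succ_top (Nat.zero_le _), ← ih, Nat.factorial_succ, Nat.cast_mul,
        Real.log_mul (by positivity) (by positivity), add_comm]
  rw [← ArithmeticFunction.sum_Ioc_mul_zeta_eq_sum, h]
  refine Finset.sum_congr rfl fun n _ => ?_
  rw [ArithmeticFunction.vonMangoldt_mul_zeta, ArithmeticFunction.log_apply]

/-- A weak form of Mertens' first theorem. -/
theorem exists_abs_sum_vonMangoldt_div_sub_log_le :
    ∃ C : ℝ, 0 ≤ C ∧ ∀ N : ℕ, 1 ≤ N →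
      |∑ n ∈ Finset.Ioc 0 N, vonMangoldt n / n - Real.log N| ≤ C := by
  refine ⟨Real.log 4 + 4, by positivity, fun N hN => ?_⟩
  have hN0 : (0 : ℝ) < N := by exact_mod_cast hN
  set A := ∑ n ∈ Finset.Ioc 0 N, vonMangoldt n / n
  have h1 : Real.log N.factorial ≤ N * A := by
    rw [log_factorial_eq_sum, Finset.mul_sum]
    refine Finset.sum_le_sum fun n _ => ?_
    have : ((N / n : ℕ) : ℝ) ≤ N / n := Nat.cast_div_le
    have h2 : 0 ≤ vonMangoldt n := ArithmeticFunction.vonMangoldt_nonneg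
    calc _ ≤ vonMangoldt n * (N / n : ℝ) := by gcongr
      _ = _ := by ring
  -- Replacing N/n by its integer part costs at most ψ(N), which Chebyshev's bound makes O(N).
  have h2 : N * A - Chebyshev.psi N ≤ Real.log N.factorial := by
    rw [log_factorial_eq_sum, Finset.mul_sum, Chebyshev.psi, Nat.floor_natCast, ← Finset.sum_sub_distrib]
    refine Finset.sum_le_sum fun n hn => ?_
    have h3 : (N : ℝ) / n - 1 ≤ ((N / n : ℕ) : ℝ) := by
      have hn0 : (0 : ℝ) < n := by exact_mod_cast (Finset.mem_Ioc.1 hn).1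
      have : N < n * (N / n) + n := Nat.lt_mul_div_succ N (Finset.mem_Ioc.1 hn).1
      have h4 : (N : ℝ) < n * ((N / n : ℕ) : ℝ) + n := by exact_mod_cast this
      rw [sub_le_iff_le_add, div_le_iff₀ hn0]
      nlinarith
    have h2 : 0 ≤ vonMangoldt n := ArithmeticFunction.vonMangoldt_nonneg
    calc _ = vonMangoldt n * (N / n - 1 : ℝ) := by ring
      _ ≤ _ := by gcongr
  have h3 : Real.log N.factorial ≤ N * Real.log N := by
    have h : (N.factorial : ℝ) ≤ (N : ℝ) ^ N := by exact_mod_cast Nat.factorial_le_pow N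
    have := Real.log_le_log (by positivity) h
    rwa [Real.log_pow] at this
  have h4 : N * Real.log N - N ≤ Real.log N.factorial := by
    have h := Stirling.le_log_factorial_stirling (n := N) (by omega)
    have h5 : 0 ≤ Real.log N := Real.log_natCast_nonneg N
    have h6 : 0 ≤ Real.log (2 * Real.pi) := Real.log_nonneg (by nlinarith [Real.pi_gt_three])
    linarith
  have h5 := Chebyshev.psi_le_const_mul_self hN0.le
  have h6 : 0 ≤ Real.log 4 := Real.log_nonneg (by norm_num)
  rw [abs_le]
  constructor
  · by_contra hcon
    push Not at hcon
    nlinarith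
  · by_contra hcon
    push Not at hcon
    nlinarith

/-- Partial summation against Mertens' estimate. The main term is a change of variable u = log t /
L. The error is bounded by the total variation of G(log t / L), which does not depend on L, so the
prefactor 1/L is the whole gain. -/
theorem exists_abs_sum_vonMangoldt_div_mul_sub_le {G : ℝ → ℝ} (hG : ContDiff ℝ 1 G)
    {b : ℝ} (hb : ∀ u, b < |u| → G u = 0) :
    ∃ C : ℝ, 0 ≤ C ∧ ∀ L : ℝ, 0 < L → ∀ N : ℕ, 1 ≤ N → Real.exp (b * L) < N →
      |1 / L * ∑ n ∈ Finset.range N, vonMangoldt n / n * G (Real.log n / L) - ∫ u in Set.Ioi 0, G u| ≤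
        C / L := by
  obtain ⟨C₁, hC₁, hM⟩ := exists_abs_sum_vonMangoldt_div_sub_log_le
  have hGc : HasCompactSupport G := by
    refine HasCompactSupport.intro (isCompact_Icc (a := -b) (b := b)) fun x hx => hb x ?_
    rw [Set.mem_Icc, ← abs_le] at hx
    exact not_le.1 hx
  have hdG : Continuous (deriv G) := hG.continuous_deriv le_rfl
  have hdi : Integrable (deriv G) := hdG.integrable_of_hasCompactSupport hGc.deriv
  refine ⟨(C₁ + 1) * ∫ u, |deriv G u|, by positivity, fun L hL N hN1 hN => ?_⟩
  set f : ℝ → ℝ := fun t => G (Real.log t / L) with hf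
  have hN0 : (0 : ℝ) < N := by exact_mod_cast hN1
  have hN1' : (1 : ℝ) ≤ N := by exact_mod_cast hN1
  have hbN : b < Real.log N / L := by
    rw [lt_div_iff₀ hL]
    exact (Real.lt_log_iff_exp_lt hN0).2 hN
  have hfN : f N = 0 := hb _ (hbN.trans_le (le_abs_self _))
  have hdu : ∀ t : ℝ, 0 < t → HasDerivAt (fun t => Real.log t / L) (t⁻¹ / L) t := fun t ht =>
    (Real.hasDerivAt_log ht.ne').div_const L
  have hdf : ∀ t : ℝ, 0 < t → HasDerivAt f (deriv G (Real.log t / L) * (t⁻¹ / L)) t := fun t ht =>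
    ((hG.differentiable one_ne_zero).differentiableAt.hasDerivAt).comp t (hdu t ht)
  have hpos : ∀ t ∈ Set.uIcc (1 : ℝ) N, 0 < t := fun t ht => by
    rw [Set.uIcc_of_le hN1'] at ht
    linarith [ht.1]
  have hlog : ContinuousOn (fun t : ℝ => Real.log t / L) (Set.uIcc (1 : ℝ) N) := fun t ht =>
    (hdu t (hpos t ht)).continuousAt.continuousWithinAt
  have hinv : ContinuousOn (fun t : ℝ => t⁻¹ / L) (Set.uIcc (1 : ℝ) N) :=
    (continuousOn_id.inv₀ fun t ht => (hpos t ht).ne').div_const L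
  have hcont : ContinuousOn (fun t => deriv G (Real.log t / L) * (t⁻¹ / L)) (Set.uIcc (1 : ℝ) N) :=
    (hdG.comp_continuousOn hlog).mul hinv
  have hcont' : ContinuousOn (deriv f) (Set.uIcc (1 : ℝ) N) :=
    hcont.congr fun t ht => (hdf t (hpos t ht)).deriv
  have hab := sum_mul_eq_sub_integral_mul₀ (fun n : ℕ => vonMangoldt n / n) (f := f) (by simp) (N : ℝ)
    (fun t ht => (hdf t (by linarith [ht.1])).differentiableAt)
    (by rw [← Set.uIcc_of_le hN1']; exact hcont'.integrableOn_compact isCompact_uIcc)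
  rw [hfN, zero_mul, zero_sub, Nat.floor_natCast] at hab
  have hsum : ∑ n ∈ Finset.range N, vonMangoldt n / n * G (Real.log n / L) =
      ∑ k ∈ Finset.Icc 0 N, f k * (vonMangoldt k / k) := by
    rw [← Nat.range_succ_eq_Icc_zero, Finset.sum_range_succ, hfN, zero_mul, add_zero]
    exact Finset.sum_congr rfl fun n _ => mul_comm _ _
  have hparts := intervalIntegral.integral_mul_deriv_eq_deriv_mul (a := 1) (b := (N : ℝ)) (u := Real.log)
    (v := f) (u' := fun t => t⁻¹) (v' := deriv f) (fun t ht => Real.hasDerivAt_log (hpos t ht).ne')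
    (fun t ht => (hdf t (hpos t ht)).differentiableAt.hasDerivAt)
    (ContinuousOn.intervalIntegrable (continuousOn_id.inv₀ fun t ht => (hpos t ht).ne'))
    hcont'.intervalIntegrable
  rw [hfN, mul_zero, Real.log_one, zero_mul, sub_zero, zero_sub] at hparts
  have hcv : ∫ t in (1 : ℝ)..N, t⁻¹ * f t = L * ∫ u in Set.Ioi 0, G u := by
    have h := intervalIntegral.integral_comp_mul_deriv (a := 1) (b := (N : ℝ)) (g := G)
      (f := fun t => Real.log t / L) (f' := fun t => t⁻¹ / L) (fun t ht => hdu t (hpos t ht)) hinv hG.continuous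
    simp only [Real.log_one, zero_div] at h
    have h2 : ∫ u in (0 : ℝ)..(Real.log N / L), G u = ∫ u in Set.Ioi 0, G u := by
      rw [intervalIntegral.integral_of_le (div_nonneg (Real.log_natCast_nonneg N) hL.le)]
      refine (setIntegral_eq_of_subset_of_forall_sdiff_eq_zero measurableSet_Ioi
        (fun x hx => hx.1) fun x hx => hb x ?_).symm
      have : Real.log N / L < x := by
        by_contra hc
        exact hx.2 ⟨hx.1, not_lt.1 hc⟩
      exact (hbN.trans this).trans_le (le_abs_self x)
    rw [← h2, ← h, ← intervalIntegral.integral_const_mul]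
    congr 1 with t
    simp only [Function.comp_apply, hf]
    field_simp
  have hcv2 : ∫ t in (1 : ℝ)..N, |deriv f t| ≤ ∫ u, |deriv G u| := by
    have h := intervalIntegral.integral_comp_mul_deriv (a := 1) (b := (N : ℝ)) (g := fun u => |deriv G u|)
      (f := fun t => Real.log t / L) (f' := fun t => t⁻¹ / L) (fun t ht => hdu t (hpos t ht)) hinv hdG.abs
    have h1 : ∫ t in (1 : ℝ)..N, |deriv f t| =
        ∫ t in (1 : ℝ)..N, ((fun u => |deriv G u|) ∘ fun t => Real.log t / L) t * (t⁻¹ / L) := by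
      refine intervalIntegral.integral_congr fun t ht => ?_
      have ht0 := hpos t ht
      simp only [Function.comp_apply]
      rw [(hdf t ht0).deriv, abs_mul, abs_of_pos (by positivity : 0 < t⁻¹ / L)]
    rw [h1, h, intervalIntegral.integral_of_le (by
      simp only [Real.log_one, zero_div]
      exact div_nonneg (Real.log_natCast_nonneg N) hL.le)]
    exact setIntegral_le_integral hdi.abs (Eventually.of_forall fun _ => abs_nonneg _)
  set A : ℝ → ℝ := fun t => ∑ k ∈ Finset.Icc 0 ⌊t⌋₊, vonMangoldt k / k with hA
  have hAle : ∀ t : ℝ, 1 ≤ t → |A t - Real.log t| ≤ C₁ + 1 := by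
    intro t ht
    have hfl : 1 ≤ ⌊t⌋₊ := (Nat.one_le_floor_iff t).2 ht
    have h1 := hM ⌊t⌋₊ hfl
    have h2 : A t = ∑ n ∈ Finset.Ioc 0 ⌊t⌋₊, vonMangoldt n / n := by
      rw [hA]
      simp only
      rw [← Finset.add_sum_Ioc_eq_sum_Icc (Nat.zero_le _)]
      simp
    have hfl0 : (1 : ℝ) ≤ ⌊t⌋₊ := by exact_mod_cast hfl
    have h3 : Real.log ⌊t⌋₊ ≤ Real.log t := Real.log_le_log (by linarith) (Nat.floor_le (by linarith))
    -- t ≤ ⌊t⌋ + 1 ≤ 2⌊t⌋ ≤ e⌊t⌋; this is the extra 1 in `C₁ + 1`.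
    have h4 : Real.log t ≤ Real.log ⌊t⌋₊ + 1 := by
      have h5 : t ≤ ⌊t⌋₊ * Real.exp 1 := by
        have := (Nat.lt_floor_add_one t).le
        have := Real.add_one_le_exp 1
        nlinarith
      have := Real.log_le_log (by linarith) h5
      rwa [Real.log_mul (by linarith) (Real.exp_pos 1).ne', Real.log_exp] at this
    rw [h2]
    rw [abs_le] at *
    constructor <;> linarith [h1.1, h1.2]
  have hAm : Measurable A := by
    have h : Measurable fun n : ℕ => ∑ k ∈ Finset.Icc 0 n, vonMangoldt k / k := measurable_of_countable _
    exact h.comp Nat.measurable_floor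
  have hi1 : IntervalIntegrable (fun t => Real.log t * deriv f t) volume 1 N :=
    ContinuousOn.intervalIntegrable (ContinuousOn.mul
      (Real.continuousOn_log.mono fun t ht => (hpos t ht).ne') hcont')
  have hdb : IntervalIntegrable (fun t => deriv f t * (A t - Real.log t)) volume 1 N := by
    refine IntervalIntegrable.mono_fun ((hcont'.intervalIntegrable).mul_const (C₁ + 1)) ?_ ?_
    · exact ((measurable_deriv f).mul (hAm.sub Real.measurable_log)).aestronglyMeasurable
    · rw [Set.uIoc_of_le hN1']
      filter_upwards [ae_restrict_mem measurableSet_Ioc] with t ht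
      rw [norm_mul, norm_mul]
      gcongr
      rw [Real.norm_eq_abs, Real.norm_eq_abs]
      exact (hAle t ht.1.le).trans (le_abs_self _)
  have hsplit : ∫ t in Set.Ioc (1 : ℝ) N, deriv f t * A t =
      (∫ t in (1 : ℝ)..N, Real.log t * deriv f t) + ∫ t in (1 : ℝ)..N, deriv f t * (A t - Real.log t) := by
    rw [← intervalIntegral.integral_add hi1 hdb, intervalIntegral.integral_of_le hN1']
    congr 1 with t
    ring
  have herr : |∫ t in (1 : ℝ)..N, deriv f t * (A t - Real.log t)| ≤ (C₁ + 1) * ∫ u, |deriv G u| := by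
    have h := intervalIntegral.norm_integral_le_of_norm_le hN1' (μ := volume)
      (f := fun t => deriv f t * (A t - Real.log t)) (g := fun t => (C₁ + 1) * |deriv f t|)
      (Eventually.of_forall fun t ht => by
        rw [norm_mul, mul_comm, Real.norm_eq_abs, Real.norm_eq_abs]
        exact mul_le_mul_of_nonneg_right (hAle t ht.1.le) (abs_nonneg _))
      (hcont'.intervalIntegrable.abs.const_mul _)
    rw [Real.norm_eq_abs, intervalIntegral.integral_const_mul] at h
    refine h.trans ?_
    gcongr
  rw [hsum, hab, hsplit, hparts, hcv]
  rw [show 1 / L * -(-(L * ∫ u in Set.Ioi 0, G u) + ∫ t in (1 : ℝ)..N, deriv f t * (A t - Real.log t)) -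
    ∫ u in Set.Ioi 0, G u = -(∫ t in (1 : ℝ)..N, deriv f t * (A t - Real.log t)) / L by field_simp; ring]
  rw [abs_div, abs_neg, abs_of_pos hL]
  gcongr

theorem summable_vonMangoldt_div_not_prime :
    Summable fun n : ℕ => (if n.Prime then 0 else vonMangoldt n) / n := by
  have h := ArithmeticFunction.vonMangoldt.summable_residueClass_non_primes_div (q := 1) 0
  convert h using 4 with n
  simp [ArithmeticFunction.vonMangoldt.residueClass, Set.indicator, Subsingleton.elim _ (0 : ZMod 1)]

/-- On primes Λ² = Λ log, which reduces the sum to the preceding one with u h(u). On the other prime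
powers |Λ - log| ≤ bL within the support, and the sum of Λ(n)/n over non-primes converges, so they
contribute O(1/L). -/
theorem exists_abs_sum_vonMangoldt_sq_sub_le {h : ℝ → ℝ} (hh : ContDiff ℝ 1 h)
    {b : ℝ} (hb0 : 0 ≤ b) (hb : ∀ u, b < |u| → h u = 0) :
    ∃ C : ℝ, 0 ≤ C ∧ ∀ L : ℝ, 0 < L → ∀ N : ℕ, 1 ≤ N → Real.exp (b * L) < N →
      |1 / L ^ 2 * ∑ n ∈ Finset.range N, vonMangoldt n ^ 2 / n * h (Real.log n / L) -
        ∫ u in Set.Ioi 0, u * h u| ≤ C / L := by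
  obtain ⟨C₁, hC₁, h₁⟩ := exists_abs_sum_vonMangoldt_div_mul_sub_le (G := fun u => u * h u)
    (contDiff_id.mul hh) (b := b) (fun u hu => by rw [hb u hu, mul_zero])
  have hhc : HasCompactSupport h := by
    refine HasCompactSupport.intro (isCompact_Icc (a := -b) (b := b)) fun x hx => hb x ?_
    rw [Set.mem_Icc, ← abs_le] at hx
    exact not_le.1 hx
  obtain ⟨K, hK⟩ := hhc.exists_bound_of_continuous hh.continuous
  have hK0 : 0 ≤ K := (norm_nonneg _).trans (hK 0)
  set S := ∑' n : ℕ, (if n.Prime then 0 else vonMangoldt n) / (n : ℝ)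
  have hterm0 : ∀ n : ℕ, 0 ≤ (if n.Prime then 0 else vonMangoldt n) / (n : ℝ) := fun n => by
    split_ifs
    · simp
    · exact div_nonneg ArithmeticFunction.vonMangoldt_nonneg n.cast_nonneg
  have hS0 : 0 ≤ S := tsum_nonneg hterm0
  refine ⟨C₁ + b * K * S, by positivity, fun L hL N hN1 hN => ?_⟩
  have h2 := h₁ L hL N hN1 hN
  have hkey : |1 / L ^ 2 * ∑ n ∈ Finset.range N, vonMangoldt n ^ 2 / n * h (Real.log n / L) -
      1 / L * ∑ n ∈ Finset.range N, vonMangoldt n / n * (Real.log n / L * h (Real.log n / L))| ≤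
      b * K * S / L := by
    rw [Finset.mul_sum, Finset.mul_sum, ← Finset.sum_sub_distrib]
    refine (Finset.abs_sum_le_sum_abs _ _).trans ?_
    calc _ ≤ ∑ n ∈ Finset.range N, b * K / L * ((if n.Prime then 0 else vonMangoldt n) / n) := ?_
      _ = b * K / L * ∑ n ∈ Finset.range N, ((if n.Prime then 0 else vonMangoldt n) / (n : ℝ)) := by
        rw [Finset.mul_sum]
      _ ≤ b * K / L * S := by
        gcongr
        exact summable_vonMangoldt_div_not_prime.sum_le_tsum _ (fun n _ => hterm0 n)
      _ = _ := by ring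
    refine Finset.sum_le_sum fun n _ => ?_
    have hΛ : 0 ≤ vonMangoldt n := ArithmeticFunction.vonMangoldt_nonneg
    have e : 1 / L ^ 2 * (vonMangoldt n ^ 2 / n * h (Real.log n / L)) -
        1 / L * (vonMangoldt n / n * (Real.log n / L * h (Real.log n / L))) =
        (vonMangoldt n - Real.log n) * (vonMangoldt n / n) * (h (Real.log n / L) / L ^ 2) := by
      field_simp
    rw [e]
    by_cases hp : n.Prime
    · rw [if_pos hp, ArithmeticFunction.vonMangoldt_apply_prime hp]
      simp
    · rw [if_neg hp]
      by_cases hbn : b < |Real.log n / L|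
      · rw [hb _ hbn]
        simp only [zero_div, mul_zero, abs_zero]
        positivity
      · have hlog0 : 0 ≤ Real.log n := Real.log_natCast_nonneg n
        rw [not_lt, abs_div, abs_of_pos hL, abs_of_nonneg hlog0, div_le_iff₀ hL] at hbn
        have h3 : |vonMangoldt n - Real.log n| ≤ b * L := by
          have := ArithmeticFunction.vonMangoldt_le_log (n := n)
          rw [abs_le]
          constructor <;> linarith
        have h4 := hK (Real.log n / L)
        rw [Real.norm_eq_abs] at h4
        rw [abs_mul, abs_mul, abs_div (h _), abs_of_nonneg (by positivity : 0 ≤ L ^ 2),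
          abs_of_nonneg (by positivity : 0 ≤ vonMangoldt n / (n : ℝ))]
        calc _ ≤ b * L * (vonMangoldt n / n) * (K / L ^ 2) := by gcongr
          _ = _ := by field_simp
  have e3 : (C₁ + b * K * S) / L = C₁ / L + b * K * S / L := by ring
  rw [e3]
  rw [abs_le] at *
  constructor <;> linarith [h2.1, h2.2, hkey.1, hkey.2]

end ZetaStatistics
end

/-! ### The random model and the exact moment identity. -/

noncomputable section
namespace ZetaStatistics

/-- The uniform distribution on the unit interval. -/
def unif : Measure ℝ := volume.restrict (Set.Ioc 0 1)

instance : IsProbabilityMeasure unif := ⟨by simp [unif]⟩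

theorem integral_unif_exp (j : ℤ) :
    ∫ x, Complex.exp (2 * Real.pi * Complex.I * j * x) ∂unif = if j = 0 then 1 else 0 := by
  rw [unif, ← intervalIntegral.integral_of_le zero_le_one]
  split_ifs with h
  · simp [h]
  · have hc : (2 * Real.pi * Complex.I * j : ℂ) ≠ 0 := by
      simp [h, Real.pi_ne_zero]
    rw [integral_exp_mul_complex hc]
    rw [Complex.ofReal_one, mul_one, Complex.ofReal_zero, mul_zero, Complex.exp_zero]
    rw [show (2 * Real.pi * Complex.I * j : ℂ) = j * (2 * Real.pi * Complex.I) by ring,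
      Complex.exp_int_mul_two_pi_mul_I]
    simp

/-- The uniform distribution on a torus. -/
def torus (N : ℕ) : Measure (Fin N → ℝ) := Measure.pi fun _ => unif

instance (N : ℕ) : IsProbabilityMeasure (torus N) := by unfold torus; infer_instance

theorem integral_torus_exp {N : ℕ} (a : Fin N → ℤ) :
    ∫ θ, Complex.exp (2 * Real.pi * Complex.I * ∑ q, (a q : ℂ) * (θ q : ℂ)) ∂(torus N) =
      if a = 0 then 1 else 0 := by
  have h : ∀ θ : Fin N → ℝ, Complex.exp (2 * Real.pi * Complex.I * ∑ q, (a q : ℂ) * (θ q : ℂ)) =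
      ∏ q, Complex.exp (2 * Real.pi * Complex.I * a q * θ q) := fun θ => by
    rw [← Complex.exp_sum, Finset.mul_sum]
    congr 1
    exact Finset.sum_congr rfl fun q _ => by ring
  simp_rw [h]
  rw [torus, integral_fintype_prod_eq_prod (f := fun q x => Complex.exp (2 * Real.pi * Complex.I * a q * (x : ℝ)))]
  simp_rw [integral_unif_exp]
  split_ifs with h0
  · simp [h0]
  · obtain ⟨q, hq⟩ := Function.ne_iff.1 h0
    exact Finset.prod_eq_zero (Finset.mem_univ q) (if_neg hq)

/-- A finite trigonometric sum with logarithmic frequencies. -/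
def trigSum (c : ℕ → ℝ) (N : ℕ) (τ : ℝ) : ℝ := ∑ n ∈ Finset.range N, c n * Real.cos (τ * Real.log n)

/-- The random phase attached to `n`, in which the primes have independent phases. -/
def phase {N : ℕ} (n : ℕ) (θ : Fin N → ℝ) : ℝ := 2 * Real.pi * ∑ q : Fin N, (n.factorization q : ℝ) * θ q

/-- The random model of `trigSum`. -/
def torusSum (c : ℕ → ℝ) (N : ℕ) (θ : Fin N → ℝ) : ℝ := ∑ n ∈ Finset.range N, c n * Real.cos (phase n θ)

/-- A sign as an integer. -/
def sgn (ε : Bool) : ℤ := if ε then 1 else -1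

/-- The angles x are arbitrary, so one expansion serves both τ log n and the random phases; the two
moments can then be compared term by term. -/
theorem sum_mul_cos_pow (c : ℕ → ℝ) (N k : ℕ) (x : ℕ → ℝ) :
    ((∑ n ∈ Finset.range N, c n * Real.cos (x n) : ℝ) : ℂ) ^ k =
      ∑ t : Fin k → Fin N × Bool, (∏ i, (c (t i).1 / 2 : ℂ)) *
        Complex.exp (Complex.I * ∑ i, (sgn (t i).2 : ℂ) * (x (t i).1 : ℂ)) := by
  have h : ((∑ n ∈ Finset.range N, c n * Real.cos (x n) : ℝ) : ℂ) =
      ∑ s : Fin N × Bool, (c s.1 / 2 : ℂ) * Complex.exp (Complex.I * (sgn s.2 * x s.1)) := by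
    rw [Finset.sum_range, Fintype.sum_prod_type]
    push_cast
    refine Finset.sum_congr rfl fun n _ => ?_
    simp only [Fintype.sum_bool, sgn, Complex.cos]
    simp only [if_true, Bool.false_eq_true, if_false]
    push_cast
    rw [show Complex.I * (1 * (x n : ℂ)) = x n * Complex.I by ring,
      show Complex.I * (-1 * (x n : ℂ)) = -x n * Complex.I by ring]
    ring
  rw [h, Fintype.sum_pow]
  refine Finset.sum_congr rfl fun t _ => ?_
  rw [Finset.prod_mul_distrib, ← Complex.exp_sum, Finset.mul_sum]

/-- For M > M' one has log(M/M') ≥ 1 - M'/M. If M ≤ 2M' this is at least 1/M, and M² ≤ 2MM' ≤ 2Y;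
otherwise it is at least 1/2, while √(2Y) ≥ 2. The square root is what admits supports up to 2a/m
instead of a/m. -/
theorem le_abs_log_sub_log {M M' : ℕ} (hM : 0 < M) (hM' : 0 < M') (hne : M ≠ M') {Y : ℝ}
    (hY : (M : ℝ) * M' ≤ Y) : 1 / √(2 * Y) ≤ |Real.log M - Real.log M'| := by
  wlog hlt : M' < M generalizing M M'
  · rw [abs_sub_comm]
    exact this hM' hM hne.symm (by rwa [mul_comm]) (by omega)
  have h1 : (M' : ℝ) + 1 ≤ M := by exact_mod_cast hlt
  have h0 : (1 : ℝ) ≤ M' := by exact_mod_cast hM'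
  have hM0 : (0 : ℝ) < M := by linarith
  have h2 := Real.one_sub_inv_le_log_of_pos (div_pos hM0 (by linarith : (0 : ℝ) < M'))
  rw [Real.log_div hM0.ne' (by linarith), inv_div] at h2
  refine le_trans ?_ (h2.trans (le_abs_self _))
  have hY0 : 0 < 2 * Y := by nlinarith
  rw [div_le_iff₀ (Real.sqrt_pos.2 hY0)]
  rcases le_total (M : ℝ) (2 * M') with h | h
  · have h3 : (M : ℝ) ≤ √(2 * Y) := Real.le_sqrt_of_sq_le (by nlinarith)
    have h4 : (1 : ℝ) / M ≤ 1 - M' / M := by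
      rw [div_le_iff₀ hM0, sub_mul, div_mul_cancel₀ _ hM0.ne']
      linarith
    have h5 : 0 ≤ 1 - (M' : ℝ) / M := le_trans (by positivity) h4
    calc (1 : ℝ) = 1 / M * M := by field_simp
      _ ≤ (1 - M' / M) * √(2 * Y) := by gcongr
  · have h3 : (2 : ℝ) ≤ √(2 * Y) := Real.le_sqrt_of_sq_le (by nlinarith)
    have h4 : (1 : ℝ) / 2 ≤ 1 - M' / M := by
      have : (M' : ℝ) / M ≤ 1 / 2 := by rw [div_le_iff₀ hM0]; linarith
      linarith
    calc (1 : ℝ) = 1 / 2 * 2 := by norm_num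
      _ ≤ (1 - M' / M) * √(2 * Y) := by gcongr

/-- A function whose Fourier transform, in angular frequency, vanishes beyond `R`. -/
def BandLimited (v : ℝ → ℝ) (R : ℝ) : Prop :=
  ∀ ν : ℝ, R < |ν| → ∫ x : ℝ, Complex.exp (Complex.I * (ν * x)) * (v x : ℂ) = 0

theorem bandLimited_of_hat_eq_zero {v : ℝ → ℝ} {B : ℝ} (hB : ∀ u, B < |u| → hat v u = 0) :
    BandLimited v (2 * Real.pi * B) := by
  intro ν hν
  rw [← hB (-ν / (2 * Real.pi)), hat_eq_integral]
  · refine integral_congr_ae (Eventually.of_forall fun x => ?_)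
    simp only
    rw [mul_comm]
    congr 2
    have hpi : (Real.pi : ℂ) ≠ 0 := by exact_mod_cast Real.pi_ne_zero
    push_cast
    field_simp
  · rw [abs_div, abs_neg, abs_of_pos Real.two_pi_pos, lt_div_iff₀ Real.two_pi_pos]
    linarith

theorem integrable_exp_mul {v : ℝ → ℝ} (hv : Integrable v) (ν : ℝ) :
    Integrable fun x : ℝ => Complex.exp (Complex.I * (ν * x)) * (v x : ℂ) := by
  refine Integrable.mono hv ?_ (Eventually.of_forall fun x => ?_)
  · exact (Continuous.aestronglyMeasurable (by fun_prop)).mul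
      (Complex.continuous_ofReal.comp_aestronglyMeasurable hv.aestronglyMeasurable)
  · rw [norm_mul, show Complex.I * ((ν : ℂ) * x) = ((ν * x : ℝ) : ℂ) * Complex.I by push_cast; ring,
      Complex.norm_exp_ofReal_mul_I, one_mul, Complex.norm_real]

/-- Let M and M' be the products of the entries with sign + and sign -. The total frequency is log M
- log M' and the phase exponents are the differences of their factorisations. Both vanish when M =
M'; otherwise unique factorisation makes the exponents nonzero and the gap bound applies. -/
theorem exponents_eq_zero_or_le {N k : ℕ} {X : ℝ} (t : Fin k → Fin N × Bool)
    (ht : ∀ i, 1 ≤ ((t i).1 : ℕ) ∧ (((t i).1 : ℕ) : ℝ) ≤ X) :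
    ((fun q : Fin N => ∑ i, sgn (t i).2 * (((t i).1 : ℕ).factorization q : ℤ)) = 0 ∧
      ∑ i, (sgn (t i).2 : ℝ) * Real.log ((t i).1 : ℕ) = 0) ∨
    ((fun q : Fin N => ∑ i, sgn (t i).2 * (((t i).1 : ℕ).factorization q : ℤ)) ≠ 0 ∧
      1 / √(2 * X ^ k) ≤ |∑ i, (sgn (t i).2 : ℝ) * Real.log ((t i).1 : ℕ)|) := by
  set M : ℕ := ∏ i, if (t i).2 then ((t i).1 : ℕ) else 1 with hM
  set M' : ℕ := ∏ i, if (t i).2 then 1 else ((t i).1 : ℕ) with hM'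
  have hpos : ∀ i, ((t i).1 : ℕ) ≠ 0 := fun i => by have := (ht i).1; omega
  have hM0 : 0 < M := Finset.prod_pos fun i _ => by
    have := (ht i).1
    split_ifs <;> omega
  have hM0' : 0 < M' := Finset.prod_pos fun i _ => by
    have := (ht i).1
    split_ifs <;> omega
  have hlog : ∑ i, (sgn (t i).2 : ℝ) * Real.log ((t i).1 : ℕ) = Real.log M - Real.log M' := by
    rw [hM, hM', Nat.cast_prod, Nat.cast_prod, Real.log_prod, Real.log_prod, ← Finset.sum_sub_distrib]
    · refine Finset.sum_congr rfl fun i _ => ?_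
      cases (t i).2 <;> simp [sgn]
    · intro i _
      have := hpos i
      split_ifs <;> simp [this]
    · intro i _
      have := hpos i
      split_ifs <;> simp [this]
  have hfac : ∀ q : ℕ, ∑ i, sgn (t i).2 * (((t i).1 : ℕ).factorization q : ℤ) =
      (M.factorization q : ℤ) - M'.factorization q := by
    intro q
    rw [hM, hM', Nat.factorization_prod, Nat.factorization_prod, Finsupp.finsetSum_apply,
      Finsupp.finsetSum_apply, Nat.cast_sum, Nat.cast_sum, ← Finset.sum_sub_distrib]
    · refine Finset.sum_congr rfl fun i _ => ?_
      cases (t i).2 <;> simp [sgn]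
    · intro i _
      have := hpos i
      split_ifs <;> simp [this]
    · intro i _
      have := hpos i
      split_ifs <;> simp [this]
  have hprod : (M : ℝ) * M' ≤ X ^ k := by
    have h1 : M * M' = ∏ i, ((t i).1 : ℕ) := by
      rw [hM, hM', ← Finset.prod_mul_distrib]
      refine Finset.prod_congr rfl fun i _ => ?_
      split_ifs <;> simp
    have h2 : (M : ℝ) * M' = ∏ i, (((t i).1 : ℕ) : ℝ) := by exact_mod_cast h1
    rw [h2]
    refine (Finset.prod_le_prod (fun i _ => Nat.cast_nonneg _) fun i _ => (ht i).2).trans ?_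
    simp
  by_cases hMM : M = M'
  · left
    refine ⟨?_, by rw [hlog, hMM, sub_self]⟩
    funext q
    rw [hfac, hMM, sub_self, Pi.zero_apply]
  · right
    refine ⟨fun h0 => hMM ?_, by rw [hlog]; exact le_abs_log_sub_log hM0 hM0' hMM hprod⟩
    refine Nat.eq_of_factorization_eq hM0.ne' hM0'.ne' fun q => ?_
    -- The torus has phases only for indices below N. A larger q divides no entry, so nothing is
    -- lost.
    by_cases hq : q < N
    · have h1 := congrFun h0 ⟨q, hq⟩
      simp only [Pi.zero_apply] at h1
      rw [hfac] at h1
      omega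
    · have hz : ∀ i, ((t i).1 : ℕ).factorization q = 0 := fun i =>
        Nat.factorization_eq_zero_of_lt ((t i).1.2.trans_le (not_lt.1 hq))
      have h1 := hfac q
      rw [hM, hM', Nat.factorization_prod, Nat.factorization_prod, Finsupp.finsetSum_apply,
        Finsupp.finsetSum_apply]
      · have e1 : ∀ i, (if (t i).2 then ((t i).1 : ℕ) else 1).factorization q = 0 := fun i => by
          split_ifs <;> simp [hz i]
        have e2 : ∀ i, (if (t i).2 then 1 else ((t i).1 : ℕ)).factorization q = 0 := fun i => by
          split_ifs <;> simp [hz i]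
        simp [e1, e2]
      · intro i _
        have := hpos i
        split_ifs <;> simp [this]
      · intro i _
        have := hpos i
        split_ifs <;> simp [this]

/-- Moments of a trigonometric sum against a band-limited weight agree with those of the random
model, once the scale exceeds the reciprocal of the frequency gap. -/
theorem integral_trigSum_pow_mul {c : ℕ → ℝ} {N k : ℕ} {X : ℝ} (hX : 0 < X)
    (hc : ∀ n, c n ≠ 0 → 1 ≤ n ∧ (n : ℝ) ≤ X) {v : ℝ → ℝ} (hv : Integrable v) {B : ℝ}
    (hB : BandLimited v B) {H : ℝ} (hH0 : 0 < H) (hH : B * √(2 * X ^ k) < H) (T : ℝ) :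
    ∫ x, trigSum c N (T + H * x) ^ k * v x = (∫ θ, torusSum c N θ ^ k ∂(torus N)) * ∫ x, v x := by
  apply Complex.ofReal_injective
  rw [Complex.ofReal_mul, ← integral_complex_ofReal, ← integral_complex_ofReal, ← integral_complex_ofReal]
  set lam : (Fin k → Fin N × Bool) → ℝ := fun t => ∑ i, (sgn (t i).2 : ℝ) * Real.log ((t i).1 : ℕ) with hlam
  set C : (Fin k → Fin N × Bool) → ℂ := fun t => ∏ i, (c (t i).1 / 2 : ℂ) with hC
  have hL : ∀ x : ℝ, ((trigSum c N (T + H * x) ^ k * v x : ℝ) : ℂ) =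
      ∑ t, C t * Complex.exp (Complex.I * (T * lam t)) *
        (Complex.exp (Complex.I * ((H * lam t : ℝ) * x)) * (v x : ℂ)) := by
    intro x
    rw [Complex.ofReal_mul, Complex.ofReal_pow, trigSum, sum_mul_cos_pow, Finset.sum_mul]
    refine Finset.sum_congr rfl fun t _ => ?_
    rw [mul_assoc, mul_assoc, ← mul_assoc (Complex.exp _), ← Complex.exp_add]
    congr 3
    rw [hlam]
    push_cast
    simp only [Finset.mul_sum, Finset.sum_mul, ← Finset.sum_add_distrib]
    refine Finset.sum_congr rfl fun i _ => ?_
    ring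
  have hR : ∀ θ : Fin N → ℝ, ((torusSum c N θ ^ k : ℝ) : ℂ) =
      ∑ t, C t * Complex.exp (2 * Real.pi * Complex.I * ∑ q,
        ((fun q : Fin N => ∑ i, sgn (t i).2 * (((t i).1 : ℕ).factorization q : ℤ)) q : ℂ) * (θ q : ℂ)) := by
    intro θ
    rw [Complex.ofReal_pow, torusSum, sum_mul_cos_pow]
    refine Finset.sum_congr rfl fun t _ => ?_
    congr 2
    simp only [phase]
    push_cast
    simp only [Finset.mul_sum, Finset.sum_mul]
    rw [Finset.sum_comm]
    refine Finset.sum_congr rfl fun i _ => Finset.sum_congr rfl fun j _ => ?_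
    ring
  simp_rw [hL, hR]
  rw [integral_finsetSum _ fun t _ => (integrable_exp_mul hv _).const_mul _, integral_finsetSum, Finset.sum_mul]
  · refine Finset.sum_congr rfl fun t _ => ?_
    rw [integral_const_mul, integral_const_mul, integral_torus_exp]
    by_cases hct : C t = 0
    · rw [hct]; simp
    have ht : ∀ i, 1 ≤ ((t i).1 : ℕ) ∧ (((t i).1 : ℕ) : ℝ) ≤ X := fun i => hc _ fun h0 =>
      hct (Finset.prod_eq_zero (Finset.mem_univ i) (by rw [h0]; simp))
    -- Diagonal tuples contribute their coefficient times ∫ v on both sides. Off the diagonal the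
    -- torus integral vanishes, and so does the line integral, the dilated frequency H · λ being
    -- outside the band of v.
    rcases exponents_eq_zero_or_le t ht with ⟨h1, h2⟩ | ⟨h1, h2⟩
    · rw [if_pos h1]
      have : lam t = 0 := h2
      simp [this]
    · rw [if_neg h1, hB (H * lam t), mul_zero, mul_zero, zero_mul]
      rw [abs_mul, abs_of_pos hH0]
      have hY : 0 < √(2 * X ^ k) := by positivity
      have h3 : 1 ≤ |lam t| * √(2 * X ^ k) := by
        rw [← div_le_iff₀ hY]; exact h2
      by_contra hcon
      push Not at hcon
      have : H * (|lam t| * √(2 * X ^ k)) ≤ B * √(2 * X ^ k) := by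
        rw [← mul_assoc]; gcongr
      nlinarith
  · intro t _
    refine Integrable.const_mul ?_ _
    refine Integrable.mono' (integrable_const (1 : ℝ)) ?_ (Eventually.of_forall fun θ => ?_)
    · exact Continuous.aestronglyMeasurable (by fun_prop)
    · rw [Complex.norm_exp]
      refine le_of_eq ?_
      rw [Real.exp_eq_one_iff]
      have : (2 * Real.pi * Complex.I * ∑ q, (((fun q : Fin N => ∑ i, sgn (t i).2 *
        (((t i).1 : ℕ).factorization q : ℤ)) q : ℤ) : ℂ) * (θ q : ℂ)) =
        ((2 * Real.pi * ∑ q, (((fun q : Fin N => ∑ i, sgn (t i).2 *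
        (((t i).1 : ℕ).factorization q : ℤ)) q : ℤ) : ℝ) * θ q : ℝ) : ℂ) * Complex.I := by
        push_cast; ring
      rw [this]
      simp

end ZetaStatistics
end

/-! ### Moment generating functions and independence over the primes. -/

noncomputable section
namespace ZetaStatistics

open ArithmeticFunction (vonMangoldt)

/-- Moments are derivatives at 0 of the entire function E[e^(sX)], so Cauchy's estimate on the unit
circle applies to the difference. -/
theorem abs_moment_sub_le {Ω Ω' : Type*} {mΩ : MeasurableSpace Ω} {mΩ' : MeasurableSpace Ω'}
    {μ : Measure Ω} {μ' : Measure Ω'} {X : Ω → ℝ} {Y : Ω' → ℝ}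
    (hX : integrableExpSet X μ = Set.univ) (hY : integrableExpSet Y μ' = Set.univ) {ε : ℝ}
    (h : ∀ s : ℂ, ‖s‖ = 1 → ‖complexMGF X μ s - complexMGF Y μ' s‖ ≤ ε) (k : ℕ) :
    |∫ x, X x ^ k ∂μ - ∫ y, Y y ^ k ∂μ'| ≤ k.factorial * ε := by
  have hdX : Differentiable ℂ (complexMGF X μ) := fun z =>
    (analyticAt_complexMGF (by rw [hX, interior_univ]; trivial)).differentiableAt
  have hdY : Differentiable ℂ (complexMGF Y μ') := fun z =>
    (analyticAt_complexMGF (by rw [hY, interior_univ]; trivial)).differentiableAt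
  have h1 := Complex.norm_iteratedDeriv_le_of_forall_mem_sphere_norm_le (n := k) (c := 0) (R := 1)
    (C := ε) (f := complexMGF X μ - complexMGF Y μ') one_pos (hdX.sub hdY).diffContOnCl
    (fun z hz => h z (by simpa using hz))
  rw [iteratedDeriv_sub (hdX.contDiff.contDiffAt) (hdY.contDiff.contDiffAt),
    iteratedDeriv_complexMGF (by rw [hX, interior_univ]; trivial),
    iteratedDeriv_complexMGF (by rw [hY, interior_univ]; trivial)] at h1
  simp only [zero_mul, Complex.exp_zero, mul_one, one_pow, div_one] at h1
  have e1 : ∫ x, (X x : ℂ) ^ k ∂μ = ((∫ x, X x ^ k ∂μ : ℝ) : ℂ) := by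
    rw [← integral_complex_ofReal]; push_cast; rfl
  have e2 : ∫ x, (Y x : ℂ) ^ k ∂μ' = ((∫ x, Y x ^ k ∂μ' : ℝ) : ℂ) := by
    rw [← integral_complex_ofReal]; push_cast; rfl
  rw [e1, e2, ← Complex.ofReal_sub, Complex.norm_real, Real.norm_eq_abs] at h1
  exact h1

/-- A second-order Taylor expansion; the mean vanishes, so the error is cubic. It is put in relative
form so that the results for different primes can be multiplied. -/
theorem exists_integral_exp_eq {Ω : Type*} {mΩ : MeasurableSpace Ω} {μ : Measure Ω}
    [IsProbabilityMeasure μ] {Z : Ω → ℝ} (hZ : AEStronglyMeasurable Z μ) {δ : ℝ} (hδ : δ ≤ 1)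
    (hb : ∀ x, |Z x| ≤ δ) (h0 : ∫ x, Z x ∂μ = 0) {s : ℂ} (hs : ‖s‖ = 1) :
    ∃ f : ℂ, ‖f‖ ≤ 4 * δ ^ 3 ∧ ∫ x, Complex.exp (s * Z x) ∂μ =
      Complex.exp (s ^ 2 * ((∫ x, Z x ^ 2 ∂μ : ℝ) : ℂ) / 2) * (1 + f) := by
  obtain ⟨x₀⟩ : Nonempty Ω := by
    by_contra hne
    rw [not_nonempty_iff] at hne
    have := measure_univ (μ := μ)
    rw [Measure.eq_zero_of_isEmpty μ] at this
    simp at this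
  have hδ0 : 0 ≤ δ := (abs_nonneg _).trans (hb x₀)
  set v := ∫ x, Z x ^ 2 ∂μ with hv
  have hv0 : 0 ≤ v := integral_nonneg fun x => sq_nonneg _
  have hvle : v ≤ δ ^ 2 := by
    have h : v ≤ ∫ _, δ ^ 2 ∂μ := integral_mono_of_nonneg (Eventually.of_forall fun x => sq_nonneg _)
      (integrable_const _) (Eventually.of_forall fun x => sq_le_sq' (abs_le.1 (hb x)).1 (abs_le.1 (hb x)).2)
    simpa using h
  have hiZ : Integrable Z μ := Integrable.mono' (integrable_const δ) hZ (Eventually.of_forall hb)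
  have hiZ2 : Integrable (fun x => Z x ^ 2) μ := Integrable.mono' (integrable_const (δ ^ 2)) (hZ.pow 2)
    (Eventually.of_forall fun x => by
      rw [norm_pow]
      exact pow_le_pow_left₀ (norm_nonneg _) (hb x) 2)
  have hsz : ∀ x, ‖s * Z x‖ ≤ δ := fun x => by
    rw [norm_mul, hs, one_mul, Complex.norm_real]; exact hb x
  have hrem : ∀ x, ‖Complex.exp (s * Z x) - (1 + s * Z x + s ^ 2 / 2 * (Z x ^ 2 : ℝ))‖ ≤ δ ^ 3 := by
    intro x
    have h' := Complex.exp_bound ((hsz x).trans hδ) (n := 3) (by norm_num)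
    simp only [Finset.sum_range_succ, Finset.sum_range_zero, Nat.factorial] at h'
    norm_num at h'
    rw [show 1 + s * Z x + s ^ 2 / 2 * (Z x ^ 2 : ℝ) = 1 + s * Z x + (s * Z x) ^ 2 / 2 by push_cast; ring]
    refine h'.trans ?_
    have h3 := pow_le_pow_left₀ (norm_nonneg _) (hsz x) 3
    rw [norm_mul, Complex.norm_real, Real.norm_eq_abs] at h3
    have h4 : 0 ≤ (‖s‖ * |Z x|) ^ 3 := by positivity
    linarith
  have hiE : Integrable (fun x => Complex.exp (s * Z x)) μ := by
    refine Integrable.mono' (integrable_const (Real.exp δ)) ?_ (Eventually.of_forall fun x => ?_)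
    · exact Complex.continuous_exp.comp_aestronglyMeasurable
        ((Complex.continuous_ofReal.comp_aestronglyMeasurable hZ).const_mul s)
    · rw [Complex.norm_exp]
      exact Real.exp_le_exp.2 ((Complex.re_le_norm _).trans (hsz x))
  have hi0 : Integrable (fun x => s * (Z x : ℂ)) μ := hiZ.ofReal.const_mul s
  have hi1 : Integrable (fun x => 1 + s * Z x) μ := (integrable_const _).add (hiZ.ofReal.const_mul s)
  have hi2 : Integrable (fun x => s ^ 2 / 2 * ((Z x ^ 2 : ℝ) : ℂ)) μ := hiZ2.ofReal.const_mul _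
  have hiQ : Integrable (fun x => 1 + s * Z x + s ^ 2 / 2 * ((Z x ^ 2 : ℝ) : ℂ)) μ :=
    hi1.add hi2
  have hQ : ∫ x, (1 + s * Z x + s ^ 2 / 2 * ((Z x ^ 2 : ℝ) : ℂ)) ∂μ = 1 + s ^ 2 * v / 2 := by
    rw [integral_add hi1 hi2, integral_add (integrable_const (1 : ℂ)) (hi0 : Integrable (fun x => s * (Z x : ℂ)) μ), integral_const_mul, integral_const_mul,
      integral_complex_ofReal, integral_complex_ofReal, h0, ← hv]
    simp
    ring
  have h1 : ‖∫ x, Complex.exp (s * Z x) ∂μ - (1 + s ^ 2 * v / 2)‖ ≤ δ ^ 3 := by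
    rw [← hQ, ← integral_sub hiE hiQ]
    have := norm_integral_le_of_norm_le_const (μ := μ) (Eventually.of_forall hrem)
    simpa using this
  set w : ℂ := s ^ 2 * v / 2 with hw
  have hwn : ‖w‖ = v / 2 := by
    rw [hw, norm_div, norm_mul, norm_pow, hs, Complex.norm_real, Real.norm_of_nonneg hv0]
    norm_num
  have hδ2 : δ ^ 2 ≤ 1 := pow_le_one₀ hδ0 hδ
  have h2 : ‖Complex.exp w - 1 - w‖ ≤ δ ^ 3 := by
    refine (Complex.norm_exp_sub_one_sub_id_le (by rw [hwn]; linarith)).trans ?_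
    rw [hwn]
    have h4 : δ ^ 4 ≤ δ ^ 3 := pow_le_pow_of_le_one hδ0 hδ (by norm_num)
    nlinarith
  have h3 : ‖∫ x, Complex.exp (s * Z x) ∂μ - Complex.exp w‖ ≤ 2 * δ ^ 3 := by
    have : ∫ x, Complex.exp (s * Z x) ∂μ - Complex.exp w =
      (∫ x, Complex.exp (s * Z x) ∂μ - (1 + w)) - (Complex.exp w - 1 - w) := by ring
    rw [this]
    refine (norm_sub_le _ _).trans ?_
    linarith
  -- As |w| ≤ 1/2, dividing by e^w costs at most a factor 2; with the two Taylor errors of size δ³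
  -- this gives 4δ³.
  refine ⟨Complex.exp (-w) * (∫ x, Complex.exp (s * Z x) ∂μ - Complex.exp w), ?_, ?_⟩
  · have h5 : ‖Complex.exp (-w)‖ ≤ 2 := by
      rw [Complex.norm_exp]
      have h6 : (-w).re ≤ 1 / 2 := by
        refine (Complex.re_le_norm _).trans ?_
        rw [norm_neg, hwn]
        linarith
      have h7 : Real.exp (1 / 2) ≤ 2 := by
        have := Real.exp_one_lt_d9
        have h8 : Real.exp (1 / 2) * Real.exp (1 / 2) = Real.exp 1 := by rw [← Real.exp_add]; norm_num
        nlinarith [Real.exp_pos (1 / 2)]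
      exact (Real.exp_le_exp.2 h6).trans h7
    rw [norm_mul]
    calc _ ≤ 2 * (2 * δ ^ 3) := by gcongr
      _ = _ := by ring
  · rw [mul_add, ← mul_assoc, ← Complex.exp_add]
    simp

theorem exists_prod_integral_exp_eq {ι : Type*} (S : Finset ι) (Z : ι → ℝ → ℝ) {μ : Measure ℝ}
    [IsProbabilityMeasure μ] (hZ : ∀ i, AEStronglyMeasurable (Z i) μ) {δ : ι → ℝ} (hδ : ∀ i, δ i ≤ 1)
    (hb : ∀ i x, |Z i x| ≤ δ i) (h0 : ∀ i, ∫ x, Z i x ∂μ = 0) {s : ℂ} (hs : ‖s‖ = 1) :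
    ∃ f : ℂ, ‖f‖ ≤ Real.exp (4 * ∑ i ∈ S, δ i ^ 3) - 1 ∧ ∏ i ∈ S, ∫ x, Complex.exp (s * Z i x) ∂μ =
      Complex.exp (s ^ 2 * ((∑ i ∈ S, ∫ x, Z i x ^ 2 ∂μ : ℝ) : ℂ) / 2) * (1 + f) := by
  choose f hf he using fun i => exists_integral_exp_eq (hZ i) (hδ i) (hb i) (h0 i) hs
  refine ⟨∏ i ∈ S, (1 + f i) - 1, ?_, ?_⟩
  · refine (Finset.norm_prod_one_add_sub_one_le S f).trans ?_
    gcongr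
    rw [Finset.mul_sum]
    exact Finset.sum_le_sum fun i _ => hf i
  · rw [Finset.prod_congr rfl fun i _ => he i, Finset.prod_mul_distrib, ← Complex.exp_sum]
    rw [add_sub_cancel]
    congr 2
    push_cast
    rw [Finset.mul_sum, Finset.sum_div]

theorem integral_unif_cos (j : ℤ) : ∫ x, Real.cos (2 * Real.pi * (j * x)) ∂unif = if j = 0 then 1 else 0 := by
  have h := congrArg Complex.re (integral_unif_exp j)
  have hi : Integrable (fun x : ℝ => Complex.exp (2 * Real.pi * Complex.I * j * x)) unif := by
    refine Integrable.mono' (integrable_const (1 : ℝ)) (Continuous.aestronglyMeasurable (by fun_prop))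
      (Eventually.of_forall fun x => ?_)
    rw [show (2 * Real.pi * Complex.I * j * x : ℂ) = ((2 * Real.pi * (j * x) : ℝ) : ℂ) * Complex.I by
      push_cast; ring, Complex.norm_exp_ofReal_mul_I]
  have h2 := integral_re hi
  simp only [RCLike.re_eq_complex_re] at h2
  rw [← h2] at h
  have e : ∀ x : ℝ, (Complex.exp (2 * Real.pi * Complex.I * j * x)).re = Real.cos (2 * Real.pi * (j * x)) := by
    intro x
    rw [show (2 * Real.pi * Complex.I * j * x : ℂ) = ((2 * Real.pi * (j * x) : ℝ) : ℂ) * Complex.I by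
      push_cast; ring, Complex.exp_ofReal_mul_I_re]
  simp_rw [e] at h
  rw [h]
  split_ifs <;> simp

theorem integral_unif_cos_mul_cos {j l : ℕ} (hj : 1 ≤ j) :
    ∫ x, Real.cos (2 * Real.pi * (j * x)) * Real.cos (2 * Real.pi * (l * x)) ∂unif =
      if j = l then 1 / 2 else 0 := by
  have hi : ∀ k : ℤ, Integrable (fun x : ℝ => Real.cos (2 * Real.pi * (k * x))) unif := fun k => by
    refine Integrable.mono' (integrable_const (1 : ℝ)) (Continuous.aestronglyMeasurable (by fun_prop))
      (Eventually.of_forall fun x => Real.abs_cos_le_one _)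
  have e : ∀ x : ℝ, Real.cos (2 * Real.pi * (j * x)) * Real.cos (2 * Real.pi * (l * x)) =
      1 / 2 * Real.cos (2 * Real.pi * (((j - l : ℤ) : ℝ) * x)) +
        1 / 2 * Real.cos (2 * Real.pi * (((j + l : ℤ) : ℝ) * x)) := by
    intro x
    push_cast
    rw [show 2 * Real.pi * (((j : ℝ) - l) * x) = 2 * Real.pi * (j * x) - 2 * Real.pi * (l * x) by ring,
      show 2 * Real.pi * (((j : ℝ) + l) * x) = 2 * Real.pi * (j * x) + 2 * Real.pi * (l * x) by ring,
      Real.cos_sub, Real.cos_add]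
    ring
  simp_rw [e]
  rw [integral_add ((hi _).const_mul _) ((hi _).const_mul _), integral_const_mul, integral_const_mul,
    integral_unif_cos, integral_unif_cos]
  by_cases h : j = l
  · subst h
    rw [if_pos (by ring), if_neg (by omega), if_pos rfl]
    ring
  · rw [if_neg (by omega), if_neg (by omega), if_neg h]
    ring

/-- The part of the random model that depends on the phase of `q`. -/
def primePart (d : ℕ → ℝ) (N q : ℕ) (x : ℝ) : ℝ :=
  ∑ n ∈ (Finset.range N).filter (fun n => IsPrimePow n ∧ n.minFac = q),
    d n * Real.cos (2 * Real.pi * ((n.factorization q : ℕ) * x))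

theorem continuous_primePart (d : ℕ → ℝ) (N q : ℕ) : Continuous (primePart d N q) := by
  unfold primePart
  fun_prop

theorem one_le_factorization_of_minFac {n q : ℕ} (hn : IsPrimePow n) (hq : n.minFac = q) :
    1 ≤ n.factorization q := by
  have h1 : n ≠ 1 := hn.ne_one
  have hp : q.Prime := hq ▸ Nat.minFac_prime h1
  exact hp.factorization_pos_of_dvd hn.ne_zero (hq ▸ n.minFac_dvd)

theorem eq_pow_factorization_of_minFac {n q : ℕ} (hn : IsPrimePow n) (hq : n.minFac = q) :
    n = q ^ n.factorization q := by
  have := hn.minFac_pow_factorization_eq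
  rw [hq] at this
  exact this.symm

theorem integral_primePart (d : ℕ → ℝ) (N q : ℕ) : ∫ x, primePart d N q x ∂unif = 0 := by
  unfold primePart
  rw [integral_finsetSum]
  · refine Finset.sum_eq_zero fun n hn => ?_
    rw [Finset.mem_filter] at hn
    have := one_le_factorization_of_minFac hn.2.1 hn.2.2
    have h := integral_unif_cos (n.factorization q)
    rw [if_neg (by omega)] at h
    rw [integral_const_mul]
    push_cast at h
    rw [h, mul_zero]
  · intro n _
    refine Integrable.const_mul (Integrable.mono' (integrable_const (1 : ℝ))
      (Continuous.aestronglyMeasurable (by fun_prop)) (Eventually.of_forall fun x => Real.abs_cos_le_one _)) _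

/-- Distinct powers of q have distinct exponents, so the cosines in one prime part are orthogonal,
each with mean square 1/2. -/
theorem integral_primePart_sq (d : ℕ → ℝ) (N q : ℕ) : ∫ x, primePart d N q x ^ 2 ∂unif =
    ∑ n ∈ (Finset.range N).filter (fun n => IsPrimePow n ∧ n.minFac = q), d n ^ 2 / 2 := by
  set F := (Finset.range N).filter (fun n => IsPrimePow n ∧ n.minFac = q) with hF
  have e : ∀ x, primePart d N q x ^ 2 = ∑ n ∈ F, ∑ l ∈ F, d n * d l *
      (Real.cos (2 * Real.pi * ((n.factorization q : ℕ) * x)) *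
        Real.cos (2 * Real.pi * ((l.factorization q : ℕ) * x))) := fun x => by
    rw [sq, primePart, Finset.sum_mul_sum]
    refine Finset.sum_congr rfl fun n _ => Finset.sum_congr rfl fun l _ => ?_
    ring
  have hi : ∀ n l : ℕ, Integrable (fun x : ℝ => d n * d l *
      (Real.cos (2 * Real.pi * ((n.factorization q : ℕ) * x)) *
        Real.cos (2 * Real.pi * ((l.factorization q : ℕ) * x)))) unif := fun n l => by
    refine Integrable.const_mul (Integrable.mono' (integrable_const (1 : ℝ))
      (Continuous.aestronglyMeasurable (by fun_prop)) (Eventually.of_forall fun x => ?_)) _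
    rw [norm_mul]
    exact mul_le_one₀ (Real.abs_cos_le_one _) (norm_nonneg _) (Real.abs_cos_le_one _)
  simp_rw [e]
  rw [integral_finsetSum _ fun n _ => integrable_finsetSum _ fun l _ => hi n l]
  refine Finset.sum_congr rfl fun n hn => ?_
  rw [integral_finsetSum _ fun l _ => hi n l]
  have hn' := (Finset.mem_filter.1 hn).2
  rw [Finset.sum_eq_single n]
  · rw [integral_const_mul, integral_unif_cos_mul_cos (one_le_factorization_of_minFac hn'.1 hn'.2), if_pos rfl]
    ring
  · intro l hl hne
    have hl' := (Finset.mem_filter.1 hl).2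
    rw [integral_const_mul, integral_unif_cos_mul_cos (one_le_factorization_of_minFac hn'.1 hn'.2), if_neg,
      mul_zero]
    intro heq
    apply hne
    rw [eq_pow_factorization_of_minFac hl'.1 hl'.2, eq_pow_factorization_of_minFac hn'.1 hn'.2, heq]
  · exact fun h => absurd hn h

theorem phase_of_isPrimePow {N n q : ℕ} (hn : IsPrimePow n) (hq : n.minFac = q) (hqN : q < N)
    (θ : Fin N → ℝ) : phase n θ = 2 * Real.pi * ((n.factorization q : ℕ) * θ ⟨q, hqN⟩) := by
  rw [phase, Finset.sum_eq_single ⟨q, hqN⟩]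
  · intro r _ hr
    have h1 : n.factorization r = 0 := by
      rw [eq_pow_factorization_of_minFac hn hq]
      have hp : q.Prime := hq ▸ Nat.minFac_prime hn.ne_one
      rw [hp.factorization_pow, Finsupp.single_apply, if_neg]
      intro h
      exact hr (Fin.ext h.symm)
    rw [h1, Nat.cast_zero, zero_mul]
  · exact fun h => absurd (Finset.mem_univ _) h

/-- A prime power involves the phase of a single prime, so grouping by smallest prime factor yields
functions of separate coordinates, hence independent summands. -/
theorem torusSum_eq_sum_primePart {d : ℕ → ℝ} (hd : ∀ n, d n ≠ 0 → IsPrimePow n) (N : ℕ) (θ : Fin N → ℝ) :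
    torusSum d N θ = ∑ q : Fin N, primePart d N q (θ q) := by
  have h1 : torusSum d N θ = ∑ n ∈ (Finset.range N).filter IsPrimePow, d n * Real.cos (phase n θ) := by
    rw [torusSum, Finset.sum_filter_of_ne]
    intro n _ hne
    exact hd n (left_ne_zero_of_mul hne)
  have hmaps : ∀ n ∈ (Finset.range N).filter IsPrimePow, n.minFac ∈ Finset.range N := fun n hn => by
    rw [Finset.mem_filter, Finset.mem_range] at hn
    exact Finset.mem_range.2 ((Nat.minFac_le hn.2.pos).trans_lt hn.1)
  rw [h1, ← Finset.sum_fiberwise_of_maps_to hmaps, Finset.sum_range]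
  refine Finset.sum_congr rfl fun q _ => ?_
  rw [primePart, Finset.filter_filter]
  refine Finset.sum_congr rfl fun n hn => ?_
  have := (Finset.mem_filter.1 hn).2
  rw [phase_of_isPrimePow this.1 this.2 q.2]

theorem sum_integral_primePart_sq {d : ℕ → ℝ} (hd : ∀ n, d n ≠ 0 → IsPrimePow n) (N : ℕ) :
    ∑ q : Fin N, ∫ x, primePart d N q x ^ 2 ∂unif = ∑ n ∈ Finset.range N, d n ^ 2 / 2 := by
  have h1 : ∑ n ∈ Finset.range N, d n ^ 2 / 2 = ∑ n ∈ (Finset.range N).filter IsPrimePow, d n ^ 2 / 2 := by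
    rw [Finset.sum_filter_of_ne]
    intro n _ hne
    exact hd n fun h => hne (by rw [h]; simp)
  have hmaps : ∀ n ∈ (Finset.range N).filter IsPrimePow, n.minFac ∈ Finset.range N := fun n hn => by
    rw [Finset.mem_filter, Finset.mem_range] at hn
    exact Finset.mem_range.2 ((Nat.minFac_le hn.2.pos).trans_lt hn.1)
  rw [h1, ← Finset.sum_fiberwise_of_maps_to hmaps, Finset.sum_range]
  refine Finset.sum_congr rfl fun q _ => ?_
  rw [integral_primePart_sq, Finset.filter_filter]

theorem integral_exp_torusSum {d : ℕ → ℝ} (hd : ∀ n, d n ≠ 0 → IsPrimePow n) (N : ℕ) (s : ℂ) :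
    ∫ θ, Complex.exp (s * (torusSum d N θ : ℂ)) ∂(torus N) =
      ∏ q : Fin N, ∫ x, Complex.exp (s * (primePart d N q x : ℂ)) ∂unif := by
  rw [torus, ← integral_fintype_prod_eq_prod (f := fun (q : Fin N) (x : ℝ) =>
    Complex.exp (s * (primePart d N q x : ℂ)))]
  congr 1 with θ
  rw [torusSum_eq_sum_primePart hd, ← Complex.exp_sum, Complex.ofReal_sum, Finset.mul_sum]

/-- A geometric series of ratio 1/√q ≤ 3/4, whose sum is at most 4; the bound on the ratio holds
already for q = 2. -/
theorem sum_vonMangoldt_div_sqrt_le (N : ℕ) {q : ℕ} (hq : q.Prime) :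
    ∑ n ∈ (Finset.range N).filter (fun n => IsPrimePow n ∧ n.minFac = q), vonMangoldt n / √n ≤
      4 * (Real.log q / √q) := by
  have hq2 : (2 : ℝ) ≤ q := by exact_mod_cast hq.two_le
  have hq0 : (0 : ℝ) < √q := Real.sqrt_pos.2 (by linarith)
  have hlog : 0 ≤ Real.log q := Real.log_natCast_nonneg q
  have h43 : (4 : ℝ) / 3 ≤ √q := Real.le_sqrt_of_sq_le (by norm_num; linarith)
  have hsub : (Finset.range N).filter (fun n => IsPrimePow n ∧ n.minFac = q) ⊆
      (Finset.range N).image fun j => q ^ (j + 1) := by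
    intro n hn
    rw [Finset.mem_filter, Finset.mem_range] at hn
    have h1 := one_le_factorization_of_minFac hn.2.1 hn.2.2
    have h2 := eq_pow_factorization_of_minFac hn.2.1 hn.2.2
    refine Finset.mem_image.2 ⟨n.factorization q - 1, ?_, ?_⟩
    · rw [Finset.mem_range]
      have := Nat.factorization_lt q hn.2.1.ne_zero
      omega
    · rw [Nat.sub_add_cancel h1, ← h2]
  refine (Finset.sum_le_sum_of_subset_of_nonneg hsub fun n _ _ =>
    div_nonneg ArithmeticFunction.vonMangoldt_nonneg (Real.sqrt_nonneg _)).trans ?_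
  rw [Finset.sum_image fun i _ j _ h => by
    have := Nat.pow_right_injective hq.two_le h
    omega]
  have hr0 : 0 ≤ (√q)⁻¹ := by positivity
  have hr1 : (√q)⁻¹ ≤ 3 / 4 := by
    rw [inv_le_comm₀ hq0 (by norm_num)]
    norm_num
    exact h43
  have hterm : ∀ j ∈ Finset.range N, vonMangoldt (q ^ (j + 1)) / √((q ^ (j + 1) : ℕ) : ℝ) =
      Real.log q / √q * (√q)⁻¹ ^ j := by
    intro j _
    rw [ArithmeticFunction.vonMangoldt_apply_pow (Nat.succ_ne_zero j),
      ArithmeticFunction.vonMangoldt_apply_prime hq]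
    push_cast
    have e : √((q : ℝ) ^ (j + 1)) = √q ^ (j + 1) := by
      rw [Real.sqrt_eq_iff_mul_self_eq (by positivity) (by positivity), ← mul_pow,
        Real.mul_self_sqrt (by linarith)]
    rw [e, pow_succ, inv_pow]
    field_simp
  rw [Finset.sum_congr rfl hterm, ← Finset.mul_sum, mul_comm]
  have hgeom : ∑ j ∈ Finset.range N, (√q)⁻¹ ^ j ≤ 4 := by
    have h1 : (√q)⁻¹ < 1 := by linarith
    refine ((summable_geometric_of_lt_one hr0 h1).sum_le_tsum _ fun _ _ => pow_nonneg hr0 _).trans ?_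
    rw [tsum_geometric_of_lt_one hr0 h1, inv_le_comm₀ (by linarith) (by norm_num)]
    linarith
  gcongr

end ZetaStatistics
end

/-! ### Gaussian limit of the random model. -/

noncomputable section
namespace ZetaStatistics

open ArithmeticFunction (vonMangoldt)

/-- The coefficients of `primeSum` as a trigonometric sum. -/
def primeCoeff (φ : ℝ → ℝ) (L : ℝ) (n : ℕ) : ℝ := -(2 / L * (vonMangoldt n / √n * φ (Real.log n / L)))

/-- The coefficients of `φ 0 + primeSum` as a trigonometric sum. -/
def coeff (φ : ℝ → ℝ) (L : ℝ) (n : ℕ) : ℝ := (if n = 1 then φ 0 else 0) + primeCoeff φ L n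

/-- A bound for the prime powers that contribute at the scale `L`. -/
def cutoff (b L : ℝ) : ℕ := ⌊Real.exp (b * L)⌋₊ + 2

theorem exp_lt_cutoff (b L : ℝ) : Real.exp (b * L) < cutoff b L := by
  have := Nat.lt_floor_add_one (Real.exp (b * L))
  rw [cutoff]
  push_cast
  linarith

theorem two_le_cutoff (b L : ℝ) : 2 ≤ cutoff b L := by rw [cutoff]; omega

theorem cutoff_le {b L : ℝ} (h : 0 ≤ b * L) : (cutoff b L : ℝ) ≤ 3 * Real.exp (b * L) := by
  have h1 := Nat.floor_le (Real.exp_pos (b * L)).le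
  have h2 := Real.one_le_exp h
  rw [cutoff]
  push_cast
  linarith

theorem log_cutoff_le {b L : ℝ} (hb : 0 ≤ b) (hL : 1 ≤ L) : Real.log (cutoff b L) ≤ (b + 2) * L := by
  have h0 : 0 ≤ b * L := by positivity
  have h1 : (0 : ℝ) < cutoff b L := (Real.exp_pos _).trans (exp_lt_cutoff b L)
  have h2 := Real.log_le_log h1 (cutoff_le h0)
  rw [Real.log_mul (by norm_num) (Real.exp_pos _).ne', Real.log_exp] at h2
  have h3 : Real.log 3 ≤ 2 := by linarith [Real.log_le_sub_one_of_pos (by norm_num : (0 : ℝ) < 3)]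
  linarith

/-- The constant φ(0) sits at n = 1, whose frequency log 1 is 0; `2 ≤ N` keeps that index in range.
-/
theorem trigSum_coeff (φ : ℝ → ℝ) (L : ℝ) {N : ℕ} (hN : 2 ≤ N) (τ : ℝ) :
    trigSum (coeff φ L) N τ = φ 0 + primeSum φ L N τ := by
  simp only [trigSum, coeff, add_mul, Finset.sum_add_distrib, ite_mul, zero_mul]
  rw [Finset.sum_ite_eq' (Finset.range N) 1, if_pos (Finset.mem_range.2 (by omega)), primeSum,
    ← Finset.sum_neg_distrib]
  congr 1
  · simp
  · refine Finset.sum_congr rfl fun n _ => ?_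
    rw [primeCoeff, modulated]
    ring

theorem torusSum_coeff (φ : ℝ → ℝ) (L : ℝ) {N : ℕ} (hN : 2 ≤ N) (θ : Fin N → ℝ) :
    torusSum (coeff φ L) N θ = φ 0 + torusSum (primeCoeff φ L) N θ := by
  simp only [torusSum, coeff, add_mul, Finset.sum_add_distrib, ite_mul, zero_mul]
  rw [Finset.sum_ite_eq' (Finset.range N) 1, if_pos (Finset.mem_range.2 (by omega))]
  congr 1
  simp [phase]

theorem isPrimePow_of_primeCoeff_ne_zero {φ : ℝ → ℝ} {L : ℝ} {n : ℕ} (h : primeCoeff φ L n ≠ 0) :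
    IsPrimePow n := by
  rw [← ArithmeticFunction.vonMangoldt_ne_zero_iff]
  intro h0
  apply h
  rw [primeCoeff, h0]
  simp

theorem le_exp_of_coeff_ne_zero {φ : ℝ → ℝ} {b L : ℝ} (hb0 : 0 ≤ b) (hb : ∀ u, b < |u| → φ u = 0)
    (hL : 0 < L) {n : ℕ} (h : coeff φ L n ≠ 0) : 1 ≤ n ∧ (n : ℝ) ≤ Real.exp (b * L) := by
  by_cases h1 : n = 1
  · subst h1
    refine ⟨le_rfl, ?_⟩
    rw [Nat.cast_one]
    exact Real.one_le_exp (by positivity)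
  · rw [coeff, if_neg h1, zero_add] at h
    have hn := (isPrimePow_of_primeCoeff_ne_zero h).pos
    refine ⟨hn, ?_⟩
    by_contra hcon
    push Not at hcon
    apply h
    have h2 : b * L < Real.log n := (Real.lt_log_iff_exp_lt (by exact_mod_cast hn)).2 hcon
    rw [primeCoeff, hb, mul_zero, mul_zero, neg_zero]
    refine lt_of_lt_of_le ?_ (le_abs_self _)
    rwa [lt_div_iff₀ hL]

theorem abs_primeCoeff_le {φ : ℝ → ℝ} {K : ℝ} (hK : ∀ u, |φ u| ≤ K) {L : ℝ} (hL : 0 < L) (n : ℕ) :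
    |primeCoeff φ L n| ≤ 2 * K / L * (vonMangoldt n / √n) := by
  have h0 : 0 ≤ vonMangoldt n / √n :=
    div_nonneg ArithmeticFunction.vonMangoldt_nonneg (Real.sqrt_nonneg _)
  rw [primeCoeff, abs_neg, abs_mul, abs_mul, abs_of_nonneg h0, abs_of_pos (by positivity)]
  calc _ ≤ 2 / L * (vonMangoldt n / √n * K) := by gcongr; exact hK _
    _ = _ := by ring

theorem abs_primePart_le {φ : ℝ → ℝ} {K : ℝ} (hK : ∀ u, |φ u| ≤ K) {L : ℝ} (hL : 0 < L) (N q : ℕ) (x : ℝ) :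
    |primePart (primeCoeff φ L) N q x| ≤ if q.Prime then 8 * K / L * (Real.log q / √q) else 0 := by
  have hK0 : 0 ≤ K := (abs_nonneg _).trans (hK 0)
  split_ifs with hq
  · calc |primePart (primeCoeff φ L) N q x| ≤
        ∑ n ∈ (Finset.range N).filter (fun n => IsPrimePow n ∧ n.minFac = q),
          2 * K / L * (vonMangoldt n / √n) := by
          refine (Finset.abs_sum_le_sum_abs _ _).trans (Finset.sum_le_sum fun n _ => ?_)
          rw [abs_mul]
          exact (mul_le_of_le_one_right (abs_nonneg _) (Real.abs_cos_le_one _)).trans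
            (abs_primeCoeff_le hK hL n)
      _ ≤ 2 * K / L * (4 * (Real.log q / √q)) := by
          rw [← Finset.mul_sum]
          gcongr
          exact sum_vonMangoldt_div_sqrt_le N hq
      _ = _ := by ring
  · rw [primePart, Finset.sum_eq_zero, abs_zero]
    intro n hn
    have h := (Finset.mem_filter.1 hn).2
    exact absurd (h.2 ▸ Nat.minFac_prime h.1.ne_one) hq

/-- One factor log q is replaced by log N and Mertens' estimate does the rest. Only the order of
magnitude matters here; the exact variance comes from `exists_abs_sum_vonMangoldt_sq_sub_le`. -/
theorem exists_sum_log_sq_div_le : ∃ C : ℝ, 0 ≤ C ∧ ∀ N : ℕ, 2 ≤ N →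
    ∑ q ∈ Finset.range N, (if q.Prime then Real.log q ^ 2 / q else 0) ≤ Real.log N * (Real.log N + C) := by
  obtain ⟨C, hC, h⟩ := exists_abs_sum_vonMangoldt_div_sub_log_le
  refine ⟨C, hC, fun N hN => ?_⟩
  have h1 := (abs_le.1 (h N (by omega))).2
  have hlogN : 0 ≤ Real.log N := Real.log_natCast_nonneg N
  have hterm : ∀ n : ℕ, 0 ≤ vonMangoldt n / (n : ℝ) := fun n =>
    div_nonneg ArithmeticFunction.vonMangoldt_nonneg n.cast_nonneg
  have hsub : ∑ q ∈ Finset.range N, vonMangoldt q / q ≤ ∑ q ∈ Finset.Ioc 0 N, vonMangoldt q / q := by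
    rw [Finset.range_eq_Ico, ← Finset.add_sum_Ioo_eq_sum_Ico (by omega)]
    simp only [Nat.cast_zero, div_zero, zero_add]
    exact Finset.sum_le_sum_of_subset_of_nonneg (fun n hn => by
      rw [Finset.mem_Ioo] at hn
      exact Finset.mem_Ioc.2 ⟨hn.1, hn.2.le⟩) fun n _ _ => hterm n
  calc _ ≤ ∑ q ∈ Finset.range N, Real.log N * (vonMangoldt q / q) := by
        refine Finset.sum_le_sum fun q hq => ?_
        split_ifs with hp
        · rw [ArithmeticFunction.vonMangoldt_apply_prime hp, sq, mul_div_assoc]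
          have hlq : 0 ≤ Real.log q := Real.log_natCast_nonneg q
          gcongr
          · exact_mod_cast hp.pos
          · exact (Finset.mem_range.1 hq).le
        · exact mul_nonneg hlogN (hterm q)
    _ = Real.log N * ∑ q ∈ Finset.range N, vonMangoldt q / q := by rw [Finset.mul_sum]
    _ ≤ Real.log N * ∑ q ∈ Finset.Ioc 0 N, vonMangoldt q / q := by
        gcongr
    _ ≤ _ := by gcongr; linarith

theorem continuous_torusSum (c : ℕ → ℝ) (N : ℕ) : Continuous (torusSum c N) := by
  unfold torusSum phase
  fun_prop

theorem abs_torusSum_le (c : ℕ → ℝ) (N : ℕ) (θ : Fin N → ℝ) : |torusSum c N θ| ≤ ∑ n ∈ Finset.range N, |c n| := by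
  refine (Finset.abs_sum_le_sum_abs _ _).trans (Finset.sum_le_sum fun n _ => ?_)
  rw [abs_mul]
  exact mul_le_of_le_one_right (abs_nonneg _) (Real.abs_cos_le_one _)

theorem integrableExpSet_torusSum (c : ℕ → ℝ) (N : ℕ) :
    integrableExpSet (torusSum c N) (torus N) = Set.univ := by
  refine Set.eq_univ_of_forall fun t => ?_
  refine Integrable.mono' (integrable_const (Real.exp (|t| * ∑ n ∈ Finset.range N, |c n|))) ?_
    (Eventually.of_forall fun θ => ?_)
  · exact (Real.continuous_exp.comp (continuous_const.mul (continuous_torusSum c N))).aestronglyMeasurable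
  · rw [Real.norm_of_nonneg (Real.exp_pos _).le, Real.exp_le_exp]
    refine (le_abs_self _).trans ?_
    rw [abs_mul]
    gcongr
    exact abs_torusSum_le c N θ

/-- The part of the prime q is at most δ_q = O(log q / (L√q)). The δ_q are uniformly O(1/L) and the
sum of δ_q² is bounded, so the sum of δ_q³ is O(1/L): the product over primes is Gaussian up to a
relative error O(1/L). The variance is within O(1/L) of its limit. -/
theorem exists_norm_complexMGF_torusSum_sub_le {φ : ℝ → ℝ} (hφ : ContDiff ℝ ∞ φ) {b : ℝ} (hb0 : 0 ≤ b)
    (hb : ∀ u, b < |u| → φ u = 0) :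
    ∃ A : ℝ, ∃ L₀ : ℝ, 1 ≤ L₀ ∧ ∀ L : ℝ, L₀ ≤ L → ∀ s : ℂ, ‖s‖ = 1 →
      ‖complexMGF (torusSum (coeff φ L) (cutoff b L)) (torus (cutoff b L)) s -
        Complex.exp (s * φ 0 + s ^ 2 * ((∫ u in Set.Ioi 0, u * (2 * φ u ^ 2) : ℝ) : ℂ) / 2)‖ ≤
      Real.exp A * (Real.exp (A / L) - 1) := by
  have hc : HasCompactSupport φ := by
    refine HasCompactSupport.intro (isCompact_Icc (a := -b) (b := b)) fun x hx => hb x ?_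
    rw [Set.mem_Icc, ← abs_le] at hx
    exact not_le.1 hx
  obtain ⟨K, hK⟩ := hc.exists_bound_of_continuous hφ.continuous
  have hK0 : 0 ≤ K := (norm_nonneg _).trans (hK 0)
  obtain ⟨C₁, hC₁, h₁⟩ := exists_sum_log_sq_div_le
  have hφ2 : ContDiff ℝ 1 fun u => 2 * φ u ^ 2 :=
    (contDiff_const.mul (hφ.pow 2)).of_le (by exact_mod_cast le_top)
  obtain ⟨C₂, hC₂, h₂⟩ := exists_abs_sum_vonMangoldt_sq_sub_le hφ2 hb0 (fun u hu => by rw [hb u hu]; simp)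
  set V := ∫ u in Set.Ioi 0, u * (2 * φ u ^ 2) with hV
  have hV0 : 0 ≤ V := setIntegral_nonneg measurableSet_Ioi fun u hu => by
    have : (0 : ℝ) < u := hu
    positivity
  set C₃ := 64 * K ^ 2 * ((b + 2) * (b + 2 + C₁)) with hC₃
  have hC₃0 : 0 ≤ C₃ := by positivity
  -- One constant serves twice: |φ 0| + V/2 bounds the exponent of the Gaussian factor on |s| = 1,
  -- while 64KC₃ and C₂/2 come from the cubic errors and the variance error. Taking L ≥ 16K ensures
  -- δ ≤ 1, since log q / √q ≤ 2.
  refine ⟨|φ 0| + V / 2 + (64 * K * C₃ + C₂ / 2), max 1 (16 * K), le_max_left _ _, fun L hL s hs => ?_⟩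
  have hL1 : 1 ≤ L := (le_max_left _ _).trans hL
  have hLK : 16 * K ≤ L := (le_max_right _ _).trans hL
  have hL0 : 0 < L := by linarith
  set N := cutoff b L with hN
  have hN2 : 2 ≤ N := two_le_cutoff b L
  set δ : ℕ → ℝ := fun q => if q.Prime then 8 * K / L * (Real.log q / √q) else 0 with hδ
  have hδle : ∀ q, 0 ≤ δ q ∧ δ q ≤ 16 * K / L := by
    intro q
    simp only [hδ]
    split_ifs with hq
    · have hq0 : (0 : ℝ) < √q := Real.sqrt_pos.2 (by exact_mod_cast hq.pos)
      have hlq : 0 ≤ Real.log q := Real.log_natCast_nonneg q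
      have h3 : Real.log q / √q ≤ 2 := by
        rw [div_le_iff₀ hq0]
        have h4 := Real.log_le_sub_one_of_pos hq0
        rw [Real.log_sqrt q.cast_nonneg] at h4
        linarith
      refine ⟨by positivity, ?_⟩
      calc _ ≤ 8 * K / L * 2 := by gcongr
        _ = _ := by ring
    · exact ⟨le_rfl, by positivity⟩
  have hδ1 : ∀ q, δ q ≤ 1 := fun q => (hδle q).2.trans ((div_le_one hL0).2 hLK)
  have hsum2 : ∑ q : Fin N, δ q ^ 2 ≤ C₃ := by
    rw [← Finset.sum_range (fun q => δ q ^ 2)]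
    have e : ∀ q, δ q ^ 2 = 64 * K ^ 2 / L ^ 2 * (if q.Prime then Real.log q ^ 2 / q else 0) := by
      intro q
      simp only [hδ]
      split_ifs with hq
      · rw [mul_pow, div_pow, div_pow, Real.sq_sqrt q.cast_nonneg]
        ring
      · simp
    simp_rw [e]
    rw [← Finset.mul_sum]
    have h3 := h₁ N hN2
    have h4 := log_cutoff_le hb0 hL1
    rw [← hN] at h4
    have h5 : 0 ≤ Real.log N := Real.log_natCast_nonneg N
    calc _ ≤ 64 * K ^ 2 / L ^ 2 * (Real.log N * (Real.log N + C₁)) := by gcongr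
      _ ≤ 64 * K ^ 2 / L ^ 2 * (((b + 2) * L) * ((b + 2) * L + C₁ * L)) := by
          gcongr
          exact le_mul_of_one_le_right hC₁ hL1
      _ = C₃ := by rw [hC₃]; field_simp
  have hsum3 : ∑ q : Fin N, δ q ^ 3 ≤ 16 * K * C₃ / L := by
    calc _ ≤ ∑ q : Fin N, 16 * K / L * δ q ^ 2 := Finset.sum_le_sum fun q _ => by
          rw [pow_succ' (δ q) 2]
          exact mul_le_mul_of_nonneg_right (hδle q).2 (sq_nonneg _)
      _ = 16 * K / L * ∑ q : Fin N, δ q ^ 2 := by rw [Finset.mul_sum]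
      _ ≤ 16 * K / L * C₃ := by gcongr
      _ = _ := by ring
  have hd : ∀ n, primeCoeff φ L n ≠ 0 → IsPrimePow n := fun n h => isPrimePow_of_primeCoeff_ne_zero h
  obtain ⟨f, hf, hprod⟩ := exists_prod_integral_exp_eq Finset.univ
    (fun q : Fin N => primePart (primeCoeff φ L) N q) (μ := unif)
    (fun q => (continuous_primePart _ N q).aestronglyMeasurable) (δ := fun q : Fin N => δ q)
    (fun q => hδ1 q) (fun q x => abs_primePart_le hK hL0 N q x) (fun q => integral_primePart _ N q) hs
  rw [sum_integral_primePart_sq hd, ← integral_exp_torusSum hd] at hprod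
  set v := ∑ n ∈ Finset.range N, primeCoeff φ L n ^ 2 / 2 with hv
  have hvV : |v - V| ≤ C₂ / L := by
    have h3 := h₂ L hL0 N (by omega) (exp_lt_cutoff b L)
    convert h3 using 3
    rw [hv, Finset.mul_sum]
    refine Finset.sum_congr rfl fun n _ => ?_
    rw [primeCoeff, neg_sq, mul_pow, mul_pow, div_pow, div_pow, Real.sq_sqrt n.cast_nonneg]
    ring
  have hmgf : complexMGF (torusSum (coeff φ L) N) (torus N) s =
      Complex.exp (s * φ 0 + s ^ 2 * V / 2) * (Complex.exp (s ^ 2 * ((v - V : ℝ) : ℂ) / 2) * (1 + f)) := by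
    rw [complexMGF]
    have e : ∀ θ : Fin N → ℝ, Complex.exp (s * (torusSum (coeff φ L) N θ : ℂ)) =
        Complex.exp (s * φ 0) * Complex.exp (s * (torusSum (primeCoeff φ L) N θ : ℂ)) := fun θ => by
      rw [torusSum_coeff φ L hN2, ← Complex.exp_add]
      push_cast
      ring_nf
    simp_rw [e]
    rw [integral_const_mul, hprod, ← mul_assoc, ← mul_assoc, ← Complex.exp_add, ← Complex.exp_add]
    congr 2
    push_cast
    ring
  rw [hmgf, ← mul_sub_one, norm_mul]
  have hs2 : ‖s ^ 2‖ = 1 := by rw [norm_pow, hs, one_pow]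
  have n1 : ‖Complex.exp (s * φ 0 + s ^ 2 * V / 2)‖ ≤ Real.exp (|φ 0| + V / 2 + (64 * K * C₃ + C₂ / 2)) := by
    rw [Complex.norm_exp, Real.exp_le_exp]
    refine (Complex.re_le_norm _).trans ((norm_add_le _ _).trans ?_)
    rw [norm_mul, hs, one_mul, norm_div, norm_mul, hs2, one_mul, Complex.norm_real, Complex.norm_real,
      Real.norm_eq_abs, Real.norm_of_nonneg hV0]
    have : ‖(2 : ℂ)‖ = 2 := by simp
    rw [this]
    have : 0 ≤ 64 * K * C₃ + C₂ / 2 := by positivity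
    linarith
  have n2 : ‖Complex.exp (s ^ 2 * ((v - V : ℝ) : ℂ) / 2) - 1‖ ≤ Real.exp (C₂ / L / 2) - 1 := by
    have h1 := Complex.norm_exp_sub_sum_le_exp_norm_sub_sum (s ^ 2 * ((v - V : ℝ) : ℂ) / 2) 1
    simp only [Finset.sum_range_one, pow_zero, Nat.factorial_zero, Nat.cast_one, div_one] at h1
    refine h1.trans ?_
    have h2 : ‖(2 : ℂ)‖ = 2 := by simp
    rw [norm_div, norm_mul, hs2, one_mul, Complex.norm_real, h2, Real.norm_eq_abs]
    gcongr
  have n3 : ‖f‖ ≤ Real.exp (64 * K * C₃ / L) - 1 := by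
    refine hf.trans ?_
    gcongr
    calc _ ≤ 4 * (16 * K * C₃ / L) := by gcongr
      _ = _ := by ring
  have n4 : ‖Complex.exp (s ^ 2 * ((v - V : ℝ) : ℂ) / 2) * (1 + f) - 1‖ ≤
      Real.exp ((|φ 0| + V / 2 + (64 * K * C₃ + C₂ / 2)) / L) - 1 := by
    set g := Complex.exp (s ^ 2 * ((v - V : ℝ) : ℂ) / 2) - 1 with hg
    have e : Complex.exp (s ^ 2 * ((v - V : ℝ) : ℂ) / 2) * (1 + f) - 1 = g + f + g * f := by
      rw [hg]; ring
    rw [e]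
    have h3 : ‖g + f + g * f‖ ≤ ‖g‖ + ‖f‖ + ‖g‖ * ‖f‖ := by
      refine (norm_add_le _ _).trans ?_
      rw [norm_mul]
      gcongr
      exact norm_add_le _ _
    refine h3.trans ?_
    have h4 : (1 + ‖g‖) * (1 + ‖f‖) ≤ Real.exp (C₂ / L / 2) * Real.exp (64 * K * C₃ / L) := by
      gcongr <;> linarith
    rw [← Real.exp_add] at h4
    have h5 : C₂ / L / 2 + 64 * K * C₃ / L ≤ (|φ 0| + V / 2 + (64 * K * C₃ + C₂ / 2)) / L := by
      rw [le_div_iff₀ hL0]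
      have : (C₂ / L / 2 + 64 * K * C₃ / L) * L = C₂ / 2 + 64 * K * C₃ := by field_simp
      rw [this]
      have := abs_nonneg (φ 0)
      linarith
    have := Real.exp_le_exp.2 h5
    linarith
  gcongr

theorem tendsto_torusSum_moment {φ : ℝ → ℝ} (hφ : ContDiff ℝ ∞ φ) {b : ℝ} (hb0 : 0 ≤ b)
    (hb : ∀ u, b < |u| → φ u = 0) {v : NNReal} (hv : (v : ℝ) = ∫ u in Set.Ioi 0, u * (2 * φ u ^ 2)) (k : ℕ) :
    Tendsto (fun L => ∫ θ, torusSum (coeff φ L) (cutoff b L) θ ^ k ∂(torus (cutoff b L))) atTop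
      (𝓝 (∫ x, x ^ k ∂(gaussianReal (φ 0) v))) := by
  obtain ⟨A, L₀, hL₀, h⟩ := exists_norm_complexMGF_torusSum_sub_le hφ hb0 hb
  rw [tendsto_iff_norm_sub_tendsto_zero]
  have hlim : Tendsto (fun L : ℝ => (k.factorial : ℝ) * (Real.exp A * (Real.exp (A / L) - 1))) atTop (𝓝 0) := by
    have h1 : Tendsto (fun L : ℝ => Real.exp (A / L)) atTop (𝓝 (Real.exp 0)) :=
      (Real.continuous_exp.tendsto 0).comp (tendsto_const_nhds.div_atTop tendsto_id)
    have h2 := ((h1.sub_const 1).const_mul (Real.exp A)).const_mul (k.factorial : ℝ)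
    simpa using h2
  refine squeeze_zero' (Eventually.of_forall fun L => norm_nonneg _) ?_ hlim
  filter_upwards [eventually_ge_atTop L₀] with L hL
  rw [Real.norm_eq_abs]
  refine abs_moment_sub_le (Y := id) (integrableExpSet_torusSum _ _) integrableExpSet_id_gaussianReal
    (fun s hs => ?_) k
  rw [complexMGF_id_gaussianReal]
  convert h L hL s hs using 5
  rw [← hv]
  ring

end ZetaStatistics
end

/-! ### Band-limited weights and band-limited majorants. -/

noncomputable section
namespace ZetaStatistics

theorem BandLimited.mono {v : ℝ → ℝ} {R R' : ℝ} (h : BandLimited v R) (hR : R ≤ R') : BandLimited v R' :=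
  fun ν hν => h ν (hR.trans_lt hν)

/-- Multiplication by a cosine of frequency ρ shifts the spectrum by ±ρ, so the band widens by |ρ|.
-/
theorem BandLimited.integral_exp_mul_cos {w : ℝ → ℝ} (hw : Integrable w) {R : ℝ} (h : BandLimited w R)
    {ν ρ : ℝ} (α : ℝ) (hν : R + |ρ| < |ν|) :
    ∫ x : ℝ, Complex.exp (Complex.I * (ν * x)) * ((w x * Real.cos (ρ * x + α) : ℝ) : ℂ) = 0 := by
  have e : ∀ x : ℝ, Complex.exp (Complex.I * (ν * x)) * ((w x * Real.cos (ρ * x + α) : ℝ) : ℂ) =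
      Complex.exp (α * Complex.I) / 2 * (Complex.exp (Complex.I * ((ν + ρ : ℝ) * x)) * (w x : ℂ)) +
      Complex.exp (-α * Complex.I) / 2 * (Complex.exp (Complex.I * ((ν - ρ : ℝ) * x)) * (w x : ℂ)) := by
    intro x
    have e1 : Complex.exp (Complex.I * ((ν + ρ : ℝ) * x)) =
        Complex.exp (Complex.I * (ν * x)) * Complex.exp (Complex.I * (ρ * x)) := by
      rw [← Complex.exp_add]; push_cast; ring_nf
    have e2 : Complex.exp (Complex.I * ((ν - ρ : ℝ) * x)) =
        Complex.exp (Complex.I * (ν * x)) * Complex.exp (-(Complex.I * (ρ * x))) := by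
      rw [← Complex.exp_add]; push_cast; ring_nf
    have e3 : ((Real.cos (ρ * x + α) : ℝ) : ℂ) = (Complex.exp (α * Complex.I) * Complex.exp (Complex.I * (ρ * x)) +
        Complex.exp (-α * Complex.I) * Complex.exp (-(Complex.I * (ρ * x)))) / 2 := by
      rw [Complex.ofReal_cos, Complex.cos, ← Complex.exp_add, ← Complex.exp_add]
      push_cast
      ring_nf
    rw [e1, e2, Complex.ofReal_mul, e3]
    ring
  simp_rw [e]
  have h1 : R < |ν + ρ| := by
    have := abs_sub_abs_le_abs_sub ν (-ρ)
    rw [abs_neg, sub_neg_eq_add] at this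
    linarith
  have h2 : R < |ν - ρ| := by
    have := abs_sub_abs_le_abs_sub ν ρ
    linarith
  rw [integral_add ((integrable_exp_mul hw _).const_mul _) ((integrable_exp_mul hw _).const_mul _),
    integral_const_mul, integral_const_mul, h _ h1, h _ h2]
  simp

theorem BandLimited.integral_cos_mul {w : ℝ → ℝ} (hw : Integrable w) {R : ℝ} (h : BandLimited w R)
    {ν : ℝ} (α : ℝ) (hν : R < |ν|) : ∫ x : ℝ, w x * Real.cos (ν * x + α) = 0 := by
  have h1 : ∀ x : ℝ, w x * Real.cos (ν * x + α) =
      (Complex.exp (α * Complex.I) * (Complex.exp (Complex.I * (ν * x)) * (w x : ℂ))).re := by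
    intro x
    rw [← mul_assoc, ← Complex.exp_add, mul_comm _ (w x : ℂ), Complex.re_ofReal_mul,
      show (α * Complex.I + Complex.I * (ν * x) : ℂ) = ((ν * x + α : ℝ) : ℂ) * Complex.I by push_cast; ring,
      Complex.exp_ofReal_mul_I_re]
  simp_rw [h1]
  have h2 := integral_re ((integrable_exp_mul hw ν).const_mul (Complex.exp (α * Complex.I)))
  simp only [RCLike.re_eq_complex_re] at h2
  rw [h2, integral_const_mul, h ν hν]
  simp

theorem BandLimited.integral {w : ℝ → ℝ} {k : ℝ → ℝ → ℝ} {R : ℝ} {s : Set ℝ}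
    (hk : Integrable (fun p : ℝ × ℝ => w p.1 * k p.1 p.2) (volume.prod (volume.restrict s)))
    (hs : MeasurableSet s)
    (h : ∀ t ∈ s, BandLimited (fun x => w x * k x t) R) :
    BandLimited (fun x => w x * ∫ t in s, k x t) R := by
  intro ν hν
  have e : ∀ x : ℝ, Complex.exp (Complex.I * (ν * x)) * ((w x * ∫ t in s, k x t : ℝ) : ℂ) =
      ∫ t in s, Complex.exp (Complex.I * (ν * x)) * ((w x * k x t : ℝ) : ℂ) := by
    intro x
    rw [integral_const_mul, integral_complex_ofReal, integral_const_mul]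
  simp_rw [e]
  rw [integral_integral_swap]
  · rw [setIntegral_congr_fun hs fun t ht => h t ht ν hν]
    simp
  · refine Integrable.mono hk ?_ (Eventually.of_forall fun p => ?_)
    · exact (Continuous.aestronglyMeasurable (by fun_prop)).mul
        (Complex.continuous_ofReal.comp_aestronglyMeasurable hk.aestronglyMeasurable)
    · simp only [Function.uncurry]
      rw [norm_mul, show Complex.I * ((ν : ℂ) * p.1) = ((ν * p.1 : ℝ) : ℂ) * Complex.I by push_cast; ring,
        Complex.norm_exp_ofReal_mul_I, one_mul, Complex.norm_real]

theorem integral_integral_mul_logKernel_integrable {w : ℝ → ℝ} (hw : Integrable w)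
    (hl : Integrable fun x => w x * logKernel x) :
    Integrable (fun p : ℝ × ℝ => w p.1 * ((1 - Real.cos (p.1 * p.2)) / p.2))
      (volume.prod (volume.restrict (Set.Ioo (0 : ℝ) 1))) := by
  have hm : AEStronglyMeasurable (fun p : ℝ × ℝ => w p.1 * ((1 - Real.cos (p.1 * p.2)) / p.2))
      (volume.prod (volume.restrict (Set.Ioo (0 : ℝ) 1))) :=
    hw.aestronglyMeasurable.comp_fst.mul (Measurable.aestronglyMeasurable (by fun_prop))
  rw [integrable_prod_iff hm]
  refine ⟨Eventually.of_forall fun x => (integrableOn_logKernel x).const_mul (w x), ?_⟩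
  refine hl.norm.congr (Eventually.of_forall fun x => ?_)
  beta_reduce
  rw [norm_mul, Real.norm_of_nonneg (logKernel_nonneg x), logKernel, ← integral_const_mul]
  refine setIntegral_congr_fun measurableSet_Ioo fun t ht => ?_
  rw [norm_mul, Real.norm_of_nonneg (one_sub_cos_div_nonneg x ht.1)]

/-- `logKernel` is a superposition of cosines with frequencies below 1, hence the 1 in the new band.
-/
theorem bandLimited_mul_logKernel {w : ℝ → ℝ} (hw : Integrable w)
    (hl : Integrable fun x => w x * logKernel x) {R : ℝ} (h : BandLimited w R) :
    BandLimited (fun x => w x * logKernel x) (R + 1) := by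
  refine BandLimited.integral (integral_integral_mul_logKernel_integrable hw hl) measurableSet_Ioo
    fun t ht ν hν => ?_
  have e : ∀ x : ℝ, Complex.exp (Complex.I * (ν * x)) * ((w x * ((1 - Real.cos (x * t)) / t) : ℝ) : ℂ) =
      (1 / t : ℂ) * (Complex.exp (Complex.I * (ν * x)) * (w x : ℂ)) - (1 / t : ℂ) *
        (Complex.exp (Complex.I * (ν * x)) * ((w x * Real.cos (t * x + 0) : ℝ) : ℂ)) := by
    intro x
    rw [add_zero, mul_comm t x]
    push_cast
    ring
  have hwc : Integrable fun x => w x * Real.cos (t * x + 0) := by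
    refine Integrable.mono hw (hw.aestronglyMeasurable.mul (Continuous.aestronglyMeasurable (by fun_prop)))
      (Eventually.of_forall fun x => ?_)
    rw [norm_mul]
    exact mul_le_of_le_one_right (norm_nonneg _) (Real.abs_cos_le_one _)
  simp only
  simp_rw [e]
  rw [integral_sub ((integrable_exp_mul hw ν).const_mul _) ((integrable_exp_mul hwc ν).const_mul _),
    integral_const_mul, integral_const_mul, h ν (by linarith), h.integral_exp_mul_cos hw 0]
  · simp
  · rw [abs_of_pos ht.1]
    linarith [ht.2]

/-- The cosine transform of a function on the half-line. -/
def cosKernel (h : ℝ → ℝ) (y : ℝ) : ℝ := ∫ t in Set.Ioi (0 : ℝ), h t * Real.cos (t * y)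

theorem integrable_mul_cosKernel_prod {w : ℝ → ℝ} (hw : Integrable w) {h : ℝ → ℝ}
    (hh : IntegrableOn h (Set.Ioi 0)) (R s : ℝ) :
    Integrable (fun p : ℝ × ℝ => w p.1 * (h p.2 * Real.cos (p.2 * (R * (p.1 + s)))))
      (volume.prod (volume.restrict (Set.Ioi (0 : ℝ)))) := by
  have h1 := hw.mul_prod hh
  refine Integrable.mono h1 ?_ (Eventually.of_forall fun p => ?_)
  · have h2 := h1.aestronglyMeasurable.mul
      (Continuous.aestronglyMeasurable (f := fun p : ℝ × ℝ => Real.cos (p.2 * (R * (p.1 + s)))) (by fun_prop))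
    refine h2.congr (Eventually.of_forall fun p => ?_)
    simp only [Pi.mul_apply]
    ring
  · rw [← mul_assoc, norm_mul]
    exact mul_le_of_le_one_right (norm_nonneg _) (Real.abs_cos_le_one _)

theorem integrable_mul_cosKernel {w : ℝ → ℝ} (hw : Integrable w) {h : ℝ → ℝ}
    (hh : IntegrableOn h (Set.Ioi 0)) (R s : ℝ) : Integrable fun x => w x * cosKernel h (R * (x + s)) := by
  have h1 := (integrable_mul_cosKernel_prod hw hh R s).integral_prod_left
  refine h1.congr (Eventually.of_forall fun x => ?_)
  simp only
  rw [integral_const_mul, cosKernel]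

/-- Only frequencies tR ≤ B interact with w, so t runs over an interval of length B/R, each t
contributing at most 1. For kernels concentrated at scale 1/R this says that w puts mass O(1/R)
there, uniformly in the centre. -/
theorem abs_integral_mul_cosKernel_le {w : ℝ → ℝ} (hw : IsWeight w) {B : ℝ} (hB0 : 0 ≤ B)
    (hB : BandLimited w B) {h : ℝ → ℝ} (hh : IntegrableOn h (Set.Ioi 0))
    (h01 : ∀ t, 0 < t → 0 ≤ h t ∧ h t ≤ 1) {R : ℝ} (hR : 0 < R) (s : ℝ) :
    |∫ x, w x * cosKernel h (R * (x + s))| ≤ B / R := by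
  have e : ∀ x, w x * cosKernel h (R * (x + s)) =
      ∫ t in Set.Ioi (0 : ℝ), w x * (h t * Real.cos (t * (R * (x + s)))) := fun x => by
    rw [integral_const_mul, cosKernel]
  simp_rw [e]
  rw [integral_integral_swap (integrable_mul_cosKernel_prod hw.integrable hh R s)]
  have hin : ∀ t ∈ Set.Ioi (0 : ℝ), ‖∫ x, w x * (h t * Real.cos (t * (R * (x + s))))‖ ≤
      (Set.Ioc 0 (B / R)).indicator (fun _ => (1 : ℝ)) t := by
    intro t ht
    have ht0 : 0 < t := ht
    have e2 : ∀ x, w x * (h t * Real.cos (t * (R * (x + s)))) =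
        h t * (w x * Real.cos ((t * R) * x + t * R * s)) := fun x => by
      rw [show t * (R * (x + s)) = (t * R) * x + t * R * s by ring]
      ring
    simp_rw [e2]
    rw [integral_const_mul, norm_mul, Real.norm_of_nonneg (h01 t ht0).1]
    by_cases hc : t ≤ B / R
    · rw [Set.indicator_of_mem (Set.mem_Ioc.2 ⟨ht0, hc⟩)]
      refine mul_le_one₀ (h01 t ht0).2 (norm_nonneg _) ?_
      rw [← hw.integral_eq_one]
      refine norm_integral_le_of_norm_le hw.integrable (Eventually.of_forall fun x => ?_)
      rw [norm_mul, Real.norm_of_nonneg (hw.nonneg x)]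
      exact mul_le_of_le_one_right (hw.nonneg x) (Real.abs_cos_le_one _)
    · rw [hB.integral_cos_mul hw.integrable, norm_zero, mul_zero]
      · exact Set.indicator_nonneg (fun _ _ => zero_le_one) _
      · rw [abs_of_pos (mul_pos ht0 hR)]
        rw [not_le, div_lt_iff₀ hR] at hc
        exact hc
  have hint : IntegrableOn ((Set.Ioc 0 (B / R)).indicator (fun _ => (1 : ℝ))) (Set.Ioi 0) :=
    Integrable.integrableOn ((integrable_indicator_iff measurableSet_Ioc).2 (by simp))
  refine (norm_integral_le_of_norm_le hint
    ((ae_restrict_mem measurableSet_Ioi).mono fun t ht => hin t ht)).trans ?_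
  rw [setIntegral_indicator measurableSet_Ioc]
  have hset : Set.Ioi (0 : ℝ) ∩ Set.Ioc 0 (B / R) = Set.Ioc 0 (B / R) :=
    Set.inter_eq_right.2 fun x hx => hx.1
  rw [hset]
  simp [Measure.real, div_nonneg hB0 hR.le]

theorem cosKernel_exp_neg (y : ℝ) : cosKernel (fun t => Real.exp (-t)) y = 1 / (1 + y ^ 2) := by
  have h := integral_exp_mul_complex_Ioi (a := -1 + y * Complex.I) (by simp) 0
  have hi : IntegrableOn (fun t : ℝ => Complex.exp ((-1 + y * Complex.I) * t)) (Set.Ioi 0) :=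
    integrableOn_exp_mul_complex_Ioi (by simp) 0
  have h2 := integral_re hi
  simp only [RCLike.re_eq_complex_re] at h2
  rw [h] at h2
  rw [cosKernel]
  have e : ∀ t : ℝ, (Complex.exp ((-1 + y * Complex.I) * t)).re = Real.exp (-t) * Real.cos (t * y) := by
    intro t
    rw [Complex.exp_re]
    simp [mul_comm]
  simp_rw [e] at h2
  rw [h2]
  simp only [Complex.ofReal_zero, mul_zero, Complex.exp_zero]
  rw [Complex.div_re]
  simp [Complex.normSq_apply]
  ring

/-- The Fejér weight. -/
def tent (t : ℝ) : ℝ := max (1 - |t|) 0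

theorem continuous_tent : Continuous tent := by unfold tent; fun_prop

theorem tent_eq_zero {t : ℝ} (h : 1 ≤ |t|) : tent t = 0 := max_eq_right (by linarith)

theorem integrableOn_tent : IntegrableOn tent (Set.Ioi 0) := by
  refine (continuous_tent.integrable_of_hasCompactSupport ?_).integrableOn
  refine HasCompactSupport.intro (isCompact_Icc (a := -1) (b := 1)) fun x hx => tent_eq_zero ?_
  rw [Set.mem_Icc, ← abs_le] at hx
  exact (not_le.1 hx).le

theorem tent_mem {t : ℝ} (_ : 0 < t) : 0 ≤ tent t ∧ tent t ≤ 1 :=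
  ⟨le_max_right _ _, max_le (by linarith [abs_nonneg t]) zero_le_one⟩

theorem cosKernel_tent_eq_integral (y : ℝ) :
    cosKernel tent y = ∫ t in (0 : ℝ)..1, (1 - t) * Real.cos (t * y) := by
  rw [intervalIntegral.integral_of_le zero_le_one, cosKernel,
    setIntegral_eq_of_subset_of_forall_sdiff_eq_zero measurableSet_Ioi (s := Set.Ioc (0 : ℝ) 1) fun x hx => hx.1]
  · refine setIntegral_congr_fun measurableSet_Ioc fun t ht => ?_
    rw [tent, abs_of_pos ht.1, max_eq_left (by linarith [ht.2])]
  · intro x hx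
    have h1 : 1 < x := by
      by_contra hc
      exact hx.2 ⟨hx.1, not_lt.1 hc⟩
    rw [tent_eq_zero (h1.le.trans (le_abs_self x)), zero_mul]

theorem quarter_le_cosKernel_tent {y : ℝ} (hy : |y| ≤ 1) : 1 / 4 ≤ cosKernel tent y := by
  rw [cosKernel_tent_eq_integral]
  have h : ∫ t in (0 : ℝ)..1, (1 - t) * (1 / 2) = 1 / 4 := by
    rw [intervalIntegral.integral_mul_const, intervalIntegral.integral_sub (by simp) (by simp)]
    simp
    norm_num
  rw [← h]
  refine intervalIntegral.integral_mono_on zero_le_one (Continuous.intervalIntegrable (by fun_prop) _ _)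
    (Continuous.intervalIntegrable (by fun_prop) _ _) fun t ht => ?_
  have h1 := Real.one_sub_sq_div_two_le_cos (x := t * y)
  have h2 : (t * y) ^ 2 ≤ 1 := by
    rw [sq_le_one_iff_abs_le_one, abs_mul, abs_of_nonneg ht.1]
    exact mul_le_one₀ ht.2 (abs_nonneg y) hy
  have h3 : 0 ≤ 1 - t := by linarith [ht.2]
  gcongr
  linarith

/-- For |y| ≥ 1 the integral is evaluated as (1 - cos y)/y². With `quarter_le_cosKernel_tent`, four
times this kernel is a nonnegative band-limited majorant of the indicator of |y| ≤ 1. -/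
theorem cosKernel_tent_nonneg (y : ℝ) : 0 ≤ cosKernel tent y := by
  rcases le_total |y| 1 with hy | hy
  · linarith [quarter_le_cosKernel_tent hy]
  have hy0 : y ≠ 0 := by
    rintro rfl
    norm_num at hy
  have hd : ∀ t ∈ Set.uIcc (0 : ℝ) 1, HasDerivAt
      (fun t => (1 - t) * (Real.sin (t * y) / y) - Real.cos (t * y) / y ^ 2) ((1 - t) * Real.cos (t * y)) t := by
    intro t _
    have h1 : HasDerivAt (fun t : ℝ => t * y) y t := by simpa using (hasDerivAt_id t).mul_const y
    have h2 := (Real.hasDerivAt_sin (t * y)).comp t h1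
    have h3 := (Real.hasDerivAt_cos (t * y)).comp t h1
    have h4 := (((hasDerivAt_id t).const_sub 1).mul (h2.div_const y)).sub (h3.div_const (y ^ 2))
    refine h4.congr_deriv ?_
    simp only [Function.comp_apply, id]
    field_simp
    ring
  rw [cosKernel_tent_eq_integral, intervalIntegral.integral_eq_sub_of_hasDerivAt hd
    (Continuous.intervalIntegrable (by fun_prop) _ _)]
  have h5 : 0 ≤ (1 - Real.cos y) / y ^ 2 := div_nonneg (by linarith [Real.cos_le_one y]) (sq_nonneg y)
  have e : (1 - 1) * (Real.sin (1 * y) / y) - Real.cos (1 * y) / y ^ 2 -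
      ((1 - 0) * (Real.sin (0 * y) / y) - Real.cos (0 * y) / y ^ 2) = (1 - Real.cos y) / y ^ 2 := by
    simp
    ring
  rw [e]
  exact h5

theorem bandLimited_mul_cosKernel_tent {w : ℝ → ℝ} (hw : Integrable w) {B : ℝ} (h : BandLimited w B)
    {R : ℝ} (hR : 0 < R) (s : ℝ) : BandLimited (fun x => w x * cosKernel tent (R * (x + s))) (B + R) := by
  refine BandLimited.integral (integrable_mul_cosKernel_prod hw integrableOn_tent R s) measurableSet_Ioi
    fun t ht ν hν => ?_
  have ht0 : 0 < t := ht
  have e : ∀ x : ℝ, Complex.exp (Complex.I * (ν * x)) *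
      ((w x * (tent t * Real.cos (t * (R * (x + s)))) : ℝ) : ℂ) = (tent t : ℂ) *
        (Complex.exp (Complex.I * (ν * x)) * ((w x * Real.cos ((t * R) * x + t * R * s) : ℝ) : ℂ)) := by
    intro x
    rw [show t * (R * (x + s)) = (t * R) * x + t * R * s by ring]
    push_cast
    ring
  simp only
  simp_rw [e]
  rw [integral_const_mul]
  rcases le_total 1 t with h1 | h1
  · rw [tent_eq_zero (h1.trans (le_abs_self t))]
    simp
  · rw [h.integral_exp_mul_cos hw, mul_zero]
    rw [abs_of_pos (mul_pos ht0 hR)]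
    nlinarith

theorem exists_bandLimited {w : ℝ → ℝ} (hw : IsWeight w) : ∃ B : ℝ, 0 ≤ B ∧ BandLimited w B := by
  obtain ⟨b, hb0, hb⟩ := exists_support_bound hw.hat_compact
  exact ⟨2 * Real.pi * b, by positivity, bandLimited_of_hat_eq_zero hb⟩

end ZetaStatistics
end

/-! ### Pointwise bounds for the archimedean, pole and prime terms. -/

noncomputable section
namespace ZetaStatistics

open ArithmeticFunction (vonMangoldt)

theorem measurable_archTerm_modulated {φ : ℝ → ℝ} (hφ : Continuous φ) (L : ℝ) :
    Measurable fun τ : ℝ => archTerm (fun y => (modulated φ L τ y : ℂ)) := by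
  unfold archTerm modulated
  have hk := measurable_kappa
  have h1 := hφ.measurable
  refine Measurable.add (by fun_prop) ?_
  have h : Measurable fun p : ℝ × ℝ => (kappa p.2 : ℂ) *
      (((2 / L * (φ (0 / L) * Real.cos (p.1 * 0)) : ℝ) : ℂ) -
        ((2 / L * (φ (p.2 / L) * Real.cos (p.1 * p.2)) : ℝ) : ℂ)) := by fun_prop
  exact (h.stronglyMeasurable.integral_prod_right (ν := volume.restrict (Set.Ioi (0 : ℝ)))).measurable

theorem exists_norm_archTerm_le {φ : ℝ → ℝ} (hφ : ContDiff ℝ ∞ φ) (hc : HasCompactSupport φ) :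
    ∃ C : ℝ, 0 ≤ C ∧ ∀ L : ℝ, 0 < L → ∀ τ : ℝ,
      ‖archTerm (fun y => (modulated φ L τ y : ℂ))‖ ≤ C * (1 + 1 / L) / L * (1 + Real.log (1 + |τ|)) := by
  obtain ⟨C, hC, h⟩ := exists_norm_archTerm_sub_le hφ hc
  refine ⟨C + 4 * |φ 0|, by positivity, fun L hL τ => ?_⟩
  have h1 := h L hL τ
  have hlog : 0 ≤ Real.log (1 + |τ|) := Real.log_nonneg (by linarith [abs_nonneg τ])
  have h2 : ‖((φ 0 * logKernel τ / L : ℝ) : ℂ)‖ ≤ |φ 0| * (4 * (1 + Real.log (1 + |τ|))) / L := by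
    rw [Complex.norm_real, Real.norm_eq_abs, abs_div, abs_mul, abs_of_pos hL,
      abs_of_nonneg (logKernel_nonneg τ)]
    have := logKernel_le τ
    gcongr
    linarith
  have h3 := norm_le_norm_sub_add (archTerm (fun y => (modulated φ L τ y : ℂ))) ((φ 0 * logKernel τ / L : ℝ) : ℂ)
  have h4 : 0 < 1 / L := by positivity
  calc _ ≤ C * (1 + 1 / L) / L + |φ 0| * (4 * (1 + Real.log (1 + |τ|))) / L := by linarith
    _ ≤ C * (1 + 1 / L) / L * (1 + Real.log (1 + |τ|)) +
        4 * |φ 0| * (1 + 1 / L) / L * (1 + Real.log (1 + |τ|)) := by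
        refine add_le_add ?_ ?_
        · exact le_mul_of_one_le_right (by positivity) (by linarith)
        · have e : |φ 0| * (4 * (1 + Real.log (1 + |τ|))) / L =
            4 * |φ 0| * 1 / L * (1 + Real.log (1 + |τ|)) := by ring
          rw [e]
          gcongr
          linarith
    _ = _ := by ring

/-- The deviation of the archimedean term from its limit. -/
def archErr (φ : ℝ → ℝ) (L τ : ℝ) : ℂ := archTerm (fun y => (modulated φ L τ y : ℂ)) - φ 0

theorem rpow_mul_add {T a : ℝ} (hT : 0 < T) (x : ℝ) : T + T ^ a * x = T ^ a * (x + T ^ (1 - a)) := by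
  have h : T ^ a * T ^ (1 - a) = T := by rw [← Real.rpow_add hT]; simp
  rw [mul_add, h]
  ring

/-- With τ = T + T^a x, always |τ| ≤ T(1 + |x|), and T ≤ |τ|(1 + |x|) log T unless |τ| ≤ T^a / log
T; taking logarithms gives the first term. In the exceptional range `logKernel` is still
nonnegative, so the loss is at most 1; this is the indicator. -/
theorem abs_logKernel_div_sub_one_le {a : ℝ} (ha1 : a ≤ 1) {T : ℝ} (hT : Real.exp 1 ≤ T) (x : ℝ) :
    |logKernel (T + T ^ a * x) / Real.log T - 1| ≤
      (5 + Real.log (Real.log T)) / Real.log T * (1 + Real.log (1 + |x|)) +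
        if |Real.log T * (x + T ^ (1 - a))| ≤ 1 then 1 else 0 := by
  have hT0 : 0 < T := (Real.exp_pos 1).trans_le hT
  have hT1 : 1 ≤ T := (Real.one_le_exp zero_le_one).trans hT
  set L := Real.log T with hL
  have hL1 : 1 ≤ L := (Real.le_log_iff_exp_le hT0).2 hT
  have hL0 : 0 < L := by linarith
  have hlL : 0 ≤ Real.log L := Real.log_nonneg hL1
  have hx0 := abs_nonneg x
  have hlx : 0 ≤ Real.log (1 + |x|) := Real.log_nonneg (by linarith)
  set τ := T + T ^ a * x with hτ
  have hTa : T ^ a ≤ T := by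
    calc T ^ a ≤ T ^ (1 : ℝ) := Real.rpow_le_rpow_of_exponent_le hT1 ha1
      _ = T := Real.rpow_one T
  have hTa0 : 0 < T ^ a := Real.rpow_pos_of_pos hT0 a
  have hup : logKernel τ - L ≤ 5 + Real.log (1 + |x|) := by
    have h1 : |τ| ≤ T * (1 + |x|) := by
      rw [hτ]
      refine (abs_add_le _ _).trans ?_
      rw [abs_of_pos hT0, abs_mul, abs_of_pos hTa0]
      nlinarith
    have h2 : 1 + |τ| ≤ Real.exp 1 * (T * (1 + |x|)) := by
      have h3 := Real.add_one_le_exp 1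
      have h4 : 1 ≤ T * (1 + |x|) := by nlinarith
      nlinarith
    have h5 := Real.log_le_log (by linarith [abs_nonneg τ]) h2
    rw [Real.log_mul (Real.exp_pos 1).ne' (by positivity), Real.log_mul hT0.ne' (by linarith),
      Real.log_exp, ← hL] at h5
    linarith [logKernel_le τ]
  have hlo : L - logKernel τ ≤ 5 + Real.log L + Real.log (1 + |x|) +
      L * if |L * (x + T ^ (1 - a))| ≤ 1 then 1 else 0 := by
    split_ifs with hy
    · linarith [logKernel_nonneg τ]
    · set y := x + T ^ (1 - a) with hyd
      rw [abs_mul, abs_of_pos hL0, not_le] at hy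
      -- T^(1-a) = y - x, and L|y| exceeds 1 outside the exceptional range, so |x| may be multiplied
      -- by it.
      have h1 : T ^ (1 - a) ≤ L * |y| * (1 + |x|) := by
        have h2 : T ^ (1 - a) = y - x := by rw [hyd]; ring
        have h3 := le_abs_self y
        have h4 := neg_abs_le x
        have h5 : |y| ≤ L * |y| := le_mul_of_one_le_left (abs_nonneg y) hL1
        have h6 : |x| ≤ L * |y| * |x| := le_mul_of_one_le_left hx0 hy.le
        rw [h2]
        linarith
      have h7 : |τ| = T ^ a * |y| := by
        rw [hτ, rpow_mul_add hT0, abs_mul, abs_of_pos hTa0]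
      have hy0 : 0 < |y| := by
        by_contra hc
        have : |y| = 0 := le_antisymm (not_lt.1 hc) (abs_nonneg y)
        rw [this] at hy
        linarith
      have h8 : T ≤ L * (|τ| * (1 + |x|)) := by
        have h9 : T ^ a * T ^ (1 - a) = T := by rw [← Real.rpow_add hT0]; simp
        rw [h7]
        calc T = T ^ a * T ^ (1 - a) := h9.symm
          _ ≤ T ^ a * (L * |y| * (1 + |x|)) := by gcongr
          _ = _ := by ring
      have hτ0 : 0 < |τ| := by rw [h7]; positivity
      have h10 := Real.log_le_log hT0 h8
      rw [Real.log_mul hL0.ne' (by positivity), Real.log_mul hτ0.ne' (by linarith), ← hL] at h10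
      linarith [le_logKernel τ]
  have hind : (0 : ℝ) ≤ if |L * (x + T ^ (1 - a))| ≤ 1 then 1 else 0 := by split_ifs <;> norm_num
  have e : logKernel τ / L - 1 = (logKernel τ - L) / L := by field_simp
  rw [e, abs_div, abs_of_pos hL0, div_le_iff₀ hL0, add_mul]
  have e2 : (5 + Real.log L) / L * (1 + Real.log (1 + |x|)) * L = (5 + Real.log L) * (1 + Real.log (1 + |x|)) := by
    field_simp
  rw [e2, abs_le]
  have h11 : 0 ≤ Real.log L * Real.log (1 + |x|) := mul_nonneg hlL hlx
  have h12 := mul_nonneg hL0.le hind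
  constructor <;> nlinarith

theorem exists_norm_archErr_le {φ : ℝ → ℝ} (hφ : ContDiff ℝ ∞ φ) (hc : HasCompactSupport φ)
    {a : ℝ} (ha1 : a ≤ 1) :
    ∃ C : ℝ, 0 ≤ C ∧ ∀ T : ℝ, Real.exp 1 ≤ T → ∀ x : ℝ,
      ‖archErr φ (Real.log T) (T + T ^ a * x)‖ ≤
        C * ((1 + Real.log (Real.log T)) / Real.log T) * (1 + Real.log (1 + |x|)) +
          |φ 0| * if |Real.log T * (x + T ^ (1 - a))| ≤ 1 then 1 else 0 := by
  obtain ⟨C, hC, h⟩ := exists_norm_archTerm_sub_le hφ hc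
  refine ⟨2 * C + 5 * |φ 0|, by positivity, fun T hT x => ?_⟩
  have hT0 : 0 < T := (Real.exp_pos 1).trans_le hT
  have h2 := abs_logKernel_div_sub_one_le ha1 hT x
  set L := Real.log T with hL
  have hL1 : 1 ≤ L := (Real.le_log_iff_exp_le hT0).2 hT
  have hL0 : 0 < L := by linarith
  have hlL : 0 ≤ Real.log L := Real.log_nonneg hL1
  have hlx : 0 ≤ Real.log (1 + |x|) := Real.log_nonneg (by linarith [abs_nonneg x])
  set τ := T + T ^ a * x with hτ
  have h1 := h L hL0 τ
  set I : ℝ := if |L * (x + T ^ (1 - a))| ≤ 1 then 1 else 0 with hI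
  have e : archErr φ L τ = (archTerm (fun y => (modulated φ L τ y : ℂ)) - (φ 0 * logKernel τ / L : ℝ)) +
      ((φ 0 * (logKernel τ / L - 1) : ℝ) : ℂ) := by
    rw [archErr]
    push_cast
    ring
  have h3 : C * (1 + 1 / L) / L ≤ 2 * C / L := by
    have : 1 / L ≤ 1 := (div_le_one hL0).2 hL1
    rw [div_le_div_iff_of_pos_right hL0, mul_comm 2 C]
    gcongr
    linarith
  rw [e]
  refine (norm_add_le _ _).trans ?_
  rw [Complex.norm_real (φ 0 * _), norm_mul, Real.norm_eq_abs, Real.norm_eq_abs]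
  calc _ ≤ 2 * C / L + |φ 0| * ((5 + Real.log L) / L * (1 + Real.log (1 + |x|)) + I) := by
        gcongr
        exact h1.trans h3
    _ ≤ 2 * C * ((1 + Real.log L) / L) * (1 + Real.log (1 + |x|)) +
        |φ 0| * (5 * ((1 + Real.log L) / L) * (1 + Real.log (1 + |x|)) + I) := by
        have i1 : 2 * C / L ≤ 2 * C * ((1 + Real.log L) / L) * (1 + Real.log (1 + |x|)) := by
          rw [mul_div_assoc', div_mul_eq_mul_div, div_le_div_iff_of_pos_right hL0, mul_assoc]
          exact le_mul_of_one_le_right (by positivity) (by nlinarith)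
        have i2 : (5 + Real.log L) / L ≤ 5 * ((1 + Real.log L) / L) := by
          rw [mul_div_assoc']
          gcongr
          linarith
        gcongr
    _ = _ := by ring

theorem continuous_poleTerm {φ : ℝ → ℝ} (hφ : ContDiff ℝ ∞ φ) (hc : HasCompactSupport φ) (L : ℝ) :
    Continuous (poleTerm φ L) := by
  have h1 : Continuous (lap fun u => (φ u : ℂ)) :=
    continuous_lap (Complex.continuous_ofReal.comp hφ.continuous) (hc.comp_left (g := ((↑) : ℝ → ℂ)) rfl)
  unfold poleTerm
  exact (h1.comp (by fun_prop)).add (h1.comp (by fun_prop))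

/-- The transform is evaluated at real part ±L/2, whence e^(bL/2), and at imaginary part -Lτ, whence
arbitrary polynomial decay in L|τ|. -/
theorem exists_norm_poleTerm_le {φ : ℝ → ℝ} (hφ : ContDiff ℝ ∞ φ) (hc : HasCompactSupport φ) {b : ℝ}
    (hb : ∀ u, b < |u| → φ u = 0) (n : ℕ) :
    ∃ C : ℝ, 0 ≤ C ∧ ∀ L : ℝ, 0 < L → ∀ τ : ℝ,
      (1 + L * |τ|) ^ n * ‖poleTerm φ L τ‖ ≤ C * Real.exp (b * L / 2) := by
  obtain ⟨C, hC, h⟩ := exists_pow_mul_norm_lap_le (g := fun u => (φ u : ℂ)) (Complex.ofRealCLM.contDiff.comp hφ)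
    (hc.comp_left (g := ((↑) : ℝ → ℂ)) rfl) (b := b) (fun x hx => by rw [hb x hx, Complex.ofReal_zero]) n
  refine ⟨2 * C, by positivity, fun L hL τ => ?_⟩
  have key : ∀ ε : ℝ, |ε| = 1 / 2 → (1 + L * |τ|) ^ n * ‖lap (fun u => (φ u : ℂ)) (L * (ε - τ * Complex.I))‖ ≤
      C * Real.exp (b * L / 2) := by
    intro ε hε
    have h1 := h (L * (ε - τ * Complex.I))
    have h2 : ((L : ℂ) * (ε - τ * Complex.I)).re = L * ε := by simp
    have h3 : ((L : ℂ) * (ε - τ * Complex.I)).im = -(L * τ) := by simp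
    rw [h2, abs_mul, abs_of_pos hL, hε, show b * (L * (1 / 2)) = b * L / 2 by ring] at h1
    refine le_trans ?_ h1
    gcongr
    have h4 := Complex.abs_im_le_norm ((L : ℂ) * (ε - τ * Complex.I))
    rwa [h3, abs_neg, abs_mul, abs_of_pos hL] at h4
  have k1 := key (1 / 2) (by norm_num)
  have k2 := key (-(1 / 2)) (by norm_num)
  push_cast at k1 k2
  rw [poleTerm]
  calc _ ≤ (1 + L * |τ|) ^ n * (‖lap (fun u => (φ u : ℂ)) (L * (1 / 2 - τ * Complex.I))‖ +
      ‖lap (fun u => (φ u : ℂ)) (L * (-(1 / 2) - τ * Complex.I))‖) := by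
        gcongr
        exact norm_add_le _ _
    _ ≤ _ := by linarith

theorem sum_one_div_sqrt_le (N : ℕ) : ∑ n ∈ Finset.range (N + 1), 1 / √(n : ℝ) ≤ 2 * √(N : ℝ) := by
  induction N with
  | zero => simp
  | succ N ih =>
    rw [Finset.sum_range_succ]
    have h1 : (0 : ℝ) < √((N + 1 : ℕ) : ℝ) := Real.sqrt_pos.2 (by positivity)
    have h2 : 1 / √((N + 1 : ℕ) : ℝ) ≤ 2 * √((N + 1 : ℕ) : ℝ) - 2 * √(N : ℝ) := by
      rw [div_le_iff₀ h1]
      have h3 : √((N + 1 : ℕ) : ℝ) ^ 2 = N + 1 := by rw [Real.sq_sqrt (by positivity)]; push_cast; ring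
      have h4 : √(N : ℝ) ^ 2 = N := Real.sq_sqrt (by positivity)
      nlinarith [sq_nonneg (√((N + 1 : ℕ) : ℝ) - √(N : ℝ))]
    linarith

theorem abs_trigSum_le (c : ℕ → ℝ) (N : ℕ) (τ : ℝ) : |trigSum c N τ| ≤ ∑ n ∈ Finset.range N, |c n| := by
  refine (Finset.abs_sum_le_sum_abs _ _).trans (Finset.sum_le_sum fun n _ => ?_)
  rw [abs_mul]
  exact mul_le_of_le_one_right (abs_nonneg _) (Real.abs_cos_le_one _)

theorem continuous_trigSum (c : ℕ → ℝ) (N : ℕ) : Continuous (trigSum c N) := by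
  unfold trigSum
  fun_prop

/-- Λ(n) = O(L) cancels the 1/L, leaving the sum of 1/√n over n up to about e^(bL). No cancellation
is used; this is needed only against the pole term. -/
theorem exists_abs_trigSum_coeff_le {φ : ℝ → ℝ} (hφ : Continuous φ) (hc : HasCompactSupport φ) {b : ℝ}
    (hb0 : 0 ≤ b) : ∃ C : ℝ, 0 ≤ C ∧ ∀ L : ℝ, 1 ≤ L → ∀ τ : ℝ,
      |trigSum (coeff φ L) (cutoff b L) τ| ≤ C * Real.exp (b * L / 2) := by
  obtain ⟨K, hK⟩ := hc.exists_bound_of_continuous hφ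
  have hK0 : 0 ≤ K := (norm_nonneg _).trans (hK 0)
  refine ⟨K + 8 * K * (b + 2), by positivity, fun L hL τ => ?_⟩
  have hL0 : 0 < L := by linarith
  set N := cutoff b L with hN
  have hN2 : 2 ≤ N := two_le_cutoff b L
  have hlogN := log_cutoff_le hb0 hL
  rw [← hN] at hlogN
  have hterm : ∀ n ∈ Finset.range N, |primeCoeff φ L n| ≤ 2 * K * (b + 2) * (1 / √n) := by
    intro n hn
    refine (abs_primeCoeff_le hK hL0 n).trans ?_
    have h1 : vonMangoldt n ≤ (b + 2) * L := by
      refine ArithmeticFunction.vonMangoldt_le_log.trans (le_trans ?_ hlogN)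
      rcases Nat.eq_zero_or_pos n with rfl | hn0
      · simpa using Real.log_natCast_nonneg N
      · exact Real.log_le_log (by exact_mod_cast hn0) (by exact_mod_cast (Finset.mem_range.1 hn).le)
    calc _ ≤ 2 * K / L * ((b + 2) * L / √n) := by gcongr
      _ = _ := by field_simp
  have hsqrt : √(N : ℝ) ≤ 2 * Real.exp (b * L / 2) := by
    have h1 := cutoff_le (b := b) (L := L) (by positivity)
    rw [← hN] at h1
    refine (Real.sqrt_le_sqrt h1).trans ?_
    rw [Real.sqrt_le_left (by positivity), mul_pow, ← Real.exp_nat_mul]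
    have : ((2 : ℕ) : ℝ) * (b * L / 2) = b * L := by push_cast; ring
    rw [this]
    nlinarith [Real.exp_pos (b * L)]
  have hsum : ∑ n ∈ Finset.range N, |primeCoeff φ L n| ≤ 8 * K * (b + 2) * Real.exp (b * L / 2) := by
    calc _ ≤ ∑ n ∈ Finset.range N, 2 * K * (b + 2) * (1 / √n) := Finset.sum_le_sum hterm
      _ = 2 * K * (b + 2) * ∑ n ∈ Finset.range N, 1 / √(n : ℝ) := by rw [Finset.mul_sum]
      _ ≤ 2 * K * (b + 2) * (2 * √(N : ℝ)) := by
          have h2 := sum_one_div_sqrt_le (N - 1)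
          rw [Nat.sub_add_cancel (by omega)] at h2
          have h3 : √((N - 1 : ℕ) : ℝ) ≤ √(N : ℝ) := Real.sqrt_le_sqrt (by exact_mod_cast Nat.sub_le N 1)
          gcongr
          linarith
      _ ≤ 2 * K * (b + 2) * (2 * (2 * Real.exp (b * L / 2))) := by gcongr
      _ = _ := by ring
  have h0 : trigSum (coeff φ L) N τ = φ 0 + trigSum (primeCoeff φ L) N τ := by
    simp only [trigSum, coeff, add_mul, Finset.sum_add_distrib, ite_mul, zero_mul]
    rw [Finset.sum_ite_eq' (Finset.range N) 1, if_pos (Finset.mem_range.2 (by omega))]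
    simp
  rw [h0]
  refine (abs_add_le _ _).trans ?_
  have h1 : 1 ≤ Real.exp (b * L / 2) := Real.one_le_exp (by positivity)
  have h2 := hK 0
  rw [Real.norm_eq_abs] at h2
  have h3 := (abs_trigSum_le (primeCoeff φ L) N τ).trans hsum
  nlinarith

theorem norm_add_pow_sub_pow_le (A F : ℂ) (k : ℕ) :
    ‖(A + F) ^ (k + 1) - A ^ (k + 1)‖ ≤ (k + 1) * ‖F‖ * (‖A‖ + ‖F‖) ^ k := by
  induction k with
  | zero => simp
  | succ k ih =>
    have e : (A + F) ^ (k + 1 + 1) - A ^ (k + 1 + 1) =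
        (A + F) * ((A + F) ^ (k + 1) - A ^ (k + 1)) + F * A ^ (k + 1) := by ring
    rw [e]
    refine (norm_add_le _ _).trans ?_
    rw [norm_mul, norm_mul, norm_pow]
    have hA := norm_nonneg A
    have hF := norm_nonneg F
    calc _ ≤ (‖A‖ + ‖F‖) * ((k + 1) * ‖F‖ * (‖A‖ + ‖F‖) ^ k) + ‖F‖ * (‖A‖ + ‖F‖) ^ (k + 1) := by
          gcongr
          · exact norm_add_le _ _
          · linarith
      _ = _ := by push_cast; ring

theorem pow_le_one_add_pow {x : ℝ} (hx : 0 ≤ x) {i j : ℕ} (h : i ≤ j) : x ^ i ≤ 1 + x ^ j := by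
  rcases le_total x 1 with h1 | h1
  · have := pow_le_one₀ hx h1 (n := i)
    have := pow_nonneg hx j
    linarith
  · have := pow_le_pow_right₀ h1 h
    linarith

theorem add_pow_le_two_pow {x y : ℝ} (hx : 0 ≤ x) (hy : 0 ≤ y) (n : ℕ) :
    (x + y) ^ n ≤ 2 ^ n * (x ^ n + y ^ n) := by
  have h : x + y ≤ 2 * max x y := by linarith [le_max_left x y, le_max_right x y]
  have h0 := pow_nonneg hx n
  have h1 := pow_nonneg hy n
  calc (x + y) ^ n ≤ (2 * max x y) ^ n := by gcongr
    _ = 2 ^ n * max x y ^ n := mul_pow _ _ _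
    _ ≤ 2 ^ n * (x ^ n + y ^ n) := by
        gcongr
        rcases max_choice x y with h | h <;> rw [h] <;> linarith

end ZetaStatistics
end

/-! ### Majorants for the two error terms. -/

noncomputable section
namespace ZetaStatistics

theorem BandLimited.add {v v' : ℝ → ℝ} {R : ℝ} (hv : Integrable v) (hv' : Integrable v')
    (h : BandLimited v R) (h' : BandLimited v' R) : BandLimited (fun x => v x + v' x) R := by
  intro ν hν
  simp_rw [Complex.ofReal_add, mul_add]
  rw [integral_add (integrable_exp_mul hv ν) (integrable_exp_mul hv' ν), h ν hν, h' ν hν, add_zero]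

theorem BandLimited.const_mul {v : ℝ → ℝ} {R : ℝ} (h : BandLimited v R) (c : ℝ) :
    BandLimited (fun x => c * v x) R := by
  intro ν hν
  simp_rw [Complex.ofReal_mul, mul_left_comm _ (c : ℂ)]
  rw [integral_const_mul, h ν hν, mul_zero]

theorem sqrt_two_mul_exp_pow_le {b L : ℝ} (hb : 0 ≤ b) (hL : 0 ≤ L) {n m : ℕ} (h : n ≤ m) :
    √(2 * Real.exp (b * L) ^ n) ≤ 2 * Real.exp (b * m / 2 * L) := by
  rw [Real.sqrt_le_left (by positivity), mul_pow, ← Real.exp_nat_mul, ← Real.exp_nat_mul]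
  have h1 : (n : ℝ) * (b * L) ≤ (2 : ℕ) * (b * m / 2 * L) := by
    have h2 : (n : ℝ) ≤ m := by exact_mod_cast h
    have : (n : ℝ) * (b * L) ≤ m * (b * L) := by gcongr
    push_cast
    linarith
  have := Real.exp_le_exp.2 h1
  nlinarith [Real.exp_pos (n * (b * L))]

theorem tendsto_add_log_mul_rpow {δ : ℝ} (hδ : 0 < δ) (R : ℝ) :
    Tendsto (fun T : ℝ => (R + Real.log T) * Real.exp (-δ * Real.log T)) atTop (𝓝 0) := by
  have h1 := (tendsto_rpow_mul_exp_neg_mul_atTop_nhds_zero 1 δ hδ).comp Real.tendsto_log_atTop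
  have h0 := ((tendsto_rpow_mul_exp_neg_mul_atTop_nhds_zero 0 δ hδ).const_mul R).comp Real.tendsto_log_atTop
  have h2 := h0.add h1
  simp only [mul_zero, add_zero] at h2
  refine h2.congr fun T => ?_
  simp only [Function.comp_apply, Real.rpow_one, Real.rpow_zero]
  ring

/-- The place where the support condition is spent on the moment identity: the reciprocal gap is
O(T^(bm/2)), and the remaining power T^(a - bm/2) pays even for a band growing like log T. -/
theorem eventually_gap {a b : ℝ} (hb0 : 0 ≤ b) {m : ℕ} (hbm : b * m < 2 * a) (R : ℝ) :
    ∀ᶠ T : ℝ in atTop, ∀ n ≤ m, (R + Real.log T) * √(2 * Real.exp (b * Real.log T) ^ n) < T ^ a := by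
  have hδ : 0 < a - b * m / 2 := by linarith
  have h := tendsto_add_log_mul_rpow hδ R
  filter_upwards [h.eventually_lt_const (show (0 : ℝ) < 1 / 2 by norm_num), eventually_gt_atTop 1,
    (tendsto_atTop_add_const_left atTop R Real.tendsto_log_atTop).eventually_ge_atTop 0] with T h1 hT hR n hn
  have hL : 0 ≤ Real.log T := Real.log_nonneg hT.le
  calc _ ≤ (R + Real.log T) * (2 * Real.exp (b * m / 2 * Real.log T)) := by
        gcongr
        exact sqrt_two_mul_exp_pow_le hb0 hL hn
    _ = 2 * ((R + Real.log T) * Real.exp (-(a - b * m / 2) * Real.log T)) * Real.exp (a * Real.log T) := by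
        rw [show b * m / 2 * Real.log T = -(a - b * m / 2) * Real.log T + a * Real.log T by ring, Real.exp_add]
        ring
    _ < 1 * Real.exp (a * Real.log T) := by gcongr; linarith
    _ = T ^ a := by rw [one_mul, Real.rpow_def_of_pos (by linarith), mul_comm]

theorem log_one_add_abs_le_logKernel (x : ℝ) : 1 + Real.log (1 + |x|) ≤ logKernel x + 6 := by
  have h2 : Real.log 2 ≤ 1 := by linarith [Real.log_le_sub_one_of_pos (by norm_num : (0 : ℝ) < 2)]
  rcases le_total 1 |x| with h | h
  · have h1 := Real.log_le_log (by linarith) (by linarith : 1 + |x| ≤ 2 * |x|)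
    rw [Real.log_mul (by norm_num) (by linarith)] at h1
    linarith [le_logKernel x]
  · have h1 := Real.log_le_log (by linarith [abs_nonneg x]) (by linarith : 1 + |x| ≤ 2)
    linarith [logKernel_nonneg x]

theorem integrable_log_pow_mul {w : ℝ → ℝ} (hw : IsWeight w) {m : ℕ}
    (hl : Integrable fun x : ℝ => Real.log (1 + |x|) ^ m * w x) {k : ℕ} (hk : k ≤ m) :
    Integrable fun x : ℝ => (1 + Real.log (1 + |x|)) ^ k * w x := by
  have h1 : Integrable fun x : ℝ => 2 ^ k * (2 * w x + Real.log (1 + |x|) ^ m * w x) :=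
    ((hw.integrable.const_mul 2).add hl).const_mul _
  refine h1.mono' ?_ (Eventually.of_forall fun x => ?_)
  · exact (Measurable.aestronglyMeasurable (by fun_prop)).mul hw.integrable.aestronglyMeasurable
  · have h0 : 0 ≤ Real.log (1 + |x|) := Real.log_nonneg (by linarith [abs_nonneg x])
    rw [Real.norm_of_nonneg (mul_nonneg (by positivity) (hw.nonneg x))]
    have h2 := add_pow_le_two_pow zero_le_one h0 k
    rw [one_pow] at h2
    have h3 := pow_le_one_add_pow h0 hk
    have hwx := hw.nonneg x
    calc _ ≤ 2 ^ k * (1 + Real.log (1 + |x|) ^ k) * w x := by gcongr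
      _ ≤ 2 ^ k * (1 + (1 + Real.log (1 + |x|) ^ m)) * w x := by gcongr
      _ = _ := by ring

theorem integrable_mul_logKernel {w : ℝ → ℝ} (hw : IsWeight w) {m : ℕ} (hm : 1 ≤ m)
    (hl : Integrable fun x : ℝ => Real.log (1 + |x|) ^ m * w x) : Integrable fun x => w x * logKernel x := by
  refine ((integrable_log_pow_mul hw hl hm).const_mul 4).mono'
    (hw.integrable.aestronglyMeasurable.mul measurable_logKernel.aestronglyMeasurable)
    (Eventually.of_forall fun x => ?_)
  have h0 : 0 ≤ Real.log (1 + |x|) := Real.log_nonneg (by linarith [abs_nonneg x])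
  have hwx := hw.nonneg x
  rw [norm_mul, Real.norm_of_nonneg hwx, Real.norm_of_nonneg (logKernel_nonneg x), pow_one]
  have := logKernel_le x
  nlinarith

theorem tendsto_one_add_log_div : Tendsto (fun L : ℝ => (1 + Real.log L) / L) atTop (𝓝 0) := by
  have h1 : Tendsto (fun L : ℝ => 1 / L) atTop (𝓝 0) := tendsto_const_nhds.div_atTop tendsto_id
  have h2 : Tendsto (fun L : ℝ => Real.log L / L) atTop (𝓝 0) :=
    Real.isLittleO_log_id_atTop.tendsto_div_nhds_zero
  have h3 := h1.add h2
  rw [add_zero] at h3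
  exact h3.congr fun L => by rw [add_div]

/-- With S the polynomial and F the archimedean error, the difference of powers is controlled by
|F|(|S| + |F|)^j. The mixed part is handled by a band-limited `V` ≥ |F|w: the integral of S^n V is
exactly the n-th moment of the model, which stays bounded, times ∫ V → 0. The pure part |F|^m needs
only the logarithmic moment of w, through `Q`. -/
theorem exists_arch_majorant {φ : ℝ → ℝ} (hφ : ContDiff ℝ ∞ φ) (hc : HasCompactSupport φ) {b : ℝ}
    (hb0 : 0 ≤ b) (hb : ∀ u, b < |u| → φ u = 0) {a : ℝ} (ha1 : a ≤ 1) {m : ℕ} (hm : 1 ≤ m)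
    (hbm : b * m < 2 * a) {w : ℝ → ℝ} (hw : IsWeight w)
    (hl : Integrable fun x : ℝ => Real.log (1 + |x|) ^ m * w x) {v : NNReal}
    (hv : (v : ℝ) = ∫ u in Set.Ioi 0, u * (2 * φ u ^ 2)) {j : ℕ} (hj : j + 1 ≤ m) :
    ∃ G : ℝ → ℝ → ℝ, (∀ᶠ T in atTop, Integrable (G T)) ∧
      (∀ᶠ T in atTop, ∀ x,
        ‖((trigSum (coeff φ (Real.log T)) (cutoff b (Real.log T)) (T + T ^ a * x) : ℂ) +
            archErr φ (Real.log T) (T + T ^ a * x)) ^ (j + 1) -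
          (trigSum (coeff φ (Real.log T)) (cutoff b (Real.log T)) (T + T ^ a * x) : ℂ) ^ (j + 1)‖ * w x ≤ G T x) ∧
      Tendsto (fun T => ∫ x, G T x) atTop (𝓝 0) := by
  obtain ⟨B, hB0, hB⟩ := exists_bandLimited hw
  obtain ⟨C, hC, hE⟩ := exists_norm_archErr_le hφ hc ha1
  have hlK := integrable_mul_logKernel hw hm hl
  have hlm := integrable_log_pow_mul hw hl le_rfl
  -- The even integer among m and m - 1. Evenness gives |S|^n = S^n; j ≤ m - 1 gives j ≤ n, and n ≤
  -- m keeps the frequency gap available.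
  set n := 2 * (m / 2) with hn
  have hnm : n ≤ m := Nat.mul_div_le m 2
  have hjn : j ≤ n := by omega
  have hneven : Even n := ⟨m / 2, by omega⟩
  set A : ℝ → ℝ := fun T => C * ((1 + Real.log (Real.log T)) / Real.log T) with hA
  set K : ℝ → ℝ → ℝ := fun T x => cosKernel tent (Real.log T * (x + T ^ (1 - a))) with hK
  set S : ℝ → ℝ → ℝ := fun T x => trigSum (coeff φ (Real.log T)) (cutoff b (Real.log T)) (T + T ^ a * x) with hS
  set D : ℝ → ℝ := fun L => ∫ θ, torusSum (coeff φ L) (cutoff b L) θ ^ n ∂(torus (cutoff b L)) with hD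
  -- The logarithm is replaced by `logKernel` + 6 and the indicator by 4 times the Fejér kernel, so
  -- that `V T` has band B + 1 + log T.
  set V : ℝ → ℝ → ℝ := fun T x => A T * (w x * logKernel x) + 6 * A T * w x + 4 * |φ 0| * (w x * K T x) with hV
  set Q : ℝ → ℝ → ℝ := fun T x => A T ^ m * ((1 + Real.log (1 + |x|)) ^ m * w x) +
    4 * |φ 0| ^ m * (w x * K T x) with hQ
  have hKi : ∀ T, Integrable fun x => w x * K T x := fun T =>
    integrable_mul_cosKernel hw.integrable integrableOn_tent _ _
  have hVi : ∀ T, Integrable (V T) := fun T =>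
    ((hlK.const_mul _).add (hw.integrable.const_mul _)).add ((hKi T).const_mul _)
  have hQi : ∀ T, Integrable (Q T) := fun T => (hlm.const_mul _).add ((hKi T).const_mul _)
  have hSb : ∀ T, ∃ M, ∀ x, ‖S T x ^ n‖ ≤ M := fun T => ⟨_, fun x => by
    rw [norm_pow]
    exact pow_le_pow_left₀ (norm_nonneg _) (abs_trigSum_le _ _ _) n⟩
  have hSc : ∀ T, Continuous (S T) := fun T => (continuous_trigSum _ _).comp (by fun_prop)
  have hSVi : ∀ T, Integrable fun x => S T x ^ n * V T x := fun T => by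
    obtain ⟨M, hM⟩ := hSb T
    exact (hVi T).bdd_mul ((hSc T).pow n).aestronglyMeasurable (Eventually.of_forall hM)
  set c : ℝ := (j + 1) * 2 ^ j with hcdef
  have hTe : ∀ᶠ T : ℝ in atTop, Real.exp 1 ≤ T := eventually_ge_atTop _
  refine ⟨fun T x => c * (2 * V T x + S T x ^ n * V T x + 2 ^ m * Q T x), ?_, ?_, ?_⟩
  · refine Eventually.of_forall fun T => ?_
    exact ((((hVi T).const_mul 2).add (hSVi T)).add ((hQi T).const_mul _)).const_mul _
  · filter_upwards [hTe] with T hT x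
    have hT0 : 0 < T := (Real.exp_pos 1).trans_le hT
    have hL1 : 1 ≤ Real.log T := (Real.le_log_iff_exp_le hT0).2 hT
    have hA0 : 0 ≤ A T := by
      have := Real.log_nonneg hL1
      simp only [hA]
      positivity
    have hwx := hw.nonneg x
    have hEx := hE T hT x
    set F := archErr φ (Real.log T) (T + T ^ a * x) with hF
    have hpow := norm_add_pow_sub_pow_le (S T x : ℂ) F j
    have hKx : 0 ≤ K T x := cosKernel_tent_nonneg _
    set I : ℝ := if |Real.log T * (x + T ^ (1 - a))| ≤ 1 then 1 else 0 with hI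
    have hI0 : 0 ≤ I := by rw [hI]; split_ifs <;> norm_num
    have hI4 : I ≤ 4 * K T x := by
      rw [hI]
      split_ifs with hy
      · linarith [quarter_le_cosKernel_tent hy]
      · linarith
    have hIm : I ^ m = I := by
      rw [hI]
      split_ifs
      · simp
      · simp; omega
    have hl0 : 0 ≤ Real.log (1 + |x|) := Real.log_nonneg (by linarith [abs_nonneg x])
    have hsabs : |S T x| ^ n = S T x ^ n := hneven.pow_abs _
    have hsn0 : 0 ≤ S T x ^ n := hneven.pow_nonneg _
    have hF1 : ‖F‖ * w x ≤ V T x := by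
      calc ‖F‖ * w x ≤ (A T * (logKernel x + 6) + |φ 0| * (4 * K T x)) * w x := by
            gcongr
            refine hEx.trans ?_
            have := log_one_add_abs_le_logKernel x
            gcongr
        _ = V T x := by simp only [hV]; ring
    have hFm : ‖F‖ ^ m * w x ≤ 2 ^ m * Q T x := by
      calc ‖F‖ ^ m * w x ≤ (A T * (1 + Real.log (1 + |x|)) + |φ 0| * I) ^ m * w x := by gcongr
        _ ≤ 2 ^ m * ((A T * (1 + Real.log (1 + |x|))) ^ m + (|φ 0| * I) ^ m) * w x := by
            gcongr
            exact add_pow_le_two_pow (by positivity) (by positivity) m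
        _ = 2 ^ m * (A T ^ m * (1 + Real.log (1 + |x|)) ^ m + |φ 0| ^ m * I) * w x := by
            rw [mul_pow (A T) (1 + Real.log (1 + |x|)) m, mul_pow |φ 0| I m, hIm]
        _ ≤ 2 ^ m * (A T ^ m * (1 + Real.log (1 + |x|)) ^ m + |φ 0| ^ m * (4 * K T x)) * w x := by gcongr
        _ = _ := by simp only [hQ]; ring
    -- Powers of S are raised to the exponent n, powers of F to m - 1, at the cost of adding 1; the
    -- remaining factor |F| completes |F|^m.
    have hFj : ‖F‖ * (‖(S T x : ℂ)‖ + ‖F‖) ^ j ≤ 2 ^ j * (‖F‖ * (2 + S T x ^ n) + ‖F‖ ^ m) := by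
      have i1 := add_pow_le_two_pow (norm_nonneg (S T x : ℂ)) (norm_nonneg F) j
      have i2 := pow_le_one_add_pow (norm_nonneg (S T x : ℂ)) hjn
      have i3 := pow_le_one_add_pow (norm_nonneg F) (show j ≤ m - 1 by omega)
      rw [Complex.norm_real, Real.norm_eq_abs, hsabs] at i2
      have i4 : ‖F‖ * ‖F‖ ^ (m - 1) = ‖F‖ ^ m := by
        rw [← pow_succ', Nat.sub_add_cancel hm]
      rw [Complex.norm_real, Real.norm_eq_abs] at i1 ⊢
      calc _ ≤ ‖F‖ * (2 ^ j * (|S T x| ^ j + ‖F‖ ^ j)) := by gcongr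
        _ ≤ ‖F‖ * (2 ^ j * ((1 + S T x ^ n) + (1 + ‖F‖ ^ (m - 1)))) := by gcongr
        _ = 2 ^ j * (‖F‖ * (2 + S T x ^ n) + ‖F‖ * ‖F‖ ^ (m - 1)) := by ring
        _ = _ := by rw [i4]
    calc _ ≤ ((j + 1) * ‖F‖ * (‖(S T x : ℂ)‖ + ‖F‖) ^ j) * w x := by gcongr
      _ = (j + 1) * (‖F‖ * (‖(S T x : ℂ)‖ + ‖F‖) ^ j) * w x := by ring
      _ ≤ (j + 1) * (2 ^ j * (‖F‖ * (2 + S T x ^ n) + ‖F‖ ^ m)) * w x := by gcongr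
      _ = c * ((2 + S T x ^ n) * (‖F‖ * w x) + ‖F‖ ^ m * w x) := by rw [hcdef]; ring
      _ ≤ c * ((2 + S T x ^ n) * V T x + 2 ^ m * Q T x) := by gcongr
      _ = _ := by ring
  · have hlogT := Real.tendsto_log_atTop
    have hAlim : Tendsto A atTop (𝓝 0) := by
      have := (tendsto_one_add_log_div.comp hlogT).const_mul C
      rw [mul_zero] at this
      exact this
    have hκlim : Tendsto (fun T => ∫ x, w x * K T x) atTop (𝓝 0) := by
      have h0 : Tendsto (fun T : ℝ => B / Real.log T) atTop (𝓝 0) := tendsto_const_nhds.div_atTop hlogT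
      refine squeeze_zero_norm' ?_ h0
      filter_upwards [hlogT.eventually_gt_atTop 0] with T hT
      exact abs_integral_mul_cosKernel_le hw hB0 hB integrableOn_tent (fun t ht => tent_mem ht) hT _
    have hVint : ∀ T, ∫ x, V T x = A T * (∫ x, w x * logKernel x) + 6 * A T + 4 * |φ 0| * ∫ x, w x * K T x := by
      intro T
      simp only [hV]
      have h1 : Integrable fun x => A T * (w x * logKernel x) + 6 * A T * w x :=
        (hlK.const_mul _).add (hw.integrable.const_mul _)
      rw [integral_add h1 ((hKi T).const_mul _),
        integral_add (hlK.const_mul _) (hw.integrable.const_mul _), integral_const_mul, integral_const_mul,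
        integral_const_mul, hw.integral_eq_one, mul_one]
    have hVlim : Tendsto (fun T => ∫ x, V T x) atTop (𝓝 0) := by
      simp_rw [hVint]
      have := ((hAlim.mul_const (∫ x, w x * logKernel x)).add (hAlim.const_mul 6)).add
        (hκlim.const_mul (4 * |φ 0|))
      simpa using this
    have hQint : ∀ T, ∫ x, Q T x = A T ^ m * (∫ x, (1 + Real.log (1 + |x|)) ^ m * w x) +
        4 * |φ 0| ^ m * ∫ x, w x * K T x := by
      intro T
      simp only [hQ]
      rw [integral_add (hlm.const_mul _) ((hKi T).const_mul _), integral_const_mul, integral_const_mul]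
    have hQlim : Tendsto (fun T => ∫ x, Q T x) atTop (𝓝 0) := by
      simp_rw [hQint]
      have h1 := hAlim.pow m
      rw [zero_pow (by omega)] at h1
      have := (h1.mul_const (∫ x, (1 + Real.log (1 + |x|)) ^ m * w x)).add (hκlim.const_mul (4 * |φ 0| ^ m))
      simpa using this
    have hDlim := (tendsto_torusSum_moment hφ hb0 hb hv n).comp hlogT
    have hlim := (((hVlim.const_mul 2).add (hDlim.mul hVlim)).add (hQlim.const_mul (2 ^ m))).const_mul c
    simp only [mul_zero, add_zero] at hlim
    refine hlim.congr' ?_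
    filter_upwards [hTe, eventually_gap hb0 hbm (B + 1)] with T hT hgap
    have hT0 : 0 < T := (Real.exp_pos 1).trans_le hT
    have hL1 : 1 ≤ Real.log T := (Real.le_log_iff_exp_le hT0).2 hT
    have hL0 : 0 < Real.log T := by linarith
    have hVB : BandLimited (V T) (B + 1 + Real.log T) := by
      have b1 := ((bandLimited_mul_logKernel hw.integrable hlK hB).mono
        (show B + 1 ≤ B + 1 + Real.log T by linarith)).const_mul (A T)
      have b2 := (hB.mono (show B ≤ B + 1 + Real.log T by linarith)).const_mul (6 * A T)
      have b3 := ((bandLimited_mul_cosKernel_tent hw.integrable hB hL0 (T ^ (1 - a))).mono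
        (show B + Real.log T ≤ B + 1 + Real.log T by linarith)).const_mul (4 * |φ 0|)
      exact (b1.add (hlK.const_mul _) (hw.integrable.const_mul _) b2).add
        ((hlK.const_mul _).add (hw.integrable.const_mul _)) ((hKi T).const_mul _) b3
    -- The moment identity with the majorant `V T` itself in the role of the weight.
    have hSV : ∫ x, S T x ^ n * V T x = D (Real.log T) * ∫ x, V T x :=
      integral_trigSum_pow_mul (Real.exp_pos (b * Real.log T))
        (fun k hk => le_exp_of_coeff_ne_zero hb0 hb hL0 hk) (hVi T) hVB (Real.rpow_pos_of_pos hT0 a)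
        (hgap n hnm) T
    have h1 : Integrable fun x => 2 * V T x + S T x ^ n * V T x := ((hVi T).const_mul 2).add (hSVi T)
    rw [integral_const_mul, integral_add h1 ((hQi T).const_mul _),
      integral_add ((hVi T).const_mul 2) (hSVi T), integral_const_mul, integral_const_mul, hSV]
    rfl

/-- Everything is bounded pointwise by X^(j+1)/(1 + τ²) with X = T^(b/2). Against w the Cauchy
kernel integrates to O(T^(-a)), so bm < 2a suffices. -/
theorem exists_pole_majorant {φ : ℝ → ℝ} (hφ : ContDiff ℝ ∞ φ) (hc : HasCompactSupport φ) {b : ℝ}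
    (hb0 : 0 ≤ b) (hb : ∀ u, b < |u| → φ u = 0) {a : ℝ} {m : ℕ}
    (hbm : b * m < 2 * a) {w : ℝ → ℝ} (hw : IsWeight w) {j : ℕ} (hj : j + 1 ≤ m) :
    ∃ G : ℝ → ℝ → ℝ, (∀ᶠ T in atTop, Integrable (G T)) ∧
      (∀ᶠ T in atTop, ∀ x,
        ‖((trigSum (coeff φ (Real.log T)) (cutoff b (Real.log T)) (T + T ^ a * x) : ℂ) +
            archErr φ (Real.log T) (T + T ^ a * x) + poleTerm φ (Real.log T) (T + T ^ a * x)) ^ (j + 1) -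
          ((trigSum (coeff φ (Real.log T)) (cutoff b (Real.log T)) (T + T ^ a * x) : ℂ) +
            archErr φ (Real.log T) (T + T ^ a * x)) ^ (j + 1)‖ * w x ≤ G T x) ∧
      Tendsto (fun T => ∫ x, G T x) atTop (𝓝 0) := by
  obtain ⟨B, hB0, hB⟩ := exists_bandLimited hw
  obtain ⟨C₁, hC₁, hS⟩ := exists_abs_trigSum_coeff_le hφ.continuous hc hb0
  obtain ⟨C₂, hC₂, hM⟩ := exists_norm_archTerm_le hφ hc
  -- j powers of decay offset the factor (1 + |τ|)^j from the other terms, two more give 1/(1 + τ²).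
  obtain ⟨C₃, hC₃, hP⟩ := exists_norm_poleTerm_le hφ hc hb (j + 2)
  set C := C₁ + 2 * C₂ + |φ 0| + C₃ with hCdef
  have hC0 : 0 ≤ C := by positivity
  have hexpi : IntegrableOn (fun t : ℝ => Real.exp (-t)) (Set.Ioi 0) := integrableOn_exp_neg_Ioi 0
  set K : ℝ → ℝ → ℝ := fun T x => cosKernel (fun t => Real.exp (-t)) (T ^ a * (x + T ^ (1 - a))) with hK
  set c : ℝ := (j + 1) * C₃ * C ^ j with hcdef
  have hc0 : 0 ≤ c := by positivity
  have hTe : ∀ᶠ T : ℝ in atTop, Real.exp 1 ≤ T := eventually_ge_atTop _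
  refine ⟨fun T x => c * Real.exp (b * Real.log T / 2) ^ (j + 1) * (w x * K T x), ?_, ?_, ?_⟩
  · exact Eventually.of_forall fun T => (integrable_mul_cosKernel hw.integrable hexpi _ _).const_mul _
  · filter_upwards [hTe] with T hT x
    have hT0 : 0 < T := (Real.exp_pos 1).trans_le hT
    have hL1 : 1 ≤ Real.log T := (Real.le_log_iff_exp_le hT0).2 hT
    have hL0 : 0 < Real.log T := by linarith
    have hKx : K T x = 1 / (1 + (T + T ^ a * x) ^ 2) := by
      simp only [hK]
      rw [cosKernel_exp_neg, ← rpow_mul_add hT0]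
    set L := Real.log T with hL
    set τ := T + T ^ a * x with hτ
    set X := Real.exp (b * L / 2) with hX
    have hX1 : 1 ≤ X := Real.one_le_exp (by positivity)
    have hτ0 := abs_nonneg τ
    have hP' : (1 + |τ|) ^ (j + 2) * ‖poleTerm φ L τ‖ ≤ C₃ * X := by
      refine le_trans ?_ (hP L hL0 τ)
      gcongr
      exact le_mul_of_one_le_left hτ0 hL1
    have hP0 : ‖poleTerm φ L τ‖ ≤ C₃ * X := by
      refine le_trans ?_ hP'
      exact le_mul_of_one_le_left (norm_nonneg _) (one_le_pow₀ (by linarith))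
    have hSE : ‖(trigSum (coeff φ L) (cutoff b L) τ : ℂ) + archErr φ L τ‖ + ‖poleTerm φ L τ‖ ≤
        C * X * (1 + |τ|) := by
      have h1 : ‖(trigSum (coeff φ L) (cutoff b L) τ : ℂ)‖ ≤ C₁ * X := by
        rw [Complex.norm_real]
        exact hS L hL1 τ
      have h2 : ‖archErr φ L τ‖ ≤ 2 * C₂ * (1 + |τ|) + |φ 0| := by
        rw [archErr]
        refine (norm_sub_le _ _).trans ?_
        rw [Complex.norm_real, Real.norm_eq_abs]
        gcongr
        refine (hM L hL0 τ).trans ?_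
        have h3 : (1 + 1 / L) / L ≤ 2 := by
          have : 1 / L ≤ 1 := (div_le_one hL0).2 hL1
          rw [div_le_iff₀ hL0]
          linarith
        have h4 : Real.log (1 + |τ|) ≤ |τ| := by
          linarith [Real.log_le_sub_one_of_pos (by linarith : 0 < 1 + |τ|)]
        have h5 : 0 ≤ Real.log (1 + |τ|) := Real.log_nonneg (by linarith)
        calc _ = C₂ * ((1 + 1 / L) / L) * (1 + Real.log (1 + |τ|)) := by ring
          _ ≤ C₂ * 2 * (1 + |τ|) := by gcongr
          _ = _ := by ring
      have h6 := norm_add_le (trigSum (coeff φ L) (cutoff b L) τ : ℂ) (archErr φ L τ)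
      have g1 : C₁ * X ≤ C₁ * X * (1 + |τ|) := le_mul_of_one_le_right (by positivity) (by linarith)
      have g2 : 2 * C₂ * (1 + |τ|) ≤ 2 * C₂ * X * (1 + |τ|) := by
        rw [mul_right_comm _ X]
        exact le_mul_of_one_le_right (by positivity) hX1
      have g3 : |φ 0| ≤ |φ 0| * X * (1 + |τ|) := by
        rw [mul_assoc]
        exact le_mul_of_one_le_right (by positivity) (by nlinarith)
      have g4 : C₃ * X ≤ C₃ * X * (1 + |τ|) := le_mul_of_one_le_right (by positivity) (by linarith)
      rw [hCdef]
      linarith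
    have hkey : ‖poleTerm φ L τ‖ * (1 + |τ|) ^ j ≤ C₃ * X * (1 / (1 + τ ^ 2)) := by
      have h7 : 0 < 1 + τ ^ 2 := by positivity
      rw [mul_one_div, le_div_iff₀ h7]
      have h8 : 1 + τ ^ 2 ≤ (1 + |τ|) ^ 2 := by rw [← sq_abs τ]; nlinarith
      calc _ ≤ ‖poleTerm φ L τ‖ * (1 + |τ|) ^ j * (1 + |τ|) ^ 2 := by gcongr
        _ = (1 + |τ|) ^ (j + 2) * ‖poleTerm φ L τ‖ := by ring
        _ ≤ _ := hP'
    have hwx := hw.nonneg x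
    have hpow := norm_add_pow_sub_pow_le ((trigSum (coeff φ L) (cutoff b L) τ : ℂ) + archErr φ L τ)
      (poleTerm φ L τ) j
    rw [hKx]
    calc _ ≤ ((j + 1) * ‖poleTerm φ L τ‖ *
          (‖(trigSum (coeff φ L) (cutoff b L) τ : ℂ) + archErr φ L τ‖ + ‖poleTerm φ L τ‖) ^ j) * w x := by gcongr
      _ ≤ ((j + 1) * ‖poleTerm φ L τ‖ * (C * X * (1 + |τ|)) ^ j) * w x := by gcongr
      _ = (j + 1) * (C * X) ^ j * (‖poleTerm φ L τ‖ * (1 + |τ|) ^ j) * w x := by rw [mul_pow _ (1 + |τ|)]; ring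
      _ ≤ (j + 1) * (C * X) ^ j * (C₃ * X * (1 / (1 + τ ^ 2))) * w x := by gcongr
      _ = _ := by rw [hcdef, mul_pow]; ring
  · have hδ : 0 < a - b * m / 2 := by linarith
    -- The factor 1 + log T is superfluous here; it is kept to reuse this limit.
    have h0 := tendsto_add_log_mul_rpow hδ 1
    have h1 : Tendsto (fun T : ℝ => c * B * ((1 + Real.log T) * Real.exp (-(a - b * m / 2) * Real.log T)))
        atTop (𝓝 0) := by
      have := h0.const_mul (c * B)
      rwa [mul_zero] at this
    refine squeeze_zero_norm' ?_ h1
    filter_upwards [hTe] with T hT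
    have hT0 : 0 < T := (Real.exp_pos 1).trans_le hT
    have hL1 : 1 ≤ Real.log T := (Real.le_log_iff_exp_le hT0).2 hT
    have hL0 : 0 < Real.log T := by linarith
    have hH : 0 < T ^ a := Real.rpow_pos_of_pos hT0 a
    have h2 := abs_integral_mul_cosKernel_le hw hB0 hB hexpi
      (fun t ht => ⟨(Real.exp_pos _).le, Real.exp_le_one_iff.2 (by linarith)⟩) hH (T ^ (1 - a))
    rw [integral_const_mul, norm_mul, Real.norm_of_nonneg (by positivity), Real.norm_eq_abs]
    have h3 : T ^ a = Real.exp (a * Real.log T) := by rw [Real.rpow_def_of_pos hT0, mul_comm]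
    have h4 : Real.exp (b * Real.log T / 2) ^ (j + 1) ≤ Real.exp (b * m / 2 * Real.log T) := by
      rw [← Real.exp_nat_mul, Real.exp_le_exp]
      have h5 : ((j + 1 : ℕ) : ℝ) ≤ m := by exact_mod_cast hj
      have h6 : 0 ≤ b * Real.log T / 2 := by positivity
      calc _ ≤ (m : ℝ) * (b * Real.log T / 2) := by gcongr
        _ = _ := by ring
    calc _ ≤ c * Real.exp (b * m / 2 * Real.log T) * (B / T ^ a) := by gcongr
      _ = c * B * (1 * Real.exp (-(a - b * m / 2) * Real.log T)) := by
          rw [h3, show -(a - b * m / 2) * Real.log T = b * m / 2 * Real.log T - a * Real.log T by ring,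
            Real.exp_sub]
          ring
      _ ≤ _ := by
          gcongr
          linarith

end ZetaStatistics
end

/-! ### Assembly. -/

noncomputable section
namespace ZetaStatistics

theorem average_eq (w : ℝ → ℝ) (T : ℝ) {H : ℝ} (hH : 0 < H) (W : ℝ → ℂ) :
    average w T H W = ∫ x : ℝ, W (T + H * x) * (w x : ℂ) := by
  have e : ∀ τ : ℝ, W τ * (w ((τ - T) / H) / H : ℝ) =
      (fun τ : ℝ => (fun x : ℝ => (1 / H : ℂ) * (W (T + H * x) * (w x : ℂ))) (τ / H)) (τ - T) := by
    intro τ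
    have hH' : (H : ℂ) ≠ 0 := by exact_mod_cast hH.ne'
    simp only
    rw [mul_div_cancel₀ _ hH.ne', add_sub_cancel]
    push_cast
    ring
  rw [average]
  simp_rw [e]
  rw [integral_sub_right_eq_self (fun τ : ℝ => (fun x : ℝ => (1 / H : ℂ) * (W (T + H * x) * (w x : ℂ))) (τ / H)) T,
    Measure.integral_comp_div (fun x : ℝ => (1 / H : ℂ) * (W (T + H * x) * (w x : ℂ))), integral_const_mul,
    abs_of_pos hH, Complex.real_smul]
  have hH' : (H : ℂ) ≠ 0 := by exact_mod_cast hH.ne'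
  field_simp

theorem integrable_average_iff (w : ℝ → ℝ) (T : ℝ) {H : ℝ} (hH : 0 < H) (W : ℝ → ℂ)
    (h : Integrable fun x : ℝ => W (T + H * x) * (w x : ℂ)) :
    Integrable fun τ : ℝ => W τ * (w ((τ - T) / H) / H : ℝ) := by
  have h1 := (((h.const_mul (1 / H : ℂ)).comp_div hH.ne').comp_sub_right T)
  refine h1.congr (Eventually.of_forall fun τ => ?_)
  simp only
  rw [mul_div_cancel₀ _ hH.ne', add_sub_cancel]
  push_cast
  ring

/-- A compact set in an open interval stays away from its ends. The strict inequality b < c is what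
leaves a power of T to spare. -/
theorem exists_lt_support_bound {g : ℝ → ℂ} (hg : HasCompactSupport g) {c : ℝ} (hc : 0 < c)
    (h : tsupport g ⊆ Set.Ioo (-c) c) : ∃ b : ℝ, 0 ≤ b ∧ b < c ∧ ∀ u, b < |u| → g u = 0 := by
  rcases (tsupport g).eq_empty_or_nonempty with he | hne
  · refine ⟨0, le_rfl, hc, fun u _ => image_eq_zero_of_notMem_tsupport ?_⟩
    rw [he]
    exact Set.notMem_empty u
  · obtain ⟨u₀, hu₀, hmax⟩ := hg.isCompact.exists_isMaxOn hne continuous_abs.continuousOn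
    refine ⟨|u₀|, abs_nonneg _, abs_lt.2 (h hu₀), fun u hu => image_eq_zero_of_notMem_tsupport fun hmem => ?_⟩
    exact absurd (hmax hmem) (not_le.2 hu)

theorem zeroStat_eq {f : ℝ → ℝ} (hf : ∀ x, f (-x) = f x) (hs : ContDiff ℝ ∞ (hat f))
    (hc : HasCompactSupport (hat f)) {b : ℝ} (hb : ∀ u, b < |u| → hat f u = 0) {T : ℝ} (hT : 1 < T) (τ : ℝ) :
    zeroStat f T τ =
      (trigSum (coeff (fun u => (hat f u).re) (Real.log T)) (cutoff b (Real.log T)) τ : ℂ) +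
        archErr (fun u => (hat f u).re) (Real.log T) τ + poleTerm (fun u => (hat f u).re) (Real.log T) τ := by
  rw [zeroStat, (hasSum_zeroTerm hf hs hc hb hT τ (exp_lt_cutoff b _)).tsum_eq,
    trigSum_coeff _ _ (two_le_cutoff _ _), archErr]
  push_cast
  ring

theorem exists_norm_decomposition_le {φ : ℝ → ℝ} (hφ : ContDiff ℝ ∞ φ) (hc : HasCompactSupport φ) {b : ℝ}
    (hb : ∀ u, b < |u| → φ u = 0) {L : ℝ} (hL : 0 < L) :
    ∃ C : ℝ, 0 ≤ C ∧ ∀ τ : ℝ, ‖(trigSum (coeff φ L) (cutoff b L) τ : ℂ) + archErr φ L τ + poleTerm φ L τ‖ ≤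
      C * (1 + Real.log (1 + |τ|)) := by
  obtain ⟨C₂, hC₂, hM⟩ := exists_norm_archTerm_le hφ hc
  obtain ⟨C₃, hC₃, hP⟩ := exists_norm_poleTerm_le hφ hc hb 0
  have hS0 : 0 ≤ ∑ n ∈ Finset.range (cutoff b L), |coeff φ L n| := Finset.sum_nonneg fun _ _ => abs_nonneg _
  refine ⟨(∑ n ∈ Finset.range (cutoff b L), |coeff φ L n|) + C₂ * (1 + 1 / L) / L + |φ 0| +
    C₃ * Real.exp (b * L / 2), by positivity, fun τ => ?_⟩
  have hl : 0 ≤ Real.log (1 + |τ|) := Real.log_nonneg (by linarith [abs_nonneg τ])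
  have h1 : ‖(trigSum (coeff φ L) (cutoff b L) τ : ℂ)‖ ≤ ∑ n ∈ Finset.range (cutoff b L), |coeff φ L n| := by
    rw [Complex.norm_real]
    exact abs_trigSum_le _ _ _
  have h2 : ‖archErr φ L τ‖ ≤ C₂ * (1 + 1 / L) / L * (1 + Real.log (1 + |τ|)) + |φ 0| := by
    rw [archErr]
    refine (norm_sub_le _ _).trans ?_
    rw [Complex.norm_real, Real.norm_eq_abs]
    gcongr
    exact hM L hL τ
  have h3 : ‖poleTerm φ L τ‖ ≤ C₃ * Real.exp (b * L / 2) := by simpa using hP L hL τ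
  have h4 : 0 ≤ (∑ n ∈ Finset.range (cutoff b L), |coeff φ L n|) + |φ 0| + C₃ * Real.exp (b * L / 2) := by
    positivity
  refine (norm_add₃_le).trans ?_
  nlinarith [mul_nonneg h4 hl]

theorem measurable_decomposition {φ : ℝ → ℝ} (hφ : ContDiff ℝ ∞ φ) (hc : HasCompactSupport φ) (b L : ℝ) :
    Measurable fun τ : ℝ => (trigSum (coeff φ L) (cutoff b L) τ : ℂ) + archErr φ L τ + poleTerm φ L τ := by
  have h1 := (continuous_trigSum (coeff φ L) (cutoff b L)).measurable
  have h2 : Measurable (archErr φ L) := (measurable_archTerm_modulated hφ.continuous L).sub_const _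
  have h3 := (continuous_poleTerm hφ hc L).measurable
  fun_prop

/-- For fixed L the statistic grows at most like log(1 + |τ|), so its k-th power is controlled by
the logarithmic moments of w up to order m. -/
theorem integrable_decomposition_pow_mul {φ : ℝ → ℝ} (hφ : ContDiff ℝ ∞ φ) (hc : HasCompactSupport φ) {b : ℝ}
    (hb : ∀ u, b < |u| → φ u = 0) {L : ℝ} (hL : 0 < L) {w : ℝ → ℝ} (hw : IsWeight w) {m : ℕ}
    (hl : Integrable fun x : ℝ => Real.log (1 + |x|) ^ m * w x) {k : ℕ} (hk : k ≤ m) (T H : ℝ) :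
    Integrable fun x : ℝ => ((trigSum (coeff φ L) (cutoff b L) (T + H * x) : ℂ) + archErr φ L (T + H * x) +
      poleTerm φ L (T + H * x)) ^ k * (w x : ℂ) := by
  obtain ⟨C, hC, h⟩ := exists_norm_decomposition_le hφ hc hb hL
  set R := 1 + |T| + |H| with hR
  have hR1 : 1 ≤ R := by
    have := abs_nonneg T
    have := abs_nonneg H
    linarith
  have hlR : 0 ≤ Real.log R := Real.log_nonneg hR1
  refine ((integrable_log_pow_mul hw hl hk).const_mul ((C * (1 + Real.log R)) ^ k)).mono' ?_
    (Eventually.of_forall fun x => ?_)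
  · have h1 := (measurable_decomposition hφ hc b L).comp (show Measurable fun x : ℝ => T + H * x by fun_prop)
    exact (h1.pow_const k).aestronglyMeasurable.mul
      (Complex.continuous_ofReal.comp_aestronglyMeasurable hw.integrable.aestronglyMeasurable)
  · have hx := abs_nonneg x
    have hlx : 0 ≤ Real.log (1 + |x|) := Real.log_nonneg (by linarith)
    have h2 : Real.log (1 + |T + H * x|) ≤ Real.log R + Real.log (1 + |x|) := by
      rw [← Real.log_mul (by linarith) (by linarith)]
      refine Real.log_le_log (by positivity) ?_
      have h3 := abs_add_le T (H * x)
      rw [abs_mul] at h3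
      rw [hR]
      nlinarith [abs_nonneg T, abs_nonneg H, mul_nonneg (abs_nonneg T) hx]
    have hwx := hw.nonneg x
    rw [norm_mul, norm_pow, Complex.norm_real, Real.norm_of_nonneg hwx, ← mul_assoc, ← mul_pow]
    gcongr
    refine (h _).trans ?_
    rw [mul_assoc]
    gcongr
    nlinarith

theorem sigmaSq_eq {f : ℝ → ℝ} (hf : ∀ x, f (-x) = f x) {b : ℝ} (hb1 : b ≤ 1)
    (hb : ∀ u, b < |u| → hat f u = 0) : sigmaSq f = ∫ u in Set.Ioi 0, u * (2 * (hat f u).re ^ 2) := by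
  have h := integral_comp_abs (f := fun u => min u 1 * (hat f u).re ^ 2)
  have e : ∀ u : ℝ, min |u| 1 * (hat f |u|).re ^ 2 = min |u| 1 * (hat f u).re ^ 2 := by
    intro u
    rcases abs_choice u with h | h <;> rw [h]
    rw [hat_neg_of_even hf]
  simp_rw [e] at h
  rw [sigmaSq, h, ← integral_const_mul]
  refine setIntegral_congr_fun measurableSet_Ioi fun u hu => ?_
  have hu0 : 0 < u := hu
  by_cases hbu : b < |u|
  · rw [hb u hbu]
    simp
  · rw [not_lt, abs_of_pos hu0] at hbu
    rw [min_eq_left (hbu.trans hb1)]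
    ring

theorem tendsto_integral_decomposition_pow {φ : ℝ → ℝ} (hφ : ContDiff ℝ ∞ φ) (hc : HasCompactSupport φ) {b : ℝ}
    (hb0 : 0 ≤ b) (hb : ∀ u, b < |u| → φ u = 0) {a : ℝ} (ha1 : a ≤ 1) {m : ℕ} (hm : 1 ≤ m)
    (hbm : b * m < 2 * a) {w : ℝ → ℝ} (hw : IsWeight w)
    (hl : Integrable fun x : ℝ => Real.log (1 + |x|) ^ m * w x) {v : NNReal}
    (hv : (v : ℝ) = ∫ u in Set.Ioi 0, u * (2 * φ u ^ 2)) {k : ℕ} (hk : k ≤ m) :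
    Tendsto (fun T : ℝ => ∫ x : ℝ, ((trigSum (coeff φ (Real.log T)) (cutoff b (Real.log T)) (T + T ^ a * x) : ℂ) +
      archErr φ (Real.log T) (T + T ^ a * x) + poleTerm φ (Real.log T) (T + T ^ a * x)) ^ k * (w x : ℂ)) atTop
      (𝓝 ((∫ x, x ^ k ∂(gaussianReal (φ 0) v) : ℝ) : ℂ)) := by
  rcases k with _ | j
  · simp [integral_complex_ofReal, hw.integral_eq_one]
  obtain ⟨B, hB0, hB⟩ := exists_bandLimited hw
  obtain ⟨G₁, hG₁i, hG₁, hG₁lim⟩ := exists_arch_majorant hφ hc hb0 hb ha1 hm hbm hw hl hv hk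
  obtain ⟨G₂, hG₂i, hG₂, hG₂lim⟩ := exists_pole_majorant hφ hc hb0 hb hbm hw hk
  have hD := (tendsto_torusSum_moment hφ hb0 hb hv (j + 1)).comp Real.tendsto_log_atTop
  have hD' := (Complex.continuous_ofReal.tendsto _).comp hD
  refine tendsto_of_tendsto_of_dist hD' ?_
  have hsum := hG₁lim.add hG₂lim
  rw [add_zero] at hsum
  refine squeeze_zero' (Eventually.of_forall fun _ => dist_nonneg) ?_ hsum
  filter_upwards [hG₁i, hG₁, hG₂i, hG₂, eventually_gap hb0 hbm B, eventually_gt_atTop 1] with T i₁ h₁ i₂ h₂ hgap hT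
  have hT0 : 0 < T := by linarith
  have hL0 : 0 < Real.log T := Real.log_pos hT
  set L := Real.log T with hL
  set S : ℝ → ℝ := fun x => trigSum (coeff φ L) (cutoff b L) (T + T ^ a * x) with hS
  have hSw : ∫ x, S x ^ (j + 1) * w x = ∫ θ, torusSum (coeff φ L) (cutoff b L) θ ^ (j + 1) ∂(torus (cutoff b L)) := by
    -- The gap is available for bands of width B + log T, so the band of w is enlarged to match.
    have h := integral_trigSum_pow_mul (N := cutoff b L) (k := j + 1) (Real.exp_pos (b * L))
      (fun k hk => le_exp_of_coeff_ne_zero hb0 hb hL0 hk) hw.integrable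
      (hB.mono (show B ≤ B + L by linarith)) (Real.rpow_pos_of_pos hT0 a) (hgap _ hk) T
    rw [hw.integral_eq_one, mul_one] at h
    exact h
  have hSi : Integrable fun x => S x ^ (j + 1) * w x := by
    have hSc : Continuous S := (continuous_trigSum _ _).comp (by fun_prop)
    refine hw.integrable.bdd_mul (hSc.pow _).aestronglyMeasurable
      (c := (∑ n ∈ Finset.range (cutoff b L), |coeff φ L n|) ^ (j + 1)) (Eventually.of_forall fun x => ?_)
    rw [norm_pow]
    exact pow_le_pow_left₀ (norm_nonneg _) (abs_trigSum_le _ _ _) _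
  have hSi' : Integrable fun x => (S x : ℂ) ^ (j + 1) * (w x : ℂ) := by
    have h : Integrable fun x => ((S x ^ (j + 1) * w x : ℝ) : ℂ) := hSi.ofReal
    refine h.congr (Eventually.of_forall fun x => ?_)
    simp only
    push_cast
    rfl
  have hNi := integrable_decomposition_pow_mul hφ hc hb hL0 hw hl hk T (T ^ a)
  rw [dist_eq_norm, norm_sub_rev]
  simp only [Function.comp_apply]
  rw [← hL, ← hSw, ← integral_complex_ofReal]
  have e : ∫ x, ((S x ^ (j + 1) * w x : ℝ) : ℂ) = ∫ x, (S x : ℂ) ^ (j + 1) * (w x : ℂ) := by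
    congr 1 with x
    push_cast
    rfl
  rw [e, ← integral_sub hNi hSi', ← integral_add i₁ i₂]
  refine norm_integral_le_of_norm_le (i₁.add i₂) (Eventually.of_forall fun x => ?_)
  have hwx := hw.nonneg x
  rw [← sub_mul, norm_mul, Complex.norm_real, Real.norm_of_nonneg hwx]
  refine le_trans ?_ (add_le_add (h₁ x) (h₂ x))
  rw [← add_mul]
  gcongr
  rw [add_comm]
  refine le_trans (le_of_eq ?_) (norm_add_le _ _)
  congr 1
  simp only [hS]
  ring

/-- Needed for m = 1, where the support of f̂ may leave [-1,1] and the variance of the model need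
not be σ_f². -/
theorem gaussian_moment_congr {μ : ℝ} {v v' : NNReal} {k : ℕ} (h : 2 ≤ k → v = v') :
    ∫ x, x ^ k ∂(gaussianReal μ v) = ∫ x, x ^ k ∂(gaussianReal μ v') := by
  rcases k with _ | _ | k
  · simp
  · simp
  · rw [h (by omega)]

end ZetaStatistics
end

open ZetaStatistics in
theorem theorem1 (a : ℝ) (ha₀ : 0 < a) (ha₁ : a ≤ 1) (m : ℕ) (hm : 1 ≤ m)
    (f : ℝ → ℝ) (hf_cont : Continuous f) (hf_int : Integrable f)
    (hf_even : ∀ x, f (-x) = f x)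
    (hf_smooth : ContDiff ℝ ∞ (hat f)) (hf_compact : HasCompactSupport (hat f))
    (hf_supp : tsupport (hat f) ⊆ Set.Ioo (-(2 * a / m)) (2 * a / m))
    (w : ℝ → ℝ) (hw : IsWeight w)
    (hw_log : Integrable fun x : ℝ => Real.log (1 + |x|) ^ m * w x) :
    (∀ T : ℝ, 1 < T → ∀ τ : ℝ, Summable fun ρ : nontrivialZeros => zeroTerm f T τ ρ) ∧
    ∀ k : ℕ, k ≤ m →
      (∀ T : ℝ, 1 < T →
        Integrable fun τ : ℝ => zeroStat f T τ ^ k * (w ((τ - T) / T ^ a) / T ^ a : ℝ)) ∧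
      Tendsto (fun T : ℝ => average w T (T ^ a) fun τ => zeroStat f T τ ^ k) atTop
        (𝓝 ((∫ x, x ^ k ∂(gaussianReal (∫ x, f x) ⟨sigmaSq f, sigmaSq_nonneg f⟩) : ℝ) : ℂ)) := by
  have hm0 : (0 : ℝ) < m := by exact_mod_cast hm
  obtain ⟨b, hb0, hb2, hb⟩ := exists_lt_support_bound hf_compact (by positivity : 0 < 2 * a / m) hf_supp
  have hbm : b * m < 2 * a := (lt_div_iff₀ hm0).1 hb2
  set φ : ℝ → ℝ := fun u => (hat f u).re with hφdef
  have hφ : ContDiff ℝ ∞ φ := Complex.reCLM.contDiff.comp hf_smooth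
  have hφc : HasCompactSupport φ := hf_compact.comp_left (g := Complex.re) rfl
  have hφb : ∀ u, b < |u| → φ u = 0 := fun u hu => by rw [hφdef]; simp only; rw [hb u hu, Complex.zero_re]
  have hφ0 : φ 0 = ∫ x, f x := by rw [hφdef]; simp only; rw [hat_zero, Complex.ofReal_re]
  have hstat : ∀ T : ℝ, 1 < T → ∀ τ, zeroStat f T τ = (trigSum (coeff φ (Real.log T)) (cutoff b (Real.log T)) τ : ℂ) +
      archErr φ (Real.log T) τ + poleTerm φ (Real.log T) τ := fun T hT τ =>
    zeroStat_eq hf_even hf_smooth hf_compact hb hT τ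
  refine ⟨fun T hT τ => (hasSum_zeroTerm hf_even hf_smooth hf_compact hb hT τ (exp_lt_cutoff b _)).summable,
    fun k hk => ⟨fun T hT => ?_, ?_⟩⟩
  · refine integrable_average_iff w T (Real.rpow_pos_of_pos (by linarith) a) (fun τ => zeroStat f T τ ^ k) ?_
    simp_rw [hstat T hT]
    exact integrable_decomposition_pow_mul hφ hφc hφb (Real.log_pos hT) hw hw_log hk T (T ^ a)
  · set v : NNReal := ⟨∫ u in Set.Ioi 0, u * (2 * φ u ^ 2),
      setIntegral_nonneg measurableSet_Ioi fun u hu => mul_nonneg (le_of_lt hu) (by positivity)⟩ with hv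
    have hlim := tendsto_integral_decomposition_pow hφ hφc hb0 hφb ha₁ hm hbm hw hw_log (v := v) rfl hk
    rw [hφ0, gaussian_moment_congr (v' := ⟨sigmaSq f, sigmaSq_nonneg f⟩)] at hlim
    · refine hlim.congr' ?_
      filter_upwards [eventually_gt_atTop 1] with T hT
      rw [average_eq w T (Real.rpow_pos_of_pos (by linarith) a)]
      simp_rw [hstat T hT]
    -- k ≥ 2 forces m ≥ 2, so b < 2a/m ≤ 1 and min(|u|,1) = |u| on the support.
    · intro hk2
      have hm2 : (2 : ℝ) ≤ m := by exact_mod_cast hk2.trans hk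
      have hb1 : b ≤ 1 := by nlinarith
      exact Subtype.ext (sigmaSq_eq hf_even hb1 hb).symm
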